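/- **Setting.** Let $\mathcal A,\mathcal B,\mathcal S$ be finite sets ($\mathcal A,\mathcal B$ non-empty), $\mathcal X$ a standard Borel space, $\mathbf Q$ a probability distribution on $\mathcal X\times\mathcal S$, and $m:\mathcal A\times\mathcal B\times\mathcal X\times\mathcal S\to\mathbb R^d$ a bounded Borel function; $\|\cdot\|$ is the Euclidean norm and $M=\|m\|_{\infty,2}=\sup\|m(a,b,x,s)\|$. Let $G(x,s)=x$ or $G(x,s)=(x,s)$. At each round $t\ge1$, contexts $(x_t,s_t)\sim\mathbf Q$ are drawn independently of the past; the Player draws $a_t\sim p_t^{x_t}$ and Nature, independently of the Player's draw, $b_t\sim q_t^{G(x_t,s_t)}$, where $(p_t^x)_x$ is a measurable family of distributions on $\mathcal A$ chosen as a measurable function of $h_{t-1}=(m_{t'},x_{t'},s_{t'})_{t'\le t-1}$, $m_{t'}=m(a_{t'},b_{t'},x_{t'},s_{t'})$, and $(q_t^{G(x,s)})$ is a measurable family of distributions on $\mathcal B$ chosen as a measurable function of $H_{t-1}=(a_{t'},b_{t'},x_{t'},s_{t'})_{t'\le t-1}$. Set $\bar m_t=\frac1t\sum_{t'\le t}m_{t'}$.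 Let $\mathcal C\subseteq\mathbb R^d$ be non-empty, closed and convex, and $d_t=d(\bar m_t,\mathcal C)$. A strategy of the Player *approaches* $\mathcal C$ if $d_t\to0$ a.s. against every strategy of Nature; $\mathcal C$ is *$m$-approachable* if such a strategy exists. Write $m(p,q,x,s)=\sum_{a,b}p(a)q(b)m(a,b,x,s)$. *Blackwell's condition* is: for every measurable family $(q^{G(x,s)})$ there is a measurable family $(p^x)$ with $\int m(p^x,q^{G(x,s)},x,s)\,d\mathbf Q(x,s)\in\mathcal C$. **Estimates and strategy.** Let $\hat{\mathbf Q}_t$ ($t\ge 1$) be $h_t$-measurable random probability distributions on $\mathcal X\times\mathcal S$ and, with $T_r=2^r$, let $\hat{\mathcal C}_r$ ($r\ge0$) be $h_{T_r}$-measurable random non-empty closed convex subsets of $\mathbb R^d$. For $T_r\le t<T_{r+1}$ let $\hat c_t=\mathrm{Proj}_{\hat{\mathcal C}_r}(\bar m_t)$. A *phase-wise projected strategy* plays arbitrarily at round $1$ and, at each round $t+1\ge2$, $$(p^x_{t+1})_x\in\arg\min_{(p^x)}\max_{(q^{G(x,s)})}\Big\langle \bar m_t-\hat c_t,\int m(p^x,q^{G(x,s)},x,s)\,d\hat{\mathbf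 Q}_t(x,s)\Big\rangle .$$ **Assumptions** (for a given pair of strategies of the Player and of Nature, under the law of the play that they induce). With $\mathrm{TV}$ the total variation distance, $\delta_t=\sqrt{\mathbb E[\mathrm{TV}^2(\hat{\mathbf Q}_t,\mathbf Q)]}$ and $d(D,D')=\sup_{x\in D}d(x,D')$: (E1) $\sum_{t\ge1}\delta_t/t<\infty$; (E2) with $B<\infty$ and a non-increasing summable sequence $(\beta_r)_{r\ge0}$: a.s., for all $r$, $\|v-\mathrm{Proj}_{\hat{\mathcal C}_r}(v)\|\le B$ for all $v\in m(\mathcal A,\mathcal B,\mathcal X,\mathcal S)$; and for all $r$, $\mathbb P(\mathcal C\subseteq\hat{\mathcal C}_r)\ge1-\frac1{2T_r}$ and $\max\{\mathbb E[d(\hat{\mathcal C}_r,\mathcal C)^2],\mathbb E[d(\mathcal C,\hat{\mathcal C}_r)^2]\}\le\beta_r^2$. **Theorem.** $\mathcal C$ is $m$-approachable if and only if Blackwell's condition holds. In this case, phase-wise projected strategies exist, and each of them that satisfies (E1) and (E2) (for some $B$, $\beta$) against every strategy of Nature approaches $\mathcal C$. Moreover, let the Player use a phase-wise projected strategy, and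 let Nature use a strategy for which (E1) and (E2) hold with $B$ and $(\beta_r)$. Let $R$ be any number such that a.s., for all $r$, $\|v-\mathrm{Proj}_{\hat{\mathcal C}_r}(w)\|\le R$ for all $v\in m(\mathcal A,\mathcal B,\mathcal X,\mathcal S)$ and all $w$ in the convex hull of this set; $R=B+2M$ always has this property. Put $K=R^2+2B^2+4BM$. Then for all $r\ge1$ and all $t\in[T_r,T_{r+1}-1]$, $$\sqrt{\mathbb E[d_t^2]}\le\frac{\sqrt{2K}}{(\sqrt2-1)\sqrt t}+\frac{4M}{t}\sum_{t'=1}^{t-1}\delta_{t'}+\frac4t\sum_{r'=0}^{r}T_{r'}\beta_{r'},$$ and for all $r\ge1$ and $\varepsilon>0$, $$\mathbb P\Big(\sup_{t\ge T_r}d_t\ge2\varepsilon\Big)\le\frac{\Xi_r}{\varepsilon^2}+\frac1{\varepsilon^2}\sum_{r'\ge r}\beta_{r'}^2,$$ where $$\Xi_r=\Big(1+\tfrac{2}{(\sqrt2-1)^{2}}\Big)\frac{K}{T_r}+16M\frac{\sqrt{2K}}{(\sqrt2-1)\sqrt{T_r-1}}+4B\sum_{r'\ge r}\beta_{r'}+32\big(M\Delta^*_r+\beta^*_r\big)\Big(M\Delta^*_r+\beta^*_r+M\sum_{t\ge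 T_r}\frac{\delta_t}{t}\Big),$$ $$\Delta^*_r=\sup_{t\ge T_r}\frac1t\sum_{t'=1}^{t-1}\delta_{t'},\qquad \beta^*_r=\sup_{r''\ge r}\frac1{T_{r''}}\sum_{r'=0}^{r''-1}T_{r'}\beta_{r'},$$ and $\Xi_r\to0$ as $r\to\infty$. -/

import Mathlib

open MeasureTheory ProbabilityTheory Filter Topology Metric
open scoped ENNReal

noncomputable section

namespace FairApproach

/-- The space `ℝ^d` of vector payoffs, with the Euclidean norm. -/
abbrev Vec (d : ℕ) : Type := EuclideanSpace ℝ (Fin d)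

/-- The outcome `((x, s), (a, b))` of one round: the contexts and the two pure actions. -/
abbrev Outcome (A B X S : Type*) := (X × S) × (A × B)

/-- What the Player sees of one round: the reward and the two contexts. -/
abbrev Seen (X S : Type*) (d : ℕ) := Vec d × X × S

section Sets

variable {d : ℕ}

/-- The Euclidean projection of `v` onto `D`: a point of `D` at minimal distance from `v`.
It exists and is unique if `D` is non-empty, closed and convex
(the value for other sets is irrelevant). -/
def proj (D : Set (Vec d)) (v : Vec d) : Vec d :=
  open Classical in
  if h : ∃ c ∈ D, ‖v - c‖ = infDist v D then h.choose else v

/-- The one-sided Hausdorff distance `d(D, D') = sup_{x ∈ D} d(x, D')`, possibly infinite. -/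
def excess (D D' : Set (Vec d)) : ℝ≥0∞ := ⨆ x ∈ D, infEDist x D'

end Sets

/-- The total variation distance `sup_E |μ(E) - ν(E)|` over measurable sets `E`. -/
def tvDist {Z : Type*} [MeasurableSpace Z] (μ ν : Measure Z) : ℝ :=
  ⨆ E : {E : Set Z // MeasurableSet E}, |μ.real E - ν.real E|

variable {A B X S Y : Type*} {d : ℕ}
  [MeasurableSpace A] [MeasurableSpace B] [MeasurableSpace X] [MeasurableSpace S]
  [MeasurableSpace Y]

variable (A B X S Y d) in
/-- The data of the repeated game: a bounded Borel payoff function `m`, the law `Q` of the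
contexts, and the observation operator `G` of Nature, which reveals (up to renaming) either the
non-sensitive context `x` alone or the pair `(x, s)`. -/
structure Game where
  /-- the vector payoff function `m(a, b, x, s)` -/
  payoff : A → B → X → S → Vec d
  measurable_payoff :
    Measurable fun o : Outcome A B X S => payoff o.2.1 o.2.2 o.1.1 o.1.2
  bounded_payoff : ∃ M : ℝ, ∀ a b x s, ‖payoff a b x s‖ ≤ M
  /-- the law `Q` of the pair of contexts -/
  ctx : Measure (X × S)
  isProbabilityMeasure_ctx : IsProbabilityMeasure ctx
  /-- the observation operator `G` -/
  obs : X × S → Y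
  obs_spec : (∃ e : Y ≃ᵐ X, ∀ z, e (obs z) = z.1) ∨ (∃ e : Y ≃ᵐ X × S, ∀ z, e (obs z) = z)

variable (A X S d) in
/-- A strategy of the Player: `mix t` is the family of mixed actions `p_{t+1}^x`, as a measurable
function of the history `h_t` of the Player and of the context `x`. -/
structure PlayerStrategy where
  mix : ∀ t : ℕ, Kernel ((Fin t → Seen X S d) × X) A
  isMarkov : ∀ t, IsMarkovKernel (mix t)

variable (A B X S Y) in
/-- A strategy of Nature: `mix t` is the family of mixed actions `q_{t+1}^{G(x,s)}`, as a
measurable function of the full history `H_t` and of the observation `G(x, s)`. -/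
structure NatureStrategy where
  mix : ∀ t : ℕ, Kernel ((Fin t → Outcome A B X S) × Y) B
  isMarkov : ∀ t, IsMarkovKernel (mix t)

variable (X S d) in
/-- A sequence of estimators of the target set: for each `r`, a random non-empty closed convex set
that is a (Borel) measurable function of the history of the Player after `2 ^ r` rounds. -/
structure SetEstimator where
  set : ∀ r : ℕ, (Fin (2 ^ r) → Seen X S d) → Set (Vec d)
  nonempty : ∀ r h, (set r h).Nonempty
  isClosed : ∀ r h, IsClosed (set r h)
  convex : ∀ r h, Convex ℝ (set r h)
  measurable : ∀ r (U : Set (Vec d)), IsOpen U → MeasurableSet {h | (set r h ∩ U).Nonempty}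

/-- Average reward along a history of the Player. -/
def avg {t : ℕ} (h : Fin t → Seen X S d) : Vec d := (1 / (t : ℝ)) • ∑ i, (h i).1

/-- The phase `r` of a round `t ≥ 1` is the `r` such that `2 ^ r ≤ t < 2 ^ (r + 1)`; this is the
estimate of the target set in force after round `t`, computed from the first `2 ^ r` rounds. -/
def SetEstimator.current (Chat : SetEstimator X S d) {t : ℕ} (ht : t ≠ 0)
    (h : Fin t → Seen X S d) : Set (Vec d) :=
  Chat.set (Nat.log 2 t) fun i => h (Fin.castLE (Nat.pow_log_le_self 2 ht) i)

namespace Game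

variable (Γ : Game A B X S Y d)

theorem measurable_obs : Measurable Γ.obs := by
  rcases Γ.obs_spec with ⟨e, he⟩ | ⟨e, he⟩
  · have : Γ.obs = fun z => e.symm z.1 := by
      funext z; rw [← he z, e.symm_apply_apply]
    rw [this]; exact e.symm.measurable.comp measurable_fst
  · have : Γ.obs = fun z => e.symm z := by
      funext z; conv_rhs => rw [← he z, e.symm_apply_apply]
    rw [this]; exact e.symm.measurable

/-- What the Player sees of an outcome. -/
def see (o : Outcome A B X S) : Seen X S d := (Γ.payoff o.2.1 o.2.2 o.1.1 o.1.2, o.1)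

theorem measurable_see : Measurable Γ.see := Γ.measurable_payoff.prodMk measurable_fst

/-- The history `h_t` of the Player, read off the full history `H_t`. -/
def seeAll {t : ℕ} (H : Fin t → Outcome A B X S) : Fin t → Seen X S d := fun i => Γ.see (H i)

theorem measurable_seeAll {t : ℕ} :
    Measurable (Γ.seeAll : (Fin t → Outcome A B X S) → Fin t → Seen X S d) :=
  measurable_pi_lambda _ fun i => Γ.measurable_see.comp (measurable_pi_apply i)

/-- The set `m(A, B, X, S)` of payoffs. -/
def payoffs : Set (Vec d) := {v | ∃ a b x s, Γ.payoff a b x s = v}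

/-- The sup-norm `‖m‖_{∞,2}` of the payoff function. -/
def supNorm : ℝ := ⨆ z : Outcome A B X S, ‖Γ.payoff z.2.1 z.2.2 z.1.1 z.1.2‖

/-- Law of the outcome of a round given the full history: the contexts are drawn from `Q`
independently of the past, then the two actions are drawn independently of each other. -/
def step (σ : PlayerStrategy A X S d) (τ : NatureStrategy A B X S Y) (t : ℕ) :
    Kernel (Fin t → Outcome A B X S) (Outcome A B X S) :=
  Kernel.const _ Γ.ctx ⊗ₖ
    (((σ.mix t).comap (fun w => (Γ.seeAll w.1, w.2.1))
        ((Γ.measurable_seeAll.comp measurable_fst).prodMk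
          (measurable_fst.comp measurable_snd))) ×ₖ
      ((τ.mix t).comap (fun w => (w.1, Γ.obs w.2))
        (measurable_fst.prodMk (Γ.measurable_obs.comp measurable_snd))))

instance isMarkovKernel_step (σ : PlayerStrategy A X S d) (τ : NatureStrategy A B X S Y)
    (t : ℕ) : IsMarkovKernel (Γ.step σ τ t) := by
  have := Γ.isProbabilityMeasure_ctx
  have := σ.isMarkov t
  have := τ.isMarkov t
  unfold step
  infer_instance

/-- `step`, with the history of the first `n + 1` rounds indexed by `{0, …, n}`. -/
def stepIic (σ : PlayerStrategy A X S d) (τ : NatureStrategy A B X S Y) (n : ℕ) :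
    Kernel ((i : Finset.Iic n) → (fun _ : ℕ => Outcome A B X S) i) (Outcome A B X S) :=
  (Γ.step σ τ (n + 1)).comap
    (fun w i => w ⟨i, Finset.mem_Iic.2 (Nat.lt_succ_iff.1 i.2)⟩)
    (measurable_pi_lambda _ fun _ => measurable_pi_apply _)

instance isMarkovKernel_stepIic (σ : PlayerStrategy A X S d) (τ : NatureStrategy A B X S Y)
    (n : ℕ) : IsMarkovKernel (Γ.stepIic σ τ n) := by
  unfold stepIic
  infer_instance

/-- Law of the infinite play (Ionescu-Tulcea); the coordinate `ω n` is the outcome of round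
`n + 1`. -/
def law (σ : PlayerStrategy A X S d) (τ : NatureStrategy A B X S Y) :
    Measure (ℕ → Outcome A B X S) :=
  Measure.bind ((Γ.step σ τ 0 Fin.elim0).map fun o _ => o)
    (Kernel.traj (X := fun _ => Outcome A B X S) (Γ.stepIic σ τ) 0)

/-- The history `h_t` of the Player along a play. -/
def hist (t : ℕ) (ω : ℕ → Outcome A B X S) : Fin t → Seen X S d := fun i => Γ.see (ω i)

/-- The distance `d_t` of the average payoff to the target set. -/
def dist (C : Set (Vec d)) (t : ℕ) (ω : ℕ → Outcome A B X S) : ℝ := infDist (avg (Γ.hist t ω)) C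

/-- The strategy `σ` of the Player approaches `C` almost surely, against all strategies of
Nature. -/
def Approaches (σ : PlayerStrategy A X S d) (C : Set (Vec d)) : Prop :=
  ∀ τ : NatureStrategy A B X S Y,
    ∀ᵐ ω ∂Γ.law σ τ, Tendsto (fun t => Γ.dist C t ω) atTop (𝓝 0)

/-- `C` is `m`-approachable by the Player under the distribution `Q`. -/
def Approachable (C : Set (Vec d)) : Prop := ∃ σ : PlayerStrategy A X S d, Γ.Approaches σ C

section Mixed

variable [Fintype A] [Fintype B]

/-- The linear extension `m(p, q, x, s)` of the payoff function. -/
def mixedPayoff (p : Measure A) (q : Measure B) (x : X) (s : S) : Vec d :=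
  ∑ a, ∑ b, (p.real {a} * q.real {b}) • Γ.payoff a b x s

/-- `∫ m(p^x, q^{G(x,s)}, x, s) dQ'(x, s)` for measurable families `p`, `q`. -/
def meanPayoff (Q' : Measure (X × S)) (p : Kernel X A) (q : Kernel Y B) : Vec d :=
  ∫ z, Γ.mixedPayoff (p z.1) (q (Γ.obs z)) z.1 z.2 ∂Q'

/-- Blackwell's condition. -/
def Blackwell (C : Set (Vec d)) : Prop :=
  ∀ q : Kernel Y B, IsMarkovKernel q →
    ∃ p : Kernel X A, IsMarkovKernel p ∧ Γ.meanPayoff Γ.ctx p q ∈ C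

/-- `max_q ⟨u, ∫ m(p^x, q^{G(x,s)}, x, s) dQ'(x, s)⟩` over measurable families `q`. -/
def worst (u : Vec d) (Q' : Measure (X × S)) (p : Kernel X A) : ℝ :=
  ⨆ q : {q : Kernel Y B // IsMarkovKernel q}, inner ℝ u (Γ.meanPayoff Q' p q)

/-- The phase-wise projected strategies: arbitrary at the first round, and such that for `t ≥ 1`
the family played at round `t + 1` is an argmin of
`max_q ⟨m̄_t - ĉ_t, ∫ m(p^x, q^{G(x,s)}, x, s) dQ̂_t(x, s)⟩`, where `ĉ_t` is the projection of
`m̄_t` onto the current estimate of the target set. -/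
def IsPhaseStrategy (Qhat : ∀ t : ℕ, Kernel (Fin t → Seen X S d) (X × S))
    (Chat : SetEstimator X S d) (σ : PlayerStrategy A X S d) : Prop :=
  ∀ (t : ℕ) (ht : t ≠ 0) (h : Fin t → Seen X S d) (p : Kernel X A), IsMarkovKernel p →
    Γ.worst (avg h - proj (Chat.current ht h) (avg h)) (Qhat t h) ((σ.mix t).sectR h) ≤
      Γ.worst (avg h - proj (Chat.current ht h) (avg h)) (Qhat t h) p

end Mixed

section Assumptions

variable (Qhat : ∀ t : ℕ, Kernel (Fin t → Seen X S d) (X × S)) (Chat : SetEstimator X S d)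
  (C : Set (Vec d)) (σ : PlayerStrategy A X S d) (τ : NatureStrategy A B X S Y)

/-- The `L²` error `√(E[TV²(Q̂_t, Q)])` of the estimation of `Q`. -/
def tvErr (t : ℕ) : ℝ := √(∫ ω, tvDist (Qhat t (Γ.hist t ω)) Γ.ctx ^ 2 ∂Γ.law σ τ)

/-- Fast enough sequential estimation of `Q` (the term of index `0` is `0`). -/
def FastEstimation : Prop := Summable fun t : ℕ => 1 / (t : ℝ) * Γ.tvErr Qhat σ τ t

/-- The requirements on the estimation of the target set. -/
structure SetEstimation (B' : ℝ) (β : ℕ → ℝ) : Prop where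
  antitone : Antitone β
  summable : Summable β
  proj_dist : ∀ᵐ ω ∂Γ.law σ τ, ∀ r, ∀ v ∈ Γ.payoffs,
    ‖v - proj (Chat.set r (Γ.hist (2 ^ r) ω)) v‖ ≤ B'
  superset : ∀ r : ℕ,
    1 - 1 / (2 * 2 ^ r : ℝ) ≤ (Γ.law σ τ).real {ω | C ⊆ Chat.set r (Γ.hist (2 ^ r) ω)}
  excess_left : ∀ r : ℕ,
    ∫⁻ ω, excess (Chat.set r (Γ.hist (2 ^ r) ω)) C ^ 2 ∂Γ.law σ τ ≤ ENNReal.ofReal (β r ^ 2)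
  excess_right : ∀ r : ℕ,
    ∫⁻ ω, excess C (Chat.set r (Γ.hist (2 ^ r) ω)) ^ 2 ∂Γ.law σ τ ≤ ENNReal.ofReal (β r ^ 2)

/-- `R` bounds the distances between payoffs and projections, onto the estimated sets, of points
of the convex hull of the payoffs. -/
def StepBound (R : ℝ) : Prop :=
  ∀ᵐ ω ∂Γ.law σ τ, ∀ r, ∀ v ∈ Γ.payoffs, ∀ w ∈ convexHull ℝ Γ.payoffs,
    ‖v - proj (Chat.set r (Γ.hist (2 ^ r) ω)) w‖ ≤ R

end Assumptions

end Game

section Rates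

/-- The constant `R² + 2B² + 4BM`, which equals `3B² + 4BM` for `R = B`. -/
def rateConst (M B R : ℝ) : ℝ := R ^ 2 + 2 * B ^ 2 + 4 * B * M

/-- The `L²` rate, for `2 ^ r ≤ t < 2 ^ (r + 1)`; `δ t` stands for `√(E[TV²(Q̂_t, Q)])`. -/
def l2Rate (M B R : ℝ) (β δ : ℕ → ℝ) (r t : ℕ) : ℝ :=
  √(2 * rateConst M B R) / ((√2 - 1) * √t)
    + 4 * M / t * ∑ t' ∈ Finset.Ico 1 t, δ t'
    + 4 / t * ∑ r' ∈ Finset.range (r + 1), 2 ^ r' * β r'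

/-- `sup_{t ≥ T} (1/t) ∑_{t'=1}^{t-1} δ_{t'}`. -/
def deltaStar (δ : ℕ → ℝ) (T : ℕ) : ℝ :=
  ⨆ t : {t : ℕ // T ≤ t}, 1 / ((t : ℕ) : ℝ) * ∑ t' ∈ Finset.Ico 1 (t : ℕ), δ t'

/-- `sup_{r'' ≥ r} (1/T_{r''}) ∑_{r'=0}^{r''-1} T_{r'} β_{r'}`, where `T_r = 2 ^ r`. -/
def betaStar (β : ℕ → ℝ) (r : ℕ) : ℝ :=
  ⨆ k : {k : ℕ // r ≤ k}, 1 / (2 : ℝ) ^ (k : ℕ) * ∑ r' ∈ Finset.range (k : ℕ), 2 ^ r' * β r'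

/-- The quantity `Ξ_r` of the almost-sure rate. -/
def xi (M B R : ℝ) (β δ : ℕ → ℝ) (r : ℕ) : ℝ :=
  (1 + 2 / (√2 - 1) ^ 2) * (rateConst M B R / 2 ^ r)
    + 16 * M * (√(2 * rateConst M B R) / ((√2 - 1) * √(2 ^ r - 1)))
    + 4 * B * ∑' k, β (r + k)
    + 32 * (M * deltaStar δ (2 ^ r) + betaStar β r) *
      (M * deltaStar δ (2 ^ r) + betaStar β r
        + M * ∑' k : ℕ, 1 / ((2 ^ r + k : ℕ) : ℝ) * δ (2 ^ r + k))

end Rates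

end FairApproach

end

set_option linter.unusedSectionVars false

/-! Sufficiency is Blackwell's projection argument with two sources of error. Let D_t be the
distance from m̄_t to the current estimate Ĉ_r. Using ĉ_t as a competitor for the projection of
m̄_{t+1} and expanding the square gives (t+1)² D_{t+1}² ≤ t² D_t² + R² + 2t ⟨m̄_t - ĉ_t, m_{t+1} -
ĉ_t⟩. If C ⊆ Ĉ_r, the minimax choice of the Player, Blackwell's condition and the obtuse angle at
ĉ_t bound the conditional mean of the inner product by 4M D_t TV(Q̂_t, Q)
(`IsPhaseStrategy.inner_condMean_le`). The opposite event has probability at most 1/(2T_r) and costs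
a constant, the part 2B² + 4BM of K. When the phase changes, the distance moves by at most d(Ĉ_r, C)
+ d(C, Ĉ_{r+1}), whose L² norm is at most 2β_r. By induction, the L² norm of t D_t is at most √(tK)
plus the accumulated 4Mδ_s and 4T_sβ_s (`IsPhaseStrategy.mul_curNorm_le`).

The same one-round inequality, integrated over arbitrary events of the past, makes D_t² a
supermartingale up to summable increments. A maximal inequality (`mul_real_exists_ge_le`) controls
all D_t with t ≥ T_r at once, and Chebyshev's inequality controls d(Ĉ_r, C); both together give the
probability bound, and convergence to 0 almost surely.

Phase-wise strategies require optimal actions that are measurable in the history. Disintegrating the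
law of the contexts along x splits the one-shot game into finite games, one for each x; their
least-norm saddle points depend measurably on the payoffs (`exists_measurable_saddle`), whence
`Game.exists_optimal_families`. The same lemma exchanges the quantifiers in Blackwell's condition:
one family of the Player serves against all families of Nature in a given direction. Exact estimates
then prove approachability.

Conversely, let Nature always play the family q. The expected average payoff is then a payoff that
the Player can obtain against q in one round. Those payoffs form a compact convex set
(`Game.isClosed_convex_responses`), and by Jensen's inequality the set contains points arbitrarily
close to C, hence one in C. -/

noncomputable section

namespace FairApproach

/-! ### Distance to a convex set and its first-order expansion. -/

section Projection

variable {E : Type*} [NormedAddCommGroup E] [InnerProductSpace ℝ E]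

/-- The obtuse angle property of a point of a convex set at minimal distance. -/
theorem inner_sub_le_zero_of_norm_eq_infDist {D : Set E} (hD : Convex ℝ D) {v c : E}
    (hc : c ∈ D) (h : ‖v - c‖ = infDist v D) {w : E} (hw : w ∈ D) :
    inner ℝ (v - c) (w - c) ≤ 0 := by
  refine (norm_eq_iInf_iff_real_inner_le_zero hD hc).1 ?_ w hw
  rw [h, infDist_eq_iInf]
  simp only [dist_eq_norm]

/-- Follows from keeping c as a competitor at v + w. With `le_infDist_add_sq` it says that the
squared distance has gradient 2(v - c) at v, so that the projection can be recovered from distances.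
-/
theorem infDist_add_sq_le {D : Set E} {v c w : E} (hc : c ∈ D) (h : ‖v - c‖ = infDist v D) :
    infDist (v + w) D ^ 2 ≤ infDist v D ^ 2 + 2 * inner ℝ (v - c) w + ‖w‖ ^ 2 := by
  have h1 : infDist (v + w) D ≤ ‖(v - c) + w‖ := by
    rw [show v - c + w = (v + w) - c by abel, ← dist_eq_norm]
    exact infDist_le_dist_of_mem hc
  calc infDist (v + w) D ^ 2 ≤ ‖(v - c) + w‖ ^ 2 := by gcongr; exact infDist_nonneg
    _ = _ := by rw [norm_add_sq_real, h]

theorem le_infDist_add_sq {D : Set E} (hD : Convex ℝ D) {v c w : E}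
    (hc : c ∈ D) (h : ‖v - c‖ = infDist v D) :
    infDist v D ^ 2 + 2 * inner ℝ (v - c) w ≤ infDist (v + w) D ^ 2 := by
  have key : ∀ y ∈ D, infDist v D ^ 2 + 2 * inner ℝ (v - c) w ≤ ‖v + w - y‖ ^ 2 := by
    -- Expanding ‖(v + w - y) - (v - c)‖² ≥ 0 bounds ‖v + w - y‖² below by 2⟨v - c, v + w - y⟩ - ‖v
    -- - c‖²; the obtuse angle at c then removes y.
    intro y hy
    have h1 := inner_sub_le_zero_of_norm_eq_infDist hD hc h hy
    have h2 : 0 ≤ ‖(v + w - y) - (v - c)‖ ^ 2 := by positivity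
    rw [norm_sub_sq_real, real_inner_comm] at h2
    have h3 : v + w - y = (v - c) + w - (y - c) := by abel
    have h4 : inner ℝ (v - c) (v + w - y) = ‖v - c‖ ^ 2 + inner ℝ (v - c) w
        - inner ℝ (v - c) (y - c) := by
      rw [h3, inner_sub_right, inner_add_right, real_inner_self_eq_norm_sq]
    rw [h4] at h2
    rw [← h]
    nlinarith
  have hne : D.Nonempty := ⟨c, hc⟩
  rcases le_or_gt (infDist v D ^ 2 + 2 * inner ℝ (v - c) w) 0 with h0 | h0
  · exact h0.trans (sq_nonneg _)
  · rw [← Real.sq_sqrt h0.le]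
    gcongr
    refine (le_infDist hne).2 fun y hy => ?_
    rw [dist_eq_norm]
    exact Real.sqrt_le_iff.2 ⟨norm_nonneg _, key y hy⟩

end Projection

theorem measurable_apply_of_uncurry {Ω E F : Type*} [MeasurableSpace Ω] [MeasurableSpace E]
    [MeasurableSpace F] {u : E → Ω → F} (hu : Measurable (Function.uncurry u)) {v : Ω → E}
    (hv : Measurable v) : Measurable fun h => u (v h) h :=
  hu.comp (hv.prodMk measurable_id)

/-! ### Measurable closed-valued multifunctions. -/

section Multifunction

variable {Ω E : Type*} [MeasurableSpace Ω] [NormedAddCommGroup E]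

theorem measurable_infDist_const {D : Ω → Set E} (hne : ∀ h, (D h).Nonempty)
    (hD : ∀ U : Set E, IsOpen U → MeasurableSet {h | (D h ∩ U).Nonempty}) (v : E) :
    Measurable fun h => infDist v (D h) := by
  refine measurable_of_Iio fun c => ?_
  convert hD (ball v c) isOpen_ball using 1
  ext h
  simp only [Set.mem_preimage, Set.mem_Iio, infDist_lt_iff (hne h), Set.mem_ofPred_eq]
  constructor
  · rintro ⟨y, hy, hy'⟩; exact ⟨y, hy, by rwa [mem_ball, dist_comm]⟩
  · rintro ⟨y, hy, hy'⟩; exact ⟨y, hy, by rwa [mem_ball, dist_comm] at hy'⟩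

variable [MeasurableSpace E] [BorelSpace E] [SecondCountableTopology E]

theorem measurable_infDist_multifunction {D : Ω → Set E} (hne : ∀ h, (D h).Nonempty)
    (hD : ∀ U : Set E, IsOpen U → MeasurableSet {h | (D h ∩ U).Nonempty})
    {v : Ω → E} (hv : Measurable v) :
    Measurable fun h => infDist (v h) (D h) := by
  have hm : Measurable (Function.uncurry fun (v : E) (h : Ω) => infDist v (D h)) :=
    measurable_uncurry_of_continuous_of_measurable
      (fun h => continuous_infDist_pt (D h)) fun v => measurable_infDist_const hne hD v
  exact measurable_apply_of_uncurry hm hv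

variable [InnerProductSpace ℝ E] [FiniteDimensional ℝ E]

/-- The projection on a measurable closed convex multifunction is measurable. -/
theorem measurable_projection_multifunction {D : Ω → Set E}
    (hc : ∀ h, Convex ℝ (D h))
    (hD : ∀ U : Set E, IsOpen U → MeasurableSet {h | (D h ∩ U).Nonempty})
    {v p : Ω → E} (hv : Measurable v) (hp : ∀ h, p h ∈ D h)
    (hmin : ∀ h, ‖v h - p h‖ = infDist (v h) (D h)) :
    Measurable p := by
  have hne : ∀ h, (D h).Nonempty := fun h => ⟨_, hp h⟩
  have hinner : ∀ e : E, Measurable fun h => inner ℝ (v h - p h) e := by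
    intro e
    -- Half the difference quotient, with step 1/(n+1), of the squared distance in the direction e.
    -- The two first-order bounds squeeze it onto the coordinate of v - p along e.
    refine measurable_of_tendsto_metrizable (f := fun (n : ℕ) h => ((n : ℝ) + 1) / 2 *
      (infDist (v h + ((n : ℝ) + 1)⁻¹ • e) (D h) ^ 2 - infDist (v h) (D h) ^ 2)) ?_ ?_
    · intro n
      exact (((measurable_infDist_multifunction hne hD (hv.add_const _)).pow_const 2).sub
        ((measurable_infDist_multifunction hne hD hv).pow_const 2)).const_mul _
    · rw [tendsto_pi_nhds]
      intro h
      have hlim : Tendsto (fun n : ℕ => inner ℝ (v h - p h) e + (1 / ((n : ℝ) + 1)) * (‖e‖ ^ 2 / 2))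
          atTop (𝓝 (inner ℝ (v h - p h) e)) := by
        simpa using tendsto_const_nhds.add
          ((tendsto_one_div_add_atTop_nhds_zero_nat (𝕜 := ℝ)).mul_const (‖e‖ ^ 2 / 2))
      refine tendsto_of_tendsto_of_tendsto_of_le_of_le tendsto_const_nhds hlim ?_ ?_
      · intro n
        have hn : (0 : ℝ) < (n : ℝ) + 1 := by positivity
        have := le_infDist_add_sq (hc h) (w := ((n : ℝ) + 1)⁻¹ • e) (hp h) (hmin h)
        rw [inner_smul_right] at this
        dsimp only
        calc inner ℝ (v h - p h) e = ((n : ℝ) + 1) / 2 *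
              (2 * (((n : ℝ) + 1)⁻¹ * inner ℝ (v h - p h) e)) := by field_simp
          _ ≤ _ := by gcongr; linarith
      · intro n
        have hn : (0 : ℝ) < (n : ℝ) + 1 := by positivity
        have := infDist_add_sq_le (w := ((n : ℝ) + 1)⁻¹ • e) (hp h) (hmin h)
        rw [inner_smul_right, norm_smul, norm_inv, Real.norm_of_nonneg hn.le] at this
        dsimp only
        calc _ ≤ ((n : ℝ) + 1) / 2 * (2 * (((n : ℝ) + 1)⁻¹ * inner ℝ (v h - p h) e)
              + (((n : ℝ) + 1)⁻¹ * ‖e‖) ^ 2) := by gcongr; linarith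
          _ = _ := by field_simp
  have hsub : Measurable fun h => v h - p h := by
    let b := stdOrthonormalBasis ℝ E
    have : (fun h => v h - p h) = fun h => ∑ i, (inner ℝ (v h - p h) (b i)) • b i := by
      funext h
      conv_lhs => rw [← b.sum_repr (v h - p h)]
      refine Finset.sum_congr rfl fun i _ => ?_
      rw [b.repr_apply_apply, real_inner_comm]
    rw [this]
    exact Finset.measurable_sum _ fun i _ => (hinner (b i)).smul_const _
  have : p = fun h => v h - (v h - p h) := by funext h; abel
  rw [this]
  exact hv.sub hsub

end Multifunction

/-! ### The Euclidean projection and the convexity of the distance. -/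

section Proj

variable {d : ℕ} {D : Set (Vec d)}

theorem exists_norm_sub_eq_infDist {E : Type*} [NormedAddCommGroup E] [ProperSpace E]
    {D : Set E} (hne : D.Nonempty) (hcl : IsClosed D) (v : E) :
    ∃ c ∈ D, ‖v - c‖ = infDist v D := by
  obtain ⟨c, hc, h⟩ := hcl.exists_infDist_eq_dist hne v
  exact ⟨c, hc, by rw [h, dist_eq_norm]⟩

theorem proj_mem (hne : D.Nonempty) (hcl : IsClosed D) (v : Vec d) : proj D v ∈ D := by
  have h := exists_norm_sub_eq_infDist hne hcl v
  rw [proj, dif_pos h]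
  exact h.choose_spec.1

theorem norm_sub_proj (hne : D.Nonempty) (hcl : IsClosed D) (v : Vec d) :
    ‖v - proj D v‖ = infDist v D := by
  have h := exists_norm_sub_eq_infDist hne hcl v
  rw [proj, dif_pos h]
  exact h.choose_spec.2

theorem inner_sub_proj_le_zero (hne : D.Nonempty) (hcl : IsClosed D) (hc : Convex ℝ D)
    (v : Vec d) {w : Vec d} (hw : w ∈ D) :
    inner ℝ (v - proj D v) (w - proj D v) ≤ 0 :=
  inner_sub_le_zero_of_norm_eq_infDist hc (proj_mem hne hcl v) (norm_sub_proj hne hcl v) hw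

theorem convexOn_infDist_of_convex {E : Type*} [NormedAddCommGroup E] [NormedSpace ℝ E]
    {D : Set E} (hne : D.Nonempty) (hc : Convex ℝ D) :
    ConvexOn ℝ Set.univ fun v => infDist v D := by
  refine ⟨convex_univ, fun v _ w _ a b ha hb hab => ?_⟩
  refine le_of_forall_pos_le_add fun ε hε => ?_
  obtain ⟨y, hy, hy'⟩ := (infDist_lt_iff hne).1 (lt_add_of_pos_right (infDist v D) hε)
  obtain ⟨z, hz, hz'⟩ := (infDist_lt_iff hne).1 (lt_add_of_pos_right (infDist w D) hε)
  calc infDist (a • v + b • w) D ≤ dist (a • v + b • w) (a • y + b • z) :=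
        infDist_le_dist_of_mem (hc hy hz ha hb hab)
    _ ≤ dist (a • v) (a • y) + dist (b • w) (b • z) := dist_add_add_le _ _ _ _
    _ = a * dist v y + b * dist w z := by
        rw [dist_smul₀, dist_smul₀, Real.norm_of_nonneg ha, Real.norm_of_nonneg hb]
    _ ≤ a * (infDist v D + ε) + b * (infDist w D + ε) := by gcongr
    _ = a • infDist v D + b • infDist w D + (a + b) * ε := by
        simp only [smul_eq_mul]; ring
    _ = _ := by rw [hab, one_mul]

/-- A bound on the distance to a convex set extends to the convex hull. -/
theorem infDist_le_of_mem_convexHull {E : Type*} [NormedAddCommGroup E] [NormedSpace ℝ E]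
    {D s : Set E} (hne : D.Nonempty) (hc : Convex ℝ D) {b : ℝ} (h : ∀ v ∈ s, infDist v D ≤ b)
    {w : E} (hw : w ∈ convexHull ℝ s) : infDist w D ≤ b := by
  have hconv := (convexOn_infDist_of_convex hne hc).convex_le b
  have hsub : s ⊆ {v | v ∈ Set.univ ∧ infDist v D ≤ b} := fun v hv => ⟨Set.mem_univ _, h v hv⟩
  exact (convexHull_min hsub hconv hw).2

end Proj

end FairApproach

namespace FairApproach

/-! ### Finite zero-sum games and measurable saddle points. -/

section FiniteGame

variable {A T B : Type*} [Fintype A] [Fintype T] [Fintype B]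

/-- Payoff of a finite game in which the second player chooses one mixed action for each `t`. -/
def bilin (θ : A → T → B → ℝ) (p : A → ℝ) (q : T → B → ℝ) : ℝ :=
  ∑ a, ∑ t, ∑ b, p a * q t b * θ a t b

theorem continuous_bilin {W : Type*} [TopologicalSpace W] {θ : W → A → T → B → ℝ} {p : W → A → ℝ}
    {q : W → T → B → ℝ} (hθ : Continuous θ) (hp : Continuous p) (hq : Continuous q) :
    Continuous fun w => bilin (θ w) (p w) (q w) := by
  unfold bilin
  fun_prop

theorem bilin_combo_left (θ : A → T → B → ℝ) (p p' : A → ℝ) (q : T → B → ℝ) (a b : ℝ) :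
    bilin θ (a • p + b • p') q = a * bilin θ p q + b * bilin θ p' q := by
  simp only [bilin, Finset.mul_sum, ← Finset.sum_add_distrib]
  refine Finset.sum_congr rfl fun _ _ => Finset.sum_congr rfl fun _ _ =>
    Finset.sum_congr rfl fun _ _ => ?_
  simp only [Pi.add_apply, Pi.smul_apply, smul_eq_mul]
  ring

theorem bilin_combo_right (θ : A → T → B → ℝ) (p : A → ℝ) (q q' : T → B → ℝ) (a b : ℝ) :
    bilin θ p (a • q + b • q') = a * bilin θ p q + b * bilin θ p q' := by
  simp only [bilin, Finset.mul_sum, ← Finset.sum_add_distrib]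
  refine Finset.sum_congr rfl fun _ _ => Finset.sum_congr rfl fun _ _ =>
    Finset.sum_congr rfl fun _ _ => ?_
  simp only [Pi.add_apply, Pi.smul_apply, smul_eq_mul]
  ring

variable (T B) in
/-- The behaviour strategies of the second player: a mixed action for each `t`. -/
def behaviours : Set (T → B → ℝ) := Set.univ.pi fun _ => stdSimplex ℝ B

theorem isCompact_behaviours : IsCompact (behaviours T B) :=
  isCompact_univ_pi fun _ => isCompact_stdSimplex ℝ B

theorem convex_behaviours : Convex ℝ (behaviours T B) :=
  convex_pi fun _ _ => convex_stdSimplex ℝ B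

theorem stdSimplex_nonempty' [Nonempty B] : (stdSimplex ℝ B).Nonempty := by
  classical
  exact ⟨_, single_mem_stdSimplex ℝ (Classical.arbitrary B)⟩

theorem behaviours_nonempty [Nonempty B] : (behaviours T B).Nonempty :=
  Set.univ_pi_nonempty_iff.2 fun _ => stdSimplex_nonempty'

theorem exists_saddle_bilin [Nonempty A] [Nonempty B] (θ : A → T → B → ℝ) :
    ∃ p ∈ stdSimplex ℝ A, ∃ q ∈ behaviours T B,
      ∀ p' ∈ stdSimplex ℝ A, ∀ q' ∈ behaviours T B, bilin θ p q' ≤ bilin θ p' q := by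
  obtain ⟨p, hp, q, hq, h⟩ := Sion.exists_isSaddlePointOn' (X := stdSimplex ℝ A)
    (Y := behaviours T B) (f := bilin θ) stdSimplex_nonempty' (isCompact_stdSimplex ℝ A)
    (fun q _ => (continuous_bilin continuous_const continuous_id
      continuous_const).lowerSemicontinuous.lowerSemicontinuousOn _)
    (fun q _ => (show ConvexOn ℝ (stdSimplex ℝ A) fun p => bilin θ p q from
      ⟨convex_stdSimplex ℝ A, fun p _ p' _ a b _ _ _ =>
        (bilin_combo_left θ p p' q a b).le⟩).quasiconvexOn) convex_behaviours isCompact_behaviours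
    (fun p _ => (continuous_bilin continuous_const continuous_const
      continuous_id).upperSemicontinuous.upperSemicontinuousOn _)
    (fun p _ => (show ConcaveOn ℝ (behaviours T B) fun q => bilin θ p q from
      ⟨convex_behaviours, fun q _ q' _ a b _ _ _ =>
        (bilin_combo_right θ p q q' a b).ge⟩).quasiconcaveOn) (convex_stdSimplex ℝ A)
    behaviours_nonempty
  exact ⟨p, hp, q, hq, fun p' hp' q' hq' => h p' hp' q' hq'⟩

/-- First component of a pair of strategies. -/
def firstPart (z : EuclideanSpace ℝ (A ⊕ T × B)) : A → ℝ := fun a => z (Sum.inl a)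

/-- Second component of a pair of strategies. -/
def secondPart (z : EuclideanSpace ℝ (A ⊕ T × B)) : T → B → ℝ := fun t b => z (Sum.inr (t, b))

theorem continuous_firstPart : Continuous (firstPart (A := A) (T := T) (B := B)) := by
  unfold firstPart; fun_prop

theorem continuous_secondPart : Continuous (secondPart (A := A) (T := T) (B := B)) := by
  unfold secondPart; fun_prop

/-- The pair of strategies with given components. -/
def pairing (w : (A → ℝ) × (T → B → ℝ)) : EuclideanSpace ℝ (A ⊕ T × B) :=
  WithLp.toLp 2 (Sum.elim w.1 fun i => w.2 i.1 i.2)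

theorem continuous_pairing : Continuous (pairing (A := A) (T := T) (B := B)) := by
  unfold pairing
  refine (PiLp.continuous_toLp 2 _).comp (continuous_pi ?_)
  rintro (a | ⟨t, b⟩) <;> simp <;> fun_prop

/-- The set of saddle points of the finite game with payoffs `θ`. -/
def saddles (θ : A → T → B → ℝ) : Set (EuclideanSpace ℝ (A ⊕ T × B)) :=
  {z | (firstPart z ∈ stdSimplex ℝ A ∧ secondPart z ∈ behaviours T B) ∧
    ∀ p' ∈ stdSimplex ℝ A, ∀ q' ∈ behaviours T B,
      bilin θ (firstPart z) q' ≤ bilin θ p' (secondPart z)}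

theorem convex_saddles (θ : A → T → B → ℝ) : Convex ℝ (saddles θ) := by
  rintro z ⟨⟨hz1, hz2⟩, hz⟩ w ⟨⟨hw1, hw2⟩, hw⟩ a b ha hb hab
  have h1 : firstPart (a • z + b • w) = a • firstPart z + b • firstPart w := by
    ext; simp [firstPart]
  have h2 : secondPart (a • z + b • w) = a • secondPart z + b • secondPart w := by
    ext; simp [secondPart]
  refine ⟨⟨h1 ▸ convex_stdSimplex ℝ A hz1 hw1 ha hb hab,
    h2 ▸ convex_behaviours hz2 hw2 ha hb hab⟩, fun p' hp' q' hq' => ?_⟩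
  rw [h1, h2, bilin_combo_left, bilin_combo_right]
  gcongr
  · exact hz p' hp' q' hq'
  · exact hw p' hp' q' hq'

theorem isClosed_graph_saddles :
    IsClosed {w : (A → T → B → ℝ) × EuclideanSpace ℝ (A ⊕ T × B) | w.2 ∈ saddles w.1} := by
  have : {w : (A → T → B → ℝ) × EuclideanSpace ℝ (A ⊕ T × B) | w.2 ∈ saddles w.1} =
      ({w | firstPart w.2 ∈ stdSimplex ℝ A} ∩ {w | secondPart w.2 ∈ behaviours T B}) ∩
      ⋂ p' ∈ stdSimplex ℝ A, ⋂ q' ∈ behaviours T B,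
        {w | bilin w.1 (firstPart w.2) q' ≤ bilin w.1 p' (secondPart w.2)} := by
    ext w; simp [saddles]
  rw [this]
  have h1 := continuous_firstPart (A := A) (T := T) (B := B)
  have h2 := continuous_secondPart (A := A) (T := T) (B := B)
  refine (IsClosed.inter ?_ ?_).inter ?_
  · exact (isClosed_stdSimplex ℝ A).preimage (h1.comp continuous_snd)
  · exact isCompact_behaviours.isClosed.preimage (h2.comp continuous_snd)
  · refine isClosed_biInter fun p' _ => isClosed_biInter fun q' _ => ?_
    refine isClosed_le ?_ ?_
    · exact continuous_bilin continuous_fst (h1.comp continuous_snd) continuous_const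
    · exact continuous_bilin continuous_fst continuous_const (h2.comp continuous_snd)

theorem isClosed_saddles (θ : A → T → B → ℝ) : IsClosed (saddles θ) :=
  isClosed_graph_saddles.preimage (Continuous.prodMk_right θ)

/-- An open set is a countable union of closed sets F n. The θ with a saddle point in F n form the
projection, along a compact set of strategy pairs, of a closed set, hence a closed set. -/
theorem measurableSet_saddles_inter_nonempty {U : Set (EuclideanSpace ℝ (A ⊕ T × B))}
    (hU : IsOpen U) :
    MeasurableSet {θ : A → T → B → ℝ | (saddles θ ∩ U).Nonempty} := by
  obtain ⟨F, hF, -, rfl, -⟩ := hU.exists_iUnion_isClosed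
  have : {θ : A → T → B → ℝ | (saddles θ ∩ ⋃ n, F n).Nonempty} =
      ⋃ n, {θ | (saddles θ ∩ F n).Nonempty} := by
    ext θ; simp [Set.inter_iUnion, Set.nonempty_iUnion]
  rw [this]
  refine MeasurableSet.iUnion fun n => IsClosed.measurableSet ?_
  let K : Set (EuclideanSpace ℝ (A ⊕ T × B)) := pairing '' (stdSimplex ℝ A ×ˢ behaviours T B)
  have hK : IsCompact K :=
    ((isCompact_stdSimplex ℝ A).prod isCompact_behaviours).image continuous_pairing
  have hsub : ∀ θ : A → T → B → ℝ, saddles θ ⊆ K := by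
    rintro θ z ⟨⟨h1, h2⟩, -⟩
    refine ⟨(firstPart z, secondPart z), ⟨h1, h2⟩, ?_⟩
    ext i
    rcases i with a | ⟨t, b⟩ <;> rfl
  have := isCompact_iff_compactSpace.1 hK
  have hcl : IsClosed {w : (A → T → B → ℝ) × K | (w.2 : EuclideanSpace ℝ _) ∈ saddles w.1 ∧
      (w.2 : EuclideanSpace ℝ _) ∈ F n} :=
    (isClosed_graph_saddles.preimage (continuous_fst.prodMk
      (continuous_subtype_val.comp continuous_snd))).inter
      ((hF n).preimage (continuous_subtype_val.comp continuous_snd))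
  convert isClosedMap_fst_of_compactSpace _ hcl using 1
  ext θ
  constructor
  · rintro ⟨z, hz, hzF⟩
    exact ⟨(θ, ⟨z, hsub θ hz⟩), ⟨hz, hzF⟩, rfl⟩
  · rintro ⟨⟨θ', z⟩, ⟨hz, hzF⟩, rfl⟩
    exact ⟨z, hz, hzF⟩

/-- A measurable selection of optimal strategies in finite games. -/
theorem exists_measurable_saddle [Nonempty A] [Nonempty B] :
    ∃ (P : (A → T → B → ℝ) → A → ℝ) (Q : (A → T → B → ℝ) → T → B → ℝ),
      Measurable P ∧ Measurable Q ∧ (∀ θ, P θ ∈ stdSimplex ℝ A) ∧ (∀ θ, Q θ ∈ behaviours T B) ∧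
      ∀ θ, ∀ p' ∈ stdSimplex ℝ A, ∀ q' ∈ behaviours T B, bilin θ (P θ) q' ≤ bilin θ p' (Q θ) := by
  have hne : ∀ θ : A → T → B → ℝ, (saddles θ).Nonempty := by
    intro θ
    obtain ⟨p, hp, q, hq, h⟩ := exists_saddle_bilin θ
    exact ⟨pairing (p, q), ⟨hp, hq⟩, h⟩
  -- The selected saddle point is the one of least Euclidean norm, that is, the projection of 0 onto
  -- the closed convex set of saddle points.
  choose z hz hmin using fun θ : A → T → B → ℝ =>
    exists_norm_sub_eq_infDist (hne θ) (isClosed_saddles θ) 0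
  have hmeas : Measurable z := measurable_projection_multifunction convex_saddles
    (fun U hU => measurableSet_saddles_inter_nonempty hU) measurable_const hz hmin
  exact ⟨fun θ => firstPart (z θ), fun θ => secondPart (z θ),
    continuous_firstPart.measurable.comp hmeas, continuous_secondPart.measurable.comp hmeas,
    fun θ => (hz θ).1.1, fun θ => (hz θ).1.2, fun θ => (hz θ).2⟩

end FiniteGame

end FairApproach

namespace FairApproach

/-! ### Kernels towards finite sets. -/

section WeightKernel

variable {Z A : Type*} [MeasurableSpace Z] [Fintype A] [MeasurableSpace A]
  [MeasurableSingletonClass A]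

/-- The kernel towards a finite type with given weights. -/
def weightKernel (f : Z → A → ℝ) (hf : Measurable f) : Kernel Z A where
  toFun z := ∑ a, ENNReal.ofReal (f z a) • Measure.dirac a
  measurable' := by
    refine Measure.measurable_of_measurable_coe _ fun s hs => ?_
    simp only [Measure.coe_finsetSum, Finset.sum_apply, Measure.smul_apply, smul_eq_mul]
    refine Finset.measurable_sum _ fun a _ => ?_
    exact (ENNReal.measurable_ofReal.comp ((measurable_pi_apply a).comp hf)).mul_const _

theorem weightKernel_real_singleton (f : Z → A → ℝ) (hf : Measurable f) (z : Z) (a : A)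
    (h : 0 ≤ f z a) : (weightKernel f hf z).real {a} = f z a := by
  classical
  have : weightKernel f hf z {a} = ENNReal.ofReal (f z a) := by
    change (∑ a, ENNReal.ofReal (f z a) • Measure.dirac a : Measure A) {a} = _
    simp only [Measure.coe_finsetSum, Finset.sum_apply, Measure.smul_apply, smul_eq_mul,
      Measure.dirac_apply' _ (measurableSet_singleton a), Set.indicator_apply,
      Set.mem_singleton_iff, Pi.one_apply]
    simp
  rw [measureReal_def, this, ENNReal.toReal_ofReal h]

theorem isMarkovKernel_weightKernel {f : Z → A → ℝ} {hf : Measurable f}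
    (h : ∀ z, f z ∈ stdSimplex ℝ A) : IsMarkovKernel (weightKernel f hf) := by
  refine ⟨fun z => ⟨?_⟩⟩
  change (∑ a, ENNReal.ofReal (f z a) • Measure.dirac a : Measure A) Set.univ = 1
  simp only [Measure.coe_finsetSum, Finset.sum_apply, Measure.smul_apply, smul_eq_mul,
    measure_univ, mul_one]
  rw [← ENNReal.ofReal_sum_of_nonneg fun a _ => (h z).1 a, (h z).2, ENNReal.ofReal_one]

theorem real_singleton_mem_stdSimplex (μ : Measure A) [IsProbabilityMeasure μ] :
    (fun a => μ.real {a}) ∈ stdSimplex ℝ A := by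
  refine ⟨fun a => measureReal_nonneg, ?_⟩
  rw [sum_measureReal_singleton, Finset.coe_univ, probReal_univ]

theorem measurable_real_singleton (κ : Kernel Z A) (a : A) :
    Measurable fun z => (κ z).real {a} :=
  (κ.measurable_coe (measurableSet_singleton a)).ennreal_toReal

end WeightKernel

/-! ### One-shot games with contexts and the existence of phase-wise strategies. -/

namespace Game

universe v

variable {A B X : Type*} {S : Type v} {Y : Type*} {d : ℕ}
  [MeasurableSpace A] [MeasurableSpace B] [MeasurableSpace X] [MeasurableSpace S]
  [MeasurableSpace Y]

variable (Γ : Game A B X S Y d)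

theorem norm_payoff_le (a : A) (b : B) (x : X) (s : S) : ‖Γ.payoff a b x s‖ ≤ Γ.supNorm := by
  obtain ⟨M, hM⟩ := Γ.bounded_payoff
  exact le_ciSup (f := fun z : Outcome A B X S => ‖Γ.payoff z.2.1 z.2.2 z.1.1 z.1.2‖)
    ⟨M, by rintro _ ⟨z, rfl⟩; exact hM _ _ _ _⟩ ((x, s), (a, b))

theorem supNorm_nonneg : 0 ≤ Γ.supNorm := Real.iSup_nonneg fun _ => norm_nonneg _

theorem measurable_payoff_apply (a : A) (b : B) :
    Measurable fun z : X × S => Γ.payoff a b z.1 z.2 :=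
  Γ.measurable_payoff.comp (measurable_id.prodMk (measurable_const (a := (a, b))))

/-- Up to renaming, Nature observes `x` and a function of `s` with finitely many values. -/
theorem exists_obs_factor [Fintype S] [MeasurableSingletonClass S] :
    ∃ (T : Type v) (_ : Fintype T) (_ : MeasurableSpace T) (_ : MeasurableSingletonClass T)
      (g : S → T) (fromT : X × T → Y) (toT : Y → X × T), Measurable fromT ∧ Measurable toT ∧
      (∀ z, Γ.obs z = fromT (z.1, g z.2)) ∧ ∀ w, toT (fromT w) = w := by
  rcases Γ.obs_spec with ⟨e, he⟩ | ⟨e, he⟩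
  · refine ⟨PUnit, inferInstance, inferInstance, inferInstance, fun _ => PUnit.unit,
      fun w => e.symm w.1, fun y => (e y, PUnit.unit), e.symm.measurable.comp measurable_fst,
      e.measurable.prodMk measurable_const, fun z => ?_, fun z => ?_⟩
    · change Γ.obs z = e.symm z.1
      rw [← he z, e.symm_apply_apply]
    · change (e (e.symm z.1), PUnit.unit) = z
      rw [e.apply_symm_apply]
  · refine ⟨S, inferInstance, inferInstance, inferInstance, id, e.symm, e, e.symm.measurable,
      e.measurable, fun z => ?_, fun z => ?_⟩
    · change Γ.obs z = e.symm z
      conv_rhs => rw [← he z, e.symm_apply_apply]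
    · exact e.apply_symm_apply z

variable [Fintype A] [MeasurableSingletonClass A] [Fintype B] [MeasurableSingletonClass B]

theorem norm_mixedPayoff_le (p : Measure A) (q : Measure B) [IsProbabilityMeasure p]
    [IsProbabilityMeasure q] (x : X) (s : S) : ‖Γ.mixedPayoff p q x s‖ ≤ Γ.supNorm := by
  have hp := (real_singleton_mem_stdSimplex p).2
  have hq := (real_singleton_mem_stdSimplex q).2
  calc ‖Γ.mixedPayoff p q x s‖
      ≤ ∑ a, ∑ b, (p.real {a} * q.real {b}) * Γ.supNorm := by
        refine (norm_sum_le _ _).trans (Finset.sum_le_sum fun a _ => ?_)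
        refine (norm_sum_le _ _).trans (Finset.sum_le_sum fun b _ => ?_)
        rw [norm_smul, Real.norm_of_nonneg (by positivity)]
        gcongr
        exact Γ.norm_payoff_le a b x s
    _ = (∑ a, p.real {a}) * (∑ b, q.real {b}) * Γ.supNorm := by
        rw [Finset.sum_mul_sum]
        simp only [Finset.sum_mul]
    _ = Γ.supNorm := by rw [hp, hq]; ring

theorem measurable_mixedPayoff (p : Kernel X A) (q : Kernel Y B) :
    Measurable fun z : X × S => Γ.mixedPayoff (p z.1) (q (Γ.obs z)) z.1 z.2 := by
  unfold mixedPayoff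
  refine Finset.measurable_sum _ fun a _ => Finset.measurable_sum _ fun b _ => ?_
  exact (((measurable_real_singleton p a).comp measurable_fst).mul
    ((measurable_real_singleton q b).comp Γ.measurable_obs)).smul
    (Γ.measurable_payoff_apply a b)

theorem integrable_mixedPayoff (Q' : Measure (X × S)) [IsFiniteMeasure Q'] (p : Kernel X A)
    (q : Kernel Y B) [IsMarkovKernel p] [IsMarkovKernel q] :
    Integrable (fun z : X × S => Γ.mixedPayoff (p z.1) (q (Γ.obs z)) z.1 z.2) Q' :=
  Integrable.of_bound (Γ.measurable_mixedPayoff p q).aestronglyMeasurable Γ.supNorm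
    (ae_of_all _ fun _ => Γ.norm_mixedPayoff_le _ _ _ _)

theorem norm_meanPayoff_le (Q' : Measure (X × S)) [IsProbabilityMeasure Q'] (p : Kernel X A)
    (q : Kernel Y B) [IsMarkovKernel p] [IsMarkovKernel q] :
    ‖Γ.meanPayoff Q' p q‖ ≤ Γ.supNorm := by
  refine (norm_integral_le_of_norm_le_const (C := Γ.supNorm)
    (ae_of_all _ fun _ => Γ.norm_mixedPayoff_le _ _ _ _)).trans ?_
  simp

theorem inner_meanPayoff (u : Vec d) (Q' : Measure (X × S)) [IsFiniteMeasure Q'] (p : Kernel X A)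
    (q : Kernel Y B) [IsMarkovKernel p] [IsMarkovKernel q] :
    inner ℝ u (Γ.meanPayoff Q' p q) =
      ∫ z, inner ℝ u (Γ.mixedPayoff (p z.1) (q (Γ.obs z)) z.1 z.2) ∂Q' :=
  (integral_inner (Γ.integrable_mixedPayoff Q' p q) u).symm

theorem inner_meanPayoff_le_worst (u : Vec d) (Q' : Measure (X × S)) [IsProbabilityMeasure Q']
    (p : Kernel X A) (q : Kernel Y B) [IsMarkovKernel p] [hq : IsMarkovKernel q] :
    inner ℝ u (Γ.meanPayoff Q' p q) ≤ Γ.worst u Q' p := by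
  refine le_ciSup (f := fun q : {q : Kernel Y B // IsMarkovKernel q} =>
    inner ℝ u (Γ.meanPayoff Q' p q)) ⟨‖u‖ * Γ.supNorm, ?_⟩ ⟨q, hq⟩
  rintro _ ⟨⟨q, hq⟩, rfl⟩
  exact (real_inner_le_norm _ _).trans (by gcongr; exact Γ.norm_meanPayoff_le _ _ _)

theorem worst_le [Nonempty B] (u : Vec d) (Q' : Measure (X × S))
    (p : Kernel X A) {V : ℝ}
    (h : ∀ q : Kernel Y B, IsMarkovKernel q → inner ℝ u (Γ.meanPayoff Q' p q) ≤ V) :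
    Γ.worst u Q' p ≤ V := by
  have : Nonempty {q : Kernel Y B // IsMarkovKernel q} :=
    ⟨Kernel.const _ (Measure.dirac (Classical.arbitrary B)), inferInstance⟩
  exact ciSup_le fun q => h q.1 q.2

/-- For a measurable family of laws `κ h` of the contexts and of directions `u h`, there are
measurable families of optimal strategies in the one-shot games with payoffs `⟨u h, m⟩`. -/
theorem exists_optimal_families [Nonempty A] [Nonempty B] [StandardBorelSpace X] [Fintype S]
    [MeasurableSingletonClass S] [Nonempty S] {H : Type*} [MeasurableSpace H]
    (κ : Kernel H (X × S)) [IsMarkovKernel κ] {u : H → Vec d} (hu : Measurable u) :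
    ∃ (p : Kernel (H × X) A) (q : Kernel (H × Y) B) (V : H → ℝ),
      IsMarkovKernel p ∧ IsMarkovKernel q ∧
      (∀ h (q' : Kernel Y B), IsMarkovKernel q' →
        inner ℝ (u h) (Γ.meanPayoff (κ h) (p.sectR h) q') ≤ V h) ∧
      (∀ h (p' : Kernel X A), IsMarkovKernel p' →
        V h ≤ inner ℝ (u h) (Γ.meanPayoff (κ h) p' (q.sectR h))) := by
  classical
  obtain ⟨T, _, _, _, g, fromT, toT, hfrom, hto, hobs, hto_from⟩ := Γ.exists_obs_factor
  obtain ⟨P, Q, hP, hQ, hPmem, hQmem, hPQ⟩ := exists_measurable_saddle (A := A) (T := T) (B := B)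
  let w : Kernel (H × X) S := κ.condKernel
  -- The finite game at (h, x): t = g s is what Nature learns about s. The conditional weights of
  -- the s with g s = t are not normalised, so that summing over t restores the conditional
  -- expectation given x.
  let θ : H × X → A → T → B → ℝ := fun v a t b =>
    ∑ s, if g s = t then (w v).real {s} * inner ℝ (u v.1) (Γ.payoff a b v.2 s) else 0
  have hθ : Measurable θ := by
    refine measurable_pi_lambda _ fun a => measurable_pi_lambda _ fun t =>
      measurable_pi_lambda _ fun b => Finset.measurable_sum _ fun s _ => ?_
    split_ifs
    · refine (measurable_real_singleton w s).mul ((hu.comp measurable_fst).inner ?_)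
      exact (Γ.measurable_payoff_apply a b).comp (measurable_snd.prodMk measurable_const)
    · exact measurable_const
  have hmean : ∀ h (p' : Kernel X A) (q' : Kernel Y B), IsMarkovKernel p' → IsMarkovKernel q' →
      Integrable (fun x => bilin (θ (h, x)) (fun a => (p' x).real {a})
          fun t b => (q' (fromT (x, t))).real {b}) (κ.fst h) ∧
      inner ℝ (u h) (Γ.meanPayoff (κ h) p' q') = ∫ x, bilin (θ (h, x)) (fun a => (p' x).real {a})
          (fun t b => (q' (fromT (x, t))).real {b}) ∂κ.fst h := by
    intro h p' q' hp' hq'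
    have hint : Integrable
        (fun z : X × S => inner ℝ (u h) (Γ.mixedPayoff (p' z.1) (q' (Γ.obs z)) z.1 z.2)) (κ h) :=
      (Γ.integrable_mixedPayoff (κ h) p' q').const_inner _
    have hpoint : ∀ x, ∫ s, inner ℝ (u h) (Γ.mixedPayoff (p' x) (q' (Γ.obs (x, s))) x s)
        ∂w (h, x) = bilin (θ (h, x)) (fun a => (p' x).real {a})
          (fun t b => (q' (fromT (x, t))).real {b}) := by
      intro x
      rw [integral_fintype (Integrable.of_finite)]
      simp only [bilin, θ, hobs, mixedPayoff, inner_sum, inner_smul_right, smul_eq_mul,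
        Finset.mul_sum, mul_ite, mul_zero]
      rw [Finset.sum_comm]
      refine Finset.sum_congr rfl fun a _ => ?_
      rw [Finset.sum_comm]
      conv_rhs => rw [Finset.sum_comm]
      refine Finset.sum_congr rfl fun b _ => ?_
      conv_rhs => rw [Finset.sum_comm]
      refine Finset.sum_congr rfl fun s _ => ?_
      rw [Finset.sum_ite_eq]
      simp only [Finset.mem_univ, if_true]
      ring
    have hdis : κ.fst ⊗ₖ w = κ := κ.disintegrate κ.condKernel
    rw [Γ.inner_meanPayoff]
    simp_rw [← hpoint]
    rw [← hdis] at hint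
    refine ⟨MeasureTheory.Integrable.integral_compProd hint, ?_⟩
    conv_lhs => rw [← hdis]
    rw [integral_compProd hint]
  have hPθ : Measurable fun v => P (θ v) := hP.comp hθ
  -- Nature decodes her observation into (x, t) and plays the component t of the optimal behaviour
  -- in the finite game at (h, x).
  have hQθ : Measurable fun v : H × Y => Q (θ (v.1, (toT v.2).1)) (toT v.2).2 := by
    have h1 : Measurable fun v : H × Y => Q (θ (v.1, (toT v.2).1)) :=
      (hQ.comp hθ).comp (measurable_fst.prodMk (measurable_fst.comp (hto.comp measurable_snd)))
    have h2 : Measurable fun v : H × Y => (toT v.2).2 :=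
      measurable_snd.comp (hto.comp measurable_snd)
    have h3 : Measurable fun r : (T → B → ℝ) × T => r.1 r.2 :=
      measurable_from_prod_countable_left fun t => measurable_pi_apply t
    exact h3.comp (h1.prodMk h2)
  have hp : IsMarkovKernel (weightKernel _ hPθ) := isMarkovKernel_weightKernel fun v => hPmem _
  have hq : IsMarkovKernel (weightKernel _ hQθ) :=
    isMarkovKernel_weightKernel fun v => hQmem _ _ (Set.mem_univ _)
  have hpa : ∀ h x a, ((weightKernel _ hPθ).sectR h x).real {a} = P (θ (h, x)) a := fun h x a =>
    weightKernel_real_singleton _ hPθ (h, x) a ((hPmem _).1 a)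
  have hqb : ∀ h x t b, ((weightKernel _ hQθ).sectR h (fromT (x, t))).real {b} =
      Q (θ (h, x)) t b := fun h x t b => by
    rw [Kernel.sectR_apply, weightKernel_real_singleton _ hQθ _ b
      ((hQmem _ _ (Set.mem_univ _)).1 b)]
    simp only [hto_from]
  have hbeh : ∀ (q' : Kernel Y B), IsMarkovKernel q' → ∀ x,
      (fun t b => (q' (fromT (x, t))).real {b}) ∈ behaviours T B := fun q' hq' x t _ =>
    real_singleton_mem_stdSimplex _
  -- V h is the payoff of the two optimal families against each other. Both inequalities are saddle
  -- inequalities for each x, integrated over x.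
  refine ⟨weightKernel _ hPθ, weightKernel _ hQθ,
    fun h => inner ℝ (u h) (Γ.meanPayoff (κ h) ((weightKernel _ hPθ).sectR h)
      ((weightKernel _ hQθ).sectR h)), hp, hq, fun h q' hq' => ?_, fun h p' hp' => ?_⟩
  · have h1 := hmean h ((weightKernel _ hPθ).sectR h) q' inferInstance hq'
    have h2 := hmean h ((weightKernel _ hPθ).sectR h) ((weightKernel _ hQθ).sectR h)
      inferInstance inferInstance
    beta_reduce
    rw [h1.2, h2.2]
    refine integral_mono h1.1 h2.1 fun x => ?_
    simp only [hpa, hqb]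
    exact hPQ _ _ (hPmem _) _ (hbeh q' hq' x)
  · have h1 := hmean h p' ((weightKernel _ hQθ).sectR h) hp' inferInstance
    have h2 := hmean h ((weightKernel _ hPθ).sectR h) ((weightKernel _ hQθ).sectR h)
      inferInstance inferInstance
    beta_reduce
    rw [h1.2, h2.2]
    refine integral_mono h2.1 h1.1 fun x => ?_
    simp only [hpa, hqb]
    exact hPQ _ _ (real_singleton_mem_stdSimplex _) _ (hQmem _)

theorem nonempty_contexts (Γ : Game A B X S Y d) : Nonempty (X × S) := by
  have := Γ.isProbabilityMeasure_ctx
  exact nonempty_of_isProbabilityMeasure Γ.ctx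

/-- Under Blackwell's condition, in every direction the Player has a response whose payoff is
below some point of the target set. -/
theorem Blackwell.exists_worst_le [Nonempty A] [Nonempty B] [StandardBorelSpace X] [Fintype S]
    [MeasurableSingletonClass S] {Γ : Game A B X S Y d} {C : Set (Vec d)} (hB : Γ.Blackwell C)
    (u : Vec d) :
    ∃ p : Kernel X A, IsMarkovKernel p ∧ ∃ c ∈ C, ∀ q : Kernel Y B, IsMarkovKernel q →
      inner ℝ u (Γ.meanPayoff Γ.ctx p q) ≤ inner ℝ u c := by
  have := Γ.isProbabilityMeasure_ctx
  have : Nonempty S := Γ.nonempty_contexts.map Prod.snd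
  obtain ⟨p, q, V, hp, hq, h1, h2⟩ := Γ.exists_optimal_families (Kernel.const Unit Γ.ctx)
    (u := fun _ => u) measurable_const
  -- Blackwell's condition is used only against the optimal family of Nature: the resulting point of
  -- C lies above the value, and the optimal p guarantees the value against every family.
  obtain ⟨p', hp', hmem⟩ := hB (q.sectR ()) inferInstance
  exact ⟨p.sectR (), inferInstance, _, hmem, fun q' hq' =>
    (h1 () q' hq').trans (h2 () p' hp')⟩

theorem measurable_avg {t : ℕ} : Measurable (avg : (Fin t → Seen X S d) → Vec d) := by
  unfold avg
  exact (Finset.measurable_sum _ fun i _ =>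
    measurable_fst.comp (measurable_pi_apply i)).const_smul (1 / (t : ℝ))

theorem measurable_proj_estimator (Chat : SetEstimator X S d) {Ω : Type*} [MeasurableSpace Ω]
    (r : ℕ) {f : Ω → Fin (2 ^ r) → Seen X S d} (hf : Measurable f) {v : Ω → Vec d}
    (hv : Measurable v) : Measurable fun ω => proj (Chat.set r (f ω)) (v ω) :=
  measurable_projection_multifunction (D := fun ω => Chat.set r (f ω))
    (fun ω => Chat.convex r (f ω)) (fun U hU => hf (Chat.measurable r U hU)) hv
    (fun _ => proj_mem (Chat.nonempty _ _) (Chat.isClosed _ _) _)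
    (fun _ => norm_sub_proj (Chat.nonempty _ _) (Chat.isClosed _ _) _)

/-- The measurable optimal families for the law `Qhat t` and the direction m̄_t - ĉ_t attain the
argmin: the worst case of p is at most V, and the optimal family of Nature shows that V is at most
the worst case of any competitor. -/
theorem exists_isPhaseStrategy [Nonempty A] [Nonempty B] [StandardBorelSpace X] [Fintype S]
    [MeasurableSingletonClass S]
    (Qhat : ∀ t : ℕ, Kernel (Fin t → Seen X S d) (X × S)) (hQhat : ∀ t, IsMarkovKernel (Qhat t))
    (Chat : SetEstimator X S d) :
    ∃ σ : PlayerStrategy A X S d, Γ.IsPhaseStrategy Qhat Chat σ := by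
  have : Nonempty S := Γ.nonempty_contexts.map Prod.snd
  have hu : ∀ (t : ℕ) (ht : t ≠ 0),
      Measurable fun h : Fin t → Seen X S d => avg h - proj (Chat.current ht h) (avg h) := by
    intro t ht
    refine measurable_avg.sub (measurable_proj_estimator Chat _ ?_ measurable_avg)
    exact measurable_pi_lambda _ fun i => measurable_pi_apply _
  choose p q V hp hq h1 h2 using fun (t : ℕ) (ht : t ≠ 0) =>
    Γ.exists_optimal_families (Qhat t) (hu t ht)
  let p₀ : Kernel ((Fin 0 → Seen X S d) × X) A :=
    Kernel.const _ (Measure.dirac (Classical.arbitrary A))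
  refine ⟨⟨fun t => match t with
    | 0 => p₀
    | t + 1 => p (t + 1) (Nat.succ_ne_zero t), fun t => ?_⟩, ?_⟩
  · match t with
    | 0 => exact (inferInstance : IsMarkovKernel p₀)
    | t + 1 => exact hp _ _
  · intro t ht h p' hp'
    obtain ⟨t, rfl⟩ := Nat.exists_eq_succ_of_ne_zero ht
    have := hp _ ht
    have := hq _ ht
    exact (Γ.worst_le _ _ _ (V := V _ ht h) fun q' hq' => h1 _ ht h q' hq').trans
      ((h2 _ ht h p' hp').trans (Γ.inner_meanPayoff_le_worst _ _ _ _))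

end Game

end FairApproach

namespace FairApproach

/-! ### Total variation distance: integrals and measurability. -/

section TotalVariation

variable {Z : Type*} [MeasurableSpace Z]

theorem abs_real_sub_le_one (μ ν : Measure Z) [IsProbabilityMeasure μ] [IsProbabilityMeasure ν]
    (E : Set Z) : |μ.real E - ν.real E| ≤ 1 := by
  have h1 : μ.real E ≤ 1 := measureReal_le_one
  have h2 : ν.real E ≤ 1 := measureReal_le_one
  have h3 : 0 ≤ μ.real E := measureReal_nonneg
  have h4 : 0 ≤ ν.real E := measureReal_nonneg
  exact abs_le.2 ⟨by linarith, by linarith⟩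

theorem abs_real_sub_le_tvDist (μ ν : Measure Z) [IsProbabilityMeasure μ] [IsProbabilityMeasure ν]
    {E : Set Z} (hE : MeasurableSet E) : |μ.real E - ν.real E| ≤ tvDist μ ν :=
  le_ciSup (f := fun E : {E : Set Z // MeasurableSet E} => |μ.real E - ν.real E|)
    ⟨1, by rintro _ ⟨E, rfl⟩; exact abs_real_sub_le_one μ ν E⟩ ⟨E, hE⟩

theorem tvDist_nonneg (μ ν : Measure Z) : 0 ≤ tvDist μ ν :=
  Real.iSup_nonneg fun _ => abs_nonneg _

theorem tvDist_le_one (μ ν : Measure Z) [IsProbabilityMeasure μ] [IsProbabilityMeasure ν] :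
    tvDist μ ν ≤ 1 := by
  have : Nonempty {E : Set Z // MeasurableSet E} := ⟨⟨∅, MeasurableSet.empty⟩⟩
  exact ciSup_le fun E => abs_real_sub_le_one μ ν E

theorem tvDist_self (μ : Measure Z) : tvDist μ μ = 0 := by simp [tvDist]

/-- The difference of the expectations of a bounded function is controlled by its oscillation
times the total variation distance. -/
theorem abs_integral_sub_le_tvDist (μ ν : Measure Z) [IsProbabilityMeasure μ]
    [IsProbabilityMeasure ν] {f : Z → ℝ} (hf : Measurable f) {c : ℝ} (hc : ∀ z, |f z| ≤ c) :
    |∫ z, f z ∂μ - ∫ z, f z ∂ν| ≤ 2 * c * tvDist μ ν := by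
  have hg : Measurable fun z => f z + c := hf.add_const c
  -- Layer-cake formula for f + c, which takes values in [0, 2c]. The two integrals then differ by
  -- an integral over an interval of length 2c of differences of probabilities.
  have key : ∀ (ρ : Measure Z) [IsProbabilityMeasure ρ],
      ∫ z, f z ∂ρ = (∫ t in Set.Ioc 0 (2 * c), ρ.real {z | t ≤ f z + c}) - c := by
    intro ρ _
    have hfi : Integrable f ρ := Integrable.of_bound hf.aestronglyMeasurable c (ae_of_all _ hc)
    rw [← Integrable.integral_eq_integral_Ioc_meas_le (f := fun z => f z + c)
      (hfi.add (integrable_const c))]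
    · rw [integral_add hfi (integrable_const c)]
      simp
    · exact ae_of_all _ fun z => by
        have := neg_le_of_abs_le (hc z)
        simp only [Pi.zero_apply]; linarith
    · exact ae_of_all _ fun z => by
        have := le_of_abs_le (hc z)
        linarith
  have hint : ∀ (ρ : Measure Z) [IsProbabilityMeasure ρ],
      IntegrableOn (fun t => ρ.real {z | t ≤ f z + c}) (Set.Ioc 0 (2 * c)) := by
    intro ρ _
    have hanti : Antitone fun t => ρ.real {z | t ≤ f z + c} := fun s t hst =>
      measureReal_mono fun z hz => le_trans hst hz
    refine Integrable.of_bound hanti.measurable.aestronglyMeasurable 1 (ae_of_all _ fun t => ?_)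
    rw [Real.norm_of_nonneg measureReal_nonneg]
    exact measureReal_le_one
  rw [key μ, key ν, sub_sub_sub_cancel_right, ← integral_sub (hint μ) (hint ν)]
  rcases le_or_gt 0 c with h0 | h0
  · have := norm_setIntegral_le_of_norm_le_const (μ := volume) (s := Set.Ioc 0 (2 * c))
      (C := tvDist μ ν) (f := fun t => μ.real {z | t ≤ f z + c} - ν.real {z | t ≤ f z + c})
      measure_Ioc_lt_top fun t _ => abs_real_sub_le_tvDist μ ν (measurableSet_le measurable_const hg)
    rw [Real.norm_eq_abs, Real.volume_real_Ioc_of_le (by linarith)] at this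
    linarith
  · have := nonempty_of_isProbabilityMeasure μ
    exact absurd ((abs_nonneg _).trans (hc (Classical.arbitrary Z))) (by linarith)

/-- Density for μ + ν approximates an event simultaneously for μ and for ν. -/
theorem tvDist_eq_iSup_of_measureDense (μ ν : Measure Z) [IsProbabilityMeasure μ]
    [IsProbabilityMeasure ν] {𝒜 : Set (Set Z)} (h : (μ + ν).MeasureDense 𝒜) :
    tvDist μ ν = ⨆ E : 𝒜, |μ.real E - ν.real E| := by
  have hbdd : BddAbove (Set.range fun E : 𝒜 => |μ.real E - ν.real E|) :=
    ⟨1, by rintro _ ⟨E, rfl⟩; exact abs_real_sub_le_one μ ν E⟩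
  have : Nonempty {E : Set Z // MeasurableSet E} := ⟨⟨∅, MeasurableSet.empty⟩⟩
  have := h.nonempty.to_subtype
  refine le_antisymm (ciSup_le fun E => le_of_forall_pos_le_add fun ε hε => ?_)
    (ciSup_le fun E => abs_real_sub_le_tvDist μ ν (h.measurable E E.2))
  obtain ⟨F, hF, hlt⟩ := h.approx E E.2 (measure_ne_top _ _) ε hε
  have h1 : (μ + ν).real (symmDiff (E : Set Z) F) < ε := by
    rw [measureReal_def]
    exact (ENNReal.toReal_lt_of_lt_ofReal hlt)
  have h2 : ∀ (ρ : Measure Z) [IsProbabilityMeasure ρ], |ρ.real E - ρ.real F| ≤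
      ρ.real (symmDiff (E : Set Z) F) := fun ρ _ =>
    abs_measureReal_sub_le_measureReal_symmDiff E.2.nullMeasurableSet
      (h.measurable F hF).nullMeasurableSet
  rw [measureReal_add_apply] at h1
  have h3 := h2 μ
  have h4 := h2 ν
  have h5 := le_ciSup hbdd ⟨F, hF⟩
  dsimp only at h5
  have h6 : |μ.real E - ν.real E| ≤ |μ.real E - μ.real F| + |μ.real F - ν.real F|
      + |ν.real E - ν.real F| := by
    rw [show μ.real E - ν.real E = (μ.real E - μ.real F) + (μ.real F - ν.real F)
      + -(ν.real E - ν.real F) by ring]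
    refine (abs_add_three _ _ _).trans ?_
    rw [abs_neg]
  linarith

/-- The supremum over all events may be restricted to a countable generating algebra, which is dense
for every finite measure and hence does not depend on h. -/
theorem measurable_tvDist [MeasurableSpace.CountablyGenerated Z] {H : Type*} [MeasurableSpace H]
    (κ : Kernel H Z) [IsMarkovKernel κ] (ν : Measure Z) [IsProbabilityMeasure ν] :
    Measurable fun h => tvDist (κ h) ν := by
  let 𝒜 := generateSetAlgebra (MeasurableSpace.countableGeneratingSet Z)
  have hgen : (inferInstance : MeasurableSpace Z) = MeasurableSpace.generateFrom 𝒜 := by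
    rw [generateFrom_generateSetAlgebra_eq]
    exact (MeasurableSpace.generateFrom_countableGeneratingSet (α := Z)).symm
  have hdense : ∀ ρ : Measure Z, IsFiniteMeasure ρ → ρ.MeasureDense 𝒜 := fun ρ _ =>
    Measure.MeasureDense.of_generateFrom_isSetAlgebra_finite ρ isSetAlgebra_generateSetAlgebra hgen
  have hcount : Countable 𝒜 :=
    (countable_generateSetAlgebra (MeasurableSpace.countable_countableGeneratingSet (α := Z)))
  have : (fun h => tvDist (κ h) ν) = fun h => ⨆ E : 𝒜, |(κ h).real E - ν.real E| := by
    funext h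
    exact tvDist_eq_iSup_of_measureDense _ _ (hdense _ inferInstance)
  rw [this]
  refine Measurable.iSup fun E => ?_
  have hE : MeasurableSet (E : Set Z) := (hdense ν inferInstance).measurable E E.2
  exact ((κ.measurable_coe hE).ennreal_toReal.sub_const _).abs

end TotalVariation

/-! ### The law of the play and conditional means. -/

namespace Game

universe v

variable {A B X : Type*} {S : Type v} {Y : Type*} {d : ℕ}
  [MeasurableSpace A] [MeasurableSpace B] [MeasurableSpace X] [MeasurableSpace S]
  [MeasurableSpace Y]

variable (Γ : Game A B X S Y d) (σ : PlayerStrategy A X S d) (τ : NatureStrategy A B X S Y)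

/-- The full history `H_t` along a play. -/
def fullHist (t : ℕ) (ω : ℕ → Outcome A B X S) : Fin t → Outcome A B X S := fun i => ω i

theorem measurable_fullHist (t : ℕ) :
    Measurable (fullHist t : (ℕ → Outcome A B X S) → Fin t → Outcome A B X S) :=
  measurable_pi_lambda _ fun _ => measurable_pi_apply _

theorem hist_eq_seeAll (t : ℕ) (ω : ℕ → Outcome A B X S) :
    Γ.hist t ω = Γ.seeAll (fullHist t ω) := rfl

theorem law_eq_trajMeasure :
    Γ.law σ τ = Kernel.trajMeasure (X := fun _ => Outcome A B X S) (Γ.step σ τ 0 Fin.elim0)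
      (Γ.stepIic σ τ) := rfl

instance isProbabilityMeasure_law : IsProbabilityMeasure (Γ.law σ τ) := by
  rw [law_eq_trajMeasure]
  infer_instance

theorem map_compProd_comap {U V W : Type*} [MeasurableSpace U] [MeasurableSpace V]
    [MeasurableSpace W] (μ : Measure U) [SFinite μ] {φ : U → V} (hφ : Measurable φ)
    (η : Kernel V W) [IsSFiniteKernel η] :
    (μ ⊗ₘ η.comap φ hφ).map (Prod.map φ id) = (μ.map φ) ⊗ₘ η := by
  ext s hs
  rw [Measure.map_apply (by fun_prop) hs, Measure.compProd_apply
    ((hφ.prodMap measurable_id) hs), Measure.compProd_apply hs, lintegral_map _ hφ]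
  · rfl
  · exact Kernel.measurable_kernel_prodMk_left hs

/-- The law of the outcome of a round given the full history. -/
theorem map_fullHist_law (t : ℕ) :
    (Γ.law σ τ).map (fun ω => (fullHist t ω, ω t)) =
      (Γ.law σ τ).map (fullHist t) ⊗ₘ Γ.step σ τ t := by
  cases t with
  | zero =>
    -- At the first round the space of histories is a point, so only the law of the coordinate 0
    -- matters; it is the initial law of the trajectory measure.
    have h0 : (Γ.law σ τ).map (fun ω => ω 0) = Γ.step σ τ 0 Fin.elim0 := by
      have h1 : (Γ.law σ τ).map (Preorder.frestrictLe 0) =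
          (Γ.step σ τ 0 Fin.elim0).map fun o _ => o := by
        rw [law, Measure.map_comp _ _ (by fun_prop),
          Kernel.traj_map_frestrictLe, Kernel.partialTraj_self, Measure.id_comp]
      have h2 := congrArg (Measure.map fun w : (i : Finset.Iic 0) → Outcome A B X S =>
        w ⟨0, Finset.mem_Iic.2 le_rfl⟩) h1
      rw [Measure.map_map (by fun_prop) (by fun_prop),
        Measure.map_map (by fun_prop) (by fun_prop)] at h2
      refine Eq.trans ?_ (h2.trans ?_)
      · rfl
      · exact Measure.map_id
    have h1 : (Γ.law σ τ).map (fullHist 0) = Measure.dirac Fin.elim0 := by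
      have : (fullHist 0 : (ℕ → Outcome A B X S) → _) = fun _ => Fin.elim0 := by
        funext ω; exact Subsingleton.elim _ _
      rw [this, Measure.map_const, measure_univ, one_smul]
    have h2 : (fun ω : ℕ → Outcome A B X S => (fullHist 0 ω, ω 0)) =
        (fun o => (Fin.elim0, o)) ∘ fun ω => ω 0 := by
      funext ω
      exact Prod.ext (Subsingleton.elim _ _) rfl
    rw [h1, h2, ← Measure.map_map (by fun_prop) (by fun_prop), h0]
    ext s hs
    rw [Measure.compProd_apply hs, lintegral_dirac' _ (Kernel.measurable_kernel_prodMk_left hs),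
      Measure.map_apply (by fun_prop) hs]
  | succ n =>
    -- The defining property of the trajectory measure, with histories indexed by {0, …, n}; the
    -- rest of this case reindexes them by `Fin (n + 1)`.
    have h := Kernel.map_frestrictLe_trajMeasure_compProd_eq_map_trajMeasure
      (X := fun _ => Outcome A B X S) (μ₀ := Γ.step σ τ 0 Fin.elim0) (κ := Γ.stepIic σ τ) (a := n)
    rw [← law_eq_trajMeasure] at h
    have h2 := congrArg (Measure.map (Prod.map (fun (w : (i : Finset.Iic n) → Outcome A B X S)
      (i : Fin (n + 1)) => w ⟨i, Finset.mem_Iic.2 (Nat.lt_succ_iff.1 i.2)⟩) id)) h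
    unfold stepIic at h2
    rw [map_compProd_comap, Measure.map_map, Measure.map_map] at h2
    · exact h2.symm
    all_goals fun_prop

variable [Fintype A] [MeasurableSingletonClass A] [Fintype B] [MeasurableSingletonClass B]

/-- The mean payoff of a round given the full history. -/
def condMean (t : ℕ) (H : Fin t → Outcome A B X S) : Vec d :=
  Γ.meanPayoff Γ.ctx ((σ.mix t).sectR (Γ.seeAll H)) ((τ.mix t).sectR H)

theorem integral_payoff_step (t : ℕ) (H : Fin t → Outcome A B X S) :
    ∫ o, Γ.payoff o.2.1 o.2.2 o.1.1 o.1.2 ∂Γ.step σ τ t H = Γ.condMean σ τ t H := by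
  have := Γ.isProbabilityMeasure_ctx
  have := σ.isMarkov t
  have := τ.isMarkov t
  have hint : Integrable (fun o : Outcome A B X S => Γ.payoff o.2.1 o.2.2 o.1.1 o.1.2)
      (Γ.step σ τ t H) :=
    Integrable.of_bound Γ.measurable_payoff.aestronglyMeasurable Γ.supNorm
      (ae_of_all _ fun o => Γ.norm_payoff_le _ _ _ _)
  unfold step at hint ⊢
  rw [integral_compProd hint, Kernel.const_apply]
  refine integral_congr_ae (ae_of_all _ fun z => ?_)
  dsimp only
  rw [Kernel.prod_apply, Kernel.comap_apply, Kernel.comap_apply, integral_fintype .of_finite,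
    mixedPayoff, Fintype.sum_prod_type]
  refine Finset.sum_congr rfl fun a _ => Finset.sum_congr rfl fun b _ => ?_
  rw [← Set.singleton_prod_singleton, measureReal_prod_prod]
  rfl

/-- Conditioning on the full history: in an expectation against a bounded function of the history,
the payoff of a round may be replaced with its conditional mean. -/
theorem integral_inner_payoff_law (t : ℕ) {u : (Fin t → Outcome A B X S) → Vec d}
    (hu : Measurable u) {c : ℝ} (hc : ∀ᵐ ω ∂Γ.law σ τ, ‖u (fullHist t ω)‖ ≤ c) :
    ∫ ω, inner ℝ (u (fullHist t ω)) (Γ.see (ω t)).1 ∂Γ.law σ τ =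
      ∫ ω, inner ℝ (u (fullHist t ω)) (Γ.condMean σ τ t (fullHist t ω)) ∂Γ.law σ τ := by
  let F : (Fin t → Outcome A B X S) × Outcome A B X S → ℝ := fun w =>
    inner ℝ (u w.1) (Γ.payoff w.2.2.1 w.2.2.2 w.2.1.1 w.2.1.2)
  have hF : Measurable F :=
    (hu.comp measurable_fst).inner (Γ.measurable_payoff.comp measurable_snd)
  have hpair : Measurable fun ω : ℕ → Outcome A B X S => (fullHist t ω, ω t) :=
    (measurable_fullHist t).prodMk (measurable_pi_apply t)
  have hint : Integrable F ((Γ.law σ τ).map (fullHist t) ⊗ₘ Γ.step σ τ t) := by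
    rw [← map_fullHist_law, integrable_map_measure hF.aestronglyMeasurable hpair.aemeasurable]
    refine Integrable.of_bound (hF.comp hpair).aestronglyMeasurable (c * Γ.supNorm) ?_
    filter_upwards [hc] with ω hω
    refine (norm_inner_le_norm _ _).trans ?_
    have := Γ.norm_payoff_le (ω t).2.1 (ω t).2.2 (ω t).1.1 (ω t).1.2
    gcongr
    exact (norm_nonneg _).trans hω
  have h1 : ∫ ω, F (fullHist t ω, ω t) ∂Γ.law σ τ =
      ∫ w, F w ∂((Γ.law σ τ).map (fullHist t) ⊗ₘ Γ.step σ τ t) := by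
    rw [← map_fullHist_law, integral_map hpair.aemeasurable hF.aestronglyMeasurable]
  have hF2 : StronglyMeasurable fun H => ∫ o, F (H, o) ∂Γ.step σ τ t H :=
    hF.stronglyMeasurable.integral_kernel_prod_right'
  rw [Measure.integral_compProd hint, integral_map (measurable_fullHist t).aemeasurable
    hF2.aestronglyMeasurable] at h1
  refine h1.trans (integral_congr_ae (ae_of_all _ fun ω => ?_))
  dsimp only [F]
  rw [integral_inner, integral_payoff_step]
  exact Integrable.of_bound Γ.measurable_payoff.aestronglyMeasurable Γ.supNorm
      (ae_of_all _ fun o => Γ.norm_payoff_le _ _ _ _)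

end Game

end FairApproach

namespace FairApproach

/-! ### Inequalities in L². -/

section L2

variable {Ω : Type*} [MeasurableSpace Ω] {μ : Measure Ω}

theorem integral_mul_le_sqrt_mul_sqrt {f g : Ω → ℝ} (hf : MemLp f 2 μ) (hg : MemLp g 2 μ)
    (hf0 : 0 ≤ᵐ[μ] f) (hg0 : 0 ≤ᵐ[μ] g) :
    ∫ ω, f ω * g ω ∂μ ≤ √(∫ ω, f ω ^ 2 ∂μ) * √(∫ ω, g ω ^ 2 ∂μ) := by
  have := integral_mul_le_Lp_mul_Lq_of_nonneg (μ := μ) Real.HolderConjugate.two_two hf0 hg0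
    (by simpa using hf) (by simpa using hg)
  simpa [Real.sqrt_eq_rpow] using this

/-- Minkowski's inequality for nonnegative functions. -/
theorem sqrt_integral_sq_le_add {f g e : Ω → ℝ} (hg : MemLp g 2 μ) (he : MemLp e 2 μ)
    (hf0 : 0 ≤ᵐ[μ] f) (hg0 : 0 ≤ᵐ[μ] g) (he0 : 0 ≤ᵐ[μ] e) (h : ∀ᵐ ω ∂μ, f ω ≤ g ω + e ω) :
    √(∫ ω, f ω ^ 2 ∂μ) ≤ √(∫ ω, g ω ^ 2 ∂μ) + √(∫ ω, e ω ^ 2 ∂μ) := by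
  have hge : Integrable (fun ω => g ω * e ω) μ := hg.integrable_mul he
  rw [Real.sqrt_le_left (by positivity)]
  calc ∫ ω, f ω ^ 2 ∂μ ≤ ∫ ω, (g ω ^ 2 + 2 * (g ω * e ω) + e ω ^ 2) ∂μ := by
        refine integral_mono_of_nonneg (ae_of_all _ fun ω => sq_nonneg _)
          ((hg.integrable_sq.add (hge.const_mul 2)).add he.integrable_sq) ?_
        filter_upwards [hf0, h] with ω h0 h1
        have : f ω ^ 2 ≤ (g ω + e ω) ^ 2 := by
          have h0' : 0 ≤ f ω := h0
          gcongr
        linarith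
    _ = ∫ ω, g ω ^ 2 ∂μ + 2 * ∫ ω, g ω * e ω ∂μ + ∫ ω, e ω ^ 2 ∂μ := by
        rw [integral_add (f := fun ω => g ω ^ 2 + 2 * (g ω * e ω))
          (hg.integrable_sq.add (hge.const_mul 2)) he.integrable_sq, integral_add hg.integrable_sq (hge.const_mul 2), integral_const_mul]
    _ ≤ (√(∫ ω, g ω ^ 2 ∂μ) + √(∫ ω, e ω ^ 2 ∂μ)) ^ 2 := by
        rw [add_sq, Real.sq_sqrt (integral_nonneg fun _ => sq_nonneg _),
          Real.sq_sqrt (integral_nonneg fun _ => sq_nonneg _)]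
        have := integral_mul_le_sqrt_mul_sqrt hg he hg0 he0
        linarith

theorem integral_le_sqrt_integral_sq [IsProbabilityMeasure μ] {f : Ω → ℝ} (hf : MemLp f 2 μ)
    (hf0 : 0 ≤ᵐ[μ] f) : ∫ ω, f ω ∂μ ≤ √(∫ ω, f ω ^ 2 ∂μ) := by
  have := integral_mul_le_sqrt_mul_sqrt hf (memLp_const (1 : ℝ)) hf0
    (ae_of_all _ fun _ => zero_le_one)
  simpa using this

/-- Translation of a second moment bound on an extended-valued function. -/
theorem toReal_of_lintegral_sq_le {e : Ω → ℝ≥0∞} (he : Measurable e) {b : ℝ} (hb : 0 ≤ b)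
    (h : ∫⁻ ω, e ω ^ 2 ∂μ ≤ ENNReal.ofReal (b ^ 2)) :
    (∀ᵐ ω ∂μ, e ω ≠ ∞) ∧ MemLp (fun ω => (e ω).toReal) 2 μ ∧
      √(∫ ω, (e ω).toReal ^ 2 ∂μ) ≤ b := by
  have hfin : ∀ᵐ ω ∂μ, e ω ≠ ∞ := by
    have := ae_lt_top (he.pow_const 2) (h.trans_lt ENNReal.ofReal_lt_top).ne
    filter_upwards [this] with ω hω htop
    simp [htop] at hω
  have hsq : ∀ ω, (e ω).toReal ^ 2 = (e ω ^ 2).toReal := fun ω => (ENNReal.toReal_pow _ _).symm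
  have hint : ∫ ω, (e ω).toReal ^ 2 ∂μ = (∫⁻ ω, e ω ^ 2 ∂μ).toReal := by
    simp_rw [hsq]
    exact integral_toReal (he.pow_const 2).aemeasurable
      (ae_lt_top (he.pow_const 2) (h.trans_lt ENNReal.ofReal_lt_top).ne)
  refine ⟨hfin, ?_, ?_⟩
  · rw [memLp_two_iff_integrable_sq he.ennreal_toReal.aestronglyMeasurable]
    simp_rw [hsq]
    exact integrable_toReal_of_lintegral_ne_top (he.pow_const 2).aemeasurable
      (h.trans_lt ENNReal.ofReal_lt_top).ne
  · rw [Real.sqrt_le_left hb, hint]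
    exact ENNReal.toReal_le_of_le_ofReal (sq_nonneg _) h

end L2

/-! ### One-sided Hausdorff distances. -/

section Excess

variable {d : ℕ}

theorem infEDist_le_excess {D D' : Set (Vec d)} {x : Vec d} (hx : x ∈ D) :
    infEDist x D' ≤ excess D D' :=
  le_iSup₂ (f := fun x (_ : x ∈ D) => infEDist x D') x hx

theorem infDist_le_add_excess {D D' : Set (Vec d)} (hne : D.Nonempty)
    (hfin : excess D D' ≠ ∞) (v : Vec d) :
    infDist v D' ≤ infDist v D + (excess D D').toReal := by
  refine le_of_forall_pos_le_add fun ε hε => ?_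
  obtain ⟨y, hy, hy'⟩ := (infDist_lt_iff hne).1 (lt_add_of_pos_right (infDist v D) hε)
  have h1 : infDist y D' ≤ (excess D D').toReal :=
    ENNReal.toReal_mono hfin (infEDist_le_excess hy)
  have h2 : infDist v D' ≤ infDist y D' + dist v y := infDist_le_infDist_add_dist
  linarith

theorem measurable_excess_left {Ω : Type*} [MeasurableSpace Ω] {D : Ω → Set (Vec d)}
    (hD : ∀ U : Set (Vec d), IsOpen U → MeasurableSet {h | (D h ∩ U).Nonempty})
    (C : Set (Vec d)) : Measurable fun h => excess (D h) C := by
  refine measurable_of_Ioi fun c => ?_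
  convert hD {x | c < infEDist x C} (isOpen_lt continuous_const continuous_infEDist) using 1
  ext h
  simp only [Set.mem_preimage, Set.mem_Ioi, excess, lt_iSup_iff, Set.mem_ofPred_eq]
  constructor
  · rintro ⟨x, hx, hlt⟩; exact ⟨x, hx, hlt⟩
  · rintro ⟨x, hx, hlt⟩; exact ⟨x, hx, hlt⟩

theorem measurable_infEDist_const {Ω : Type*} [MeasurableSpace Ω] {D : Ω → Set (Vec d)}
    (hD : ∀ U : Set (Vec d), IsOpen U → MeasurableSet {h | (D h ∩ U).Nonempty}) (v : Vec d) :
    Measurable fun h => infEDist v (D h) := by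
  refine measurable_of_Iio fun c => ?_
  convert hD {x | edist v x < c} (isOpen_lt (by fun_prop) continuous_const) using 1
  ext h
  simp only [Set.mem_preimage, Set.mem_Iio, infEDist_lt_iff]
  rfl

/-- Since the distance to D h is continuous, the supremum over C equals the supremum over a
countable dense subset of C, which does not depend on h. -/
theorem measurable_excess_right {Ω : Type*} [MeasurableSpace Ω] {D : Ω → Set (Vec d)}
    (hD : ∀ U : Set (Vec d), IsOpen U → MeasurableSet {h | (D h ∩ U).Nonempty})
    (C : Set (Vec d)) : Measurable fun h => excess C (D h) := by
  obtain ⟨s, hsC, hs, hCs⟩ := (TopologicalSpace.IsSeparable.of_separableSpace C).exists_countable_dense_subset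
  have : (fun h => excess C (D h)) = fun h => ⨆ x ∈ s, infEDist x (D h) := by
    funext h
    refine le_antisymm (iSup₂_le fun x hx => ?_) (iSup₂_le fun x hx => infEDist_le_excess (hsC hx))
    have hcl : IsClosed {x | infEDist x (D h) ≤ ⨆ x ∈ s, infEDist x (D h)} :=
      isClosed_le continuous_infEDist continuous_const
    exact closure_minimal (fun y hy => le_iSup₂ (f := fun x (_ : x ∈ s) => infEDist x (D h)) y hy)
      hcl (hCs hx)
  rw [this]
  exact Measurable.biSup s hs fun x _ => measurable_infEDist_const hD x

theorem excess_eq_zero_iff {D D' : Set (Vec d)} (hcl : IsClosed D') :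
    excess D D' = 0 ↔ D ⊆ D' := by
  rw [excess, ← nonpos_iff_eq_zero, iSup₂_le_iff]
  refine forall₂_congr fun x _ => ?_
  rw [nonpos_iff_eq_zero, ← mem_closure_iff_infEDist_zero, hcl.closure_eq]

theorem measurableSet_subset_multifunction {Ω : Type*} [MeasurableSpace Ω] {D : Ω → Set (Vec d)}
    (hD : ∀ U : Set (Vec d), IsOpen U → MeasurableSet {h | (D h ∩ U).Nonempty})
    (hcl : ∀ h, IsClosed (D h)) (C : Set (Vec d)) : MeasurableSet {h | C ⊆ D h} := by
  have : {h | C ⊆ D h} = (fun h => excess C (D h)) ⁻¹' {0} := by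
    ext h
    simp [excess_eq_zero_iff (hcl h)]
  rw [this]
  exact measurable_excess_right hD C (measurableSet_singleton 0)

end Excess

end FairApproach

namespace FairApproach

/-! ### Almost sure bounds along a play, and the drift. -/

namespace Game

universe v

variable {A B X : Type*} {S : Type v} {Y : Type*} {d : ℕ}
  [MeasurableSpace A] [MeasurableSpace B] [MeasurableSpace X] [MeasurableSpace S]
  [MeasurableSpace Y]

variable (Γ : Game A B X S Y d) (σ : PlayerStrategy A X S d) (τ : NatureStrategy A B X S Y)

theorem measurable_hist (t : ℕ) : Measurable (Γ.hist t) :=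
  measurable_pi_lambda _ fun _ => Γ.measurable_see.comp (measurable_pi_apply _)

theorem avg_hist_mem_convexHull {t : ℕ} (ht : t ≠ 0) (ω : ℕ → Outcome A B X S) :
    avg (Γ.hist t ω) ∈ convexHull ℝ Γ.payoffs := by
  have ht' : (t : ℝ) ≠ 0 := Nat.cast_ne_zero.2 ht
  rw [avg, Finset.smul_sum]
  refine (convex_convexHull ℝ _).sum_mem (fun _ _ => by positivity) ?_ fun i _ =>
    subset_convexHull ℝ _ ⟨_, _, _, _, rfl⟩
  simp [ht']

theorem avg_hist_succ (t : ℕ) (ω : ℕ → Outcome A B X S) :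
    avg (Γ.hist (t + 1) ω) = ((t : ℝ) / (t + 1)) • avg (Γ.hist t ω)
      + (1 / ((t : ℝ) + 1)) • (Γ.see (ω t)).1 := by
  have h1 : ((t : ℝ) + 1) ≠ 0 := by positivity
  have h2 : ∑ i, (Γ.hist (t + 1) ω i).1 = ∑ i, (Γ.hist t ω i).1 + (Γ.see (ω t)).1 := by
    rw [Fin.sum_univ_castSucc]
    rfl
  rw [avg, avg, h2, smul_add, smul_smul]
  push_cast
  rcases eq_or_ne t 0 with rfl | ht
  · simp
  · have : (t : ℝ) ≠ 0 := Nat.cast_ne_zero.2 ht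
    congr 2
    field_simp

theorem norm_le_of_mem_payoffs {v : Vec d} (hv : v ∈ Γ.payoffs) : ‖v‖ ≤ Γ.supNorm := by
  obtain ⟨a, b, x, s, rfl⟩ := hv
  exact Γ.norm_payoff_le a b x s

theorem norm_le_of_mem_convexHull {v : Vec d} (hv : v ∈ convexHull ℝ Γ.payoffs) :
    ‖v‖ ≤ Γ.supNorm := by
  have := convexHull_min (s := Γ.payoffs) (t := closedBall 0 Γ.supNorm)
    (fun v hv => mem_closedBall_zero_iff.2 (Γ.norm_le_of_mem_payoffs hv)) (convex_closedBall _ _) hv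
  exact mem_closedBall_zero_iff.1 this

/-- The distance of the average payoff after `t` rounds to the estimate number `r` of the target
set. -/
def estDist (Chat : SetEstimator X S d) (r t : ℕ) (ω : ℕ → Outcome A B X S) : ℝ :=
  infDist (avg (Γ.hist t ω)) (Chat.set r (Γ.hist (2 ^ r) ω))

variable (Chat : SetEstimator X S d)

theorem estDist_nonneg (r t : ℕ) (ω : ℕ → Outcome A B X S) : 0 ≤ Γ.estDist Chat r t ω :=
  infDist_nonneg

theorem measurable_estDist (r t : ℕ) : Measurable (Γ.estDist Chat r t) :=
  measurable_infDist_multifunction (D := fun ω => Chat.set r (Γ.hist (2 ^ r) ω))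
    (fun _ => Chat.nonempty _ _) (fun U hU => Γ.measurable_hist _ (Chat.measurable r U hU))
    (measurable_avg.comp (Γ.measurable_hist t))

variable {Chat σ τ} {C : Set (Vec d)} {B' : ℝ} {β : ℕ → ℝ}

/-- The sign of β is automatic: a summable non-increasing sequence decreases to 0. -/
theorem SetEstimation.beta_nonneg {Γ : Game A B X S Y d} (h : Γ.SetEstimation Chat C σ τ B' β)
    (r : ℕ) : 0 ≤ β r :=
  h.antitone.le_of_tendsto h.summable.tendsto_atTop_zero r

theorem SetEstimation.infDist_le {Γ : Game A B X S Y d} (h : Γ.SetEstimation Chat C σ τ B' β) :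
    ∀ᵐ ω ∂Γ.law σ τ, ∀ r, ∀ w ∈ convexHull ℝ Γ.payoffs,
      infDist w (Chat.set r (Γ.hist (2 ^ r) ω)) ≤ B' := by
  filter_upwards [h.proj_dist] with ω hω r w hw
  refine infDist_le_of_mem_convexHull (Chat.nonempty _ _) (Chat.convex _ _) (fun v hv => ?_) hw
  rw [← norm_sub_proj (Chat.nonempty _ _) (Chat.isClosed _ _)]
  exact hω r v hv

/-- The bound at the payoffs passes to their averages because the distance to a convex set is
convex. Round 0 is left out: the empty average is 0 by convention and need not lie in the convex
hull of the payoffs. -/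
theorem SetEstimation.estDist_le {Γ : Game A B X S Y d} (h : Γ.SetEstimation Chat C σ τ B' β) :
    ∀ᵐ ω ∂Γ.law σ τ, ∀ r t, t ≠ 0 → Γ.estDist Chat r t ω ≤ B' := by
  filter_upwards [h.infDist_le] with ω hω r t ht
  exact hω r _ (Γ.avg_hist_mem_convexHull ht ω)

theorem SetEstimation.bound_nonneg {Γ : Game A B X S Y d} (h : Γ.SetEstimation Chat C σ τ B' β) :
    0 ≤ B' := by
  obtain ⟨ω, hω⟩ := h.estDist_le.exists
  exact (Γ.estDist_nonneg Chat 0 1 ω).trans (hω 0 1 one_ne_zero)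

theorem SetEstimation.stepBound {Γ : Game A B X S Y d} (h : Γ.SetEstimation Chat C σ τ B' β) :
    Γ.StepBound Chat σ τ (B' + 2 * Γ.supNorm) := by
  filter_upwards [h.infDist_le] with ω hω r v hv w hw
  have h1 := hω r w hw
  rw [← norm_sub_proj (Chat.nonempty _ _) (Chat.isClosed _ _)] at h1
  have h2 : ‖v - proj (Chat.set r (Γ.hist (2 ^ r) ω)) w‖ ≤
      ‖v - w‖ + ‖w - proj (Chat.set r (Γ.hist (2 ^ r) ω)) w‖ := norm_sub_le_norm_sub_add_norm_sub _ _ _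
  have h3 := norm_sub_le v w
  have h4 := Γ.norm_le_of_mem_payoffs hv
  have h5 := Γ.norm_le_of_mem_convexHull hw
  linarith

theorem SetEstimation.memLp_estDist {Γ : Game A B X S Y d} (h : Γ.SetEstimation Chat C σ τ B' β)
    (r : ℕ) {t : ℕ} (ht : t ≠ 0) : MemLp (Γ.estDist Chat r t) 2 (Γ.law σ τ) := by
  refine MemLp.of_bound (Γ.measurable_estDist Chat r t).aestronglyMeasurable B' ?_
  filter_upwards [h.estDist_le] with ω hω
  rw [Real.norm_of_nonneg (Γ.estDist_nonneg _ _ _ _)]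
  exact hω r t ht

variable [Fintype A] [MeasurableSingletonClass A] [Fintype B] [MeasurableSingletonClass B]

theorem inner_meanPayoff_le_add_tvDist (u : Vec d) (μ ν : Measure (X × S)) [IsProbabilityMeasure μ]
    [IsProbabilityMeasure ν] (p : Kernel X A) (q : Kernel Y B) [IsMarkovKernel p]
    [IsMarkovKernel q] :
    |inner ℝ u (Γ.meanPayoff μ p q) - inner ℝ u (Γ.meanPayoff ν p q)| ≤
      2 * Γ.supNorm * ‖u‖ * tvDist μ ν := by
  rw [inner_meanPayoff, inner_meanPayoff]
  refine (abs_integral_sub_le_tvDist μ ν (c := ‖u‖ * Γ.supNorm)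
    (measurable_const.inner (Γ.measurable_mixedPayoff p q)) fun z => ?_).trans
    (le_of_eq (by ring))
  exact (abs_real_inner_le_norm _ _).trans (by gcongr; exact Γ.norm_mixedPayoff_le _ _ _ _)

variable [Nonempty A] [Nonempty B] [StandardBorelSpace X] [Fintype S] [MeasurableSingletonClass S]

/-- The drift of a phase-wise projected strategy, at histories where the estimate contains the
target set. -/
theorem IsPhaseStrategy.inner_condMean_le {Γ : Game A B X S Y d}
    {Qhat : ∀ t : ℕ, Kernel (Fin t → Seen X S d) (X × S)} (hQhat : ∀ t, IsMarkovKernel (Qhat t))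
    (hσ : Γ.IsPhaseStrategy Qhat Chat σ) (hB : Γ.Blackwell C) {t : ℕ} (ht : t ≠ 0)
    (H : Fin t → Outcome A B X S) (hsub : C ⊆ Chat.current ht (Γ.seeAll H)) :
    inner ℝ (avg (Γ.seeAll H) - proj (Chat.current ht (Γ.seeAll H)) (avg (Γ.seeAll H)))
        (Γ.condMean σ τ t H - proj (Chat.current ht (Γ.seeAll H)) (avg (Γ.seeAll H))) ≤
      4 * Γ.supNorm * ‖avg (Γ.seeAll H) - proj (Chat.current ht (Γ.seeAll H)) (avg (Γ.seeAll H))‖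
        * tvDist (Qhat t (Γ.seeAll H)) Γ.ctx := by
  have := Γ.isProbabilityMeasure_ctx
  have := σ.isMarkov t
  have := τ.isMarkov t
  set h := Γ.seeAll H with hh
  set c := proj (Chat.current ht h) (avg h)
  set u := avg h - c
  obtain ⟨p, hp, c', hc', hle⟩ := hB.exists_worst_le u
  have h1 := Γ.inner_meanPayoff_le_add_tvDist u (Qhat t h) Γ.ctx ((σ.mix t).sectR h)
    ((τ.mix t).sectR H)
  have h2 : inner ℝ u (Γ.meanPayoff (Qhat t h) ((σ.mix t).sectR h) ((τ.mix t).sectR H)) ≤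
      inner ℝ u c' + 2 * Γ.supNorm * ‖u‖ * tvDist (Qhat t h) Γ.ctx := by
    refine (Γ.inner_meanPayoff_le_worst _ _ _ _).trans ((hσ t ht h p hp).trans ?_)
    refine Γ.worst_le _ _ _ fun q hq => ?_
    have h3 := Γ.inner_meanPayoff_le_add_tvDist u (Qhat t h) Γ.ctx p q
    have h4 := hle q hq
    linarith [(abs_le.1 h3).2]
  have h5 : inner ℝ u (c' - c) ≤ 0 := inner_sub_proj_le_zero (Chat.nonempty _ _)
    (Chat.isClosed _ _) (Chat.convex _ _) _ (hsub hc')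
  rw [inner_sub_right] at h5 ⊢
  rw [condMean, ← hh]
  linarith [(abs_le.1 h1).1]

end Game

end FairApproach

namespace FairApproach

/-! ### One round of a phase-wise strategy. -/

namespace Game

universe v

variable {A B X : Type*} {S : Type v} {Y : Type*} {d : ℕ}
  [MeasurableSpace A] [MeasurableSpace B] [MeasurableSpace X] [MeasurableSpace S]
  [MeasurableSpace Y]

variable (Γ : Game A B X S Y d) {σ : PlayerStrategy A X S d} {τ : NatureStrategy A B X S Y}
  {Chat : SetEstimator X S d} {C : Set (Vec d)} {B' R : ℝ} {β : ℕ → ℝ}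
  {Qhat : ∀ t : ℕ, Kernel (Fin t → Seen X S d) (X × S)}

variable (Chat) in
/-- The projection `ĉ_t` of the average payoff on the current estimate of the target set. -/
def curProj {t : ℕ} (ht : t ≠ 0) (H : Fin t → Outcome A B X S) : Vec d :=
  proj (Chat.current ht (Γ.seeAll H)) (avg (Γ.seeAll H))

variable (Chat) in
/-- The direction `m̄_t - ĉ_t` of the projection. -/
def curDir {t : ℕ} (ht : t ≠ 0) (H : Fin t → Outcome A B X S) : Vec d :=
  avg (Γ.seeAll H) - Γ.curProj Chat ht H

theorem measurable_castLE_seeAll {s t : ℕ} (hst : s ≤ t) :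
    Measurable fun (H : Fin t → Outcome A B X S) (i : Fin s) => Γ.seeAll H (Fin.castLE hst i) :=
  measurable_pi_lambda _ fun _ => (measurable_pi_apply _).comp Γ.measurable_seeAll

theorem measurable_curProj {t : ℕ} (ht : t ≠ 0) : Measurable (Γ.curProj Chat ht) :=
  measurable_proj_estimator Chat _ (Γ.measurable_castLE_seeAll _)
    (measurable_avg.comp Γ.measurable_seeAll)

theorem measurable_curDir {t : ℕ} (ht : t ≠ 0) : Measurable (Γ.curDir Chat ht) :=
  (measurable_avg.comp Γ.measurable_seeAll).sub (Γ.measurable_curProj ht)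

theorem norm_curDir {t : ℕ} (ht : t ≠ 0) (ω : ℕ → Outcome A B X S) :
    ‖Γ.curDir Chat ht (fullHist t ω)‖ = Γ.estDist Chat (Nat.log 2 t) t ω :=
  norm_sub_proj (Chat.nonempty _ _) (Chat.isClosed _ _) _

variable [Fintype A] [MeasurableSingletonClass A] [Fintype B] [MeasurableSingletonClass B]

theorem measurable_condMean (t : ℕ) : Measurable (Γ.condMean σ τ t) := by
  have : Γ.condMean σ τ t = fun H =>
      ∫ o, Γ.payoff o.2.1 o.2.2 o.1.1 o.1.2 ∂Γ.step σ τ t H := by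
    funext H
    rw [integral_payoff_step]
  rw [this]
  exact (StronglyMeasurable.integral_kernel (κ := Γ.step σ τ t)
    Γ.measurable_payoff.stronglyMeasurable).measurable

theorem norm_condMean_le (t : ℕ) (H : Fin t → Outcome A B X S) :
    ‖Γ.condMean σ τ t H‖ ≤ Γ.supNorm := by
  have := Γ.isProbabilityMeasure_ctx
  have := σ.isMarkov t
  have := τ.isMarkov t
  exact Γ.norm_meanPayoff_le _ _ _

/-- Bounds on the quantities of one round that hold almost surely. -/
theorem SetEstimation.bounds {Γ : Game A B X S Y d} (h : Γ.SetEstimation Chat C σ τ B' β)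
    {t : ℕ} (ht : t ≠ 0) :
    ∀ᵐ ω ∂Γ.law σ τ, ‖Γ.curDir Chat ht (fullHist t ω)‖ ≤ B' ∧
      ‖Γ.curProj Chat ht (fullHist t ω)‖ ≤ Γ.supNorm + B' ∧
      ‖(Γ.see (ω t)).1 - Γ.curProj Chat ht (fullHist t ω)‖ ≤ B' + 2 * Γ.supNorm := by
  filter_upwards [h.estDist_le] with ω hω
  have h1 : ‖Γ.curDir Chat ht (fullHist t ω)‖ ≤ B' := by
    rw [norm_curDir]; exact hω _ t ht
  have h2 : ‖avg (Γ.seeAll (fullHist t ω))‖ ≤ Γ.supNorm :=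
    Γ.norm_le_of_mem_convexHull (Γ.avg_hist_mem_convexHull ht ω)
  have h3 : ‖Γ.curProj Chat ht (fullHist t ω)‖ ≤ Γ.supNorm + B' := by
    have : Γ.curProj Chat ht (fullHist t ω) =
        avg (Γ.seeAll (fullHist t ω)) - Γ.curDir Chat ht (fullHist t ω) := by
      rw [curDir]; abel
    rw [this]
    exact (norm_sub_le _ _).trans (add_le_add h2 h1)
  refine ⟨h1, h3, ?_⟩
  have h4 : ‖(Γ.see (ω t)).1‖ ≤ Γ.supNorm := Γ.norm_payoff_le _ _ _ _
  have h5 := norm_sub_le (Γ.see (ω t)).1 (Γ.curProj Chat ht (fullHist t ω))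
  linarith

variable [Nonempty A] [Nonempty B] [StandardBorelSpace X] [Fintype S] [MeasurableSingletonClass S]

variable (Qhat) in
/-- The error of the estimation of the law of the contexts along a play. -/
def tvAt (t : ℕ) (ω : ℕ → Outcome A B X S) : ℝ := tvDist (Qhat t (Γ.hist t ω)) Γ.ctx

theorem measurable_tvAt (hQhat : ∀ t, IsMarkovKernel (Qhat t)) (t : ℕ) :
    Measurable (Γ.tvAt Qhat t) := by
  have := Γ.isProbabilityMeasure_ctx
  exact (measurable_tvDist (Qhat t) Γ.ctx).comp (Γ.measurable_hist t)

theorem tvAt_nonneg (t : ℕ) (ω : ℕ → Outcome A B X S) : 0 ≤ Γ.tvAt Qhat t ω := tvDist_nonneg _ _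

theorem tvAt_le_one (hQhat : ∀ t, IsMarkovKernel (Qhat t)) (t : ℕ) (ω : ℕ → Outcome A B X S) :
    Γ.tvAt Qhat t ω ≤ 1 := by
  have := Γ.isProbabilityMeasure_ctx
  exact tvDist_le_one _ _

theorem memLp_tvAt (hQhat : ∀ t, IsMarkovKernel (Qhat t)) (t : ℕ) :
    MemLp (Γ.tvAt Qhat t) 2 (Γ.law σ τ) := by
  refine MemLp.of_bound (Γ.measurable_tvAt hQhat t).aestronglyMeasurable 1
    (ae_of_all _ fun ω => ?_)
  rw [Real.norm_of_nonneg (Γ.tvAt_nonneg _ _)]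
  exact Γ.tvAt_le_one hQhat t ω

theorem tvErr_nonneg (t : ℕ) : 0 ≤ Γ.tvErr Qhat σ τ t := Real.sqrt_nonneg _

theorem tvErr_le_one (hQhat : ∀ t, IsMarkovKernel (Qhat t)) (t : ℕ) :
    Γ.tvErr Qhat σ τ t ≤ 1 := by
  rw [tvErr, Real.sqrt_le_left zero_le_one, one_pow]
  have h := integral_mono (μ := Γ.law σ τ) (Γ.memLp_tvAt hQhat t (σ := σ) (τ := τ)).integrable_sq
    (integrable_const (1 : ℝ))
    fun ω => pow_le_one₀ (n := 2) (Γ.tvAt_nonneg t ω) (Γ.tvAt_le_one hQhat t ω)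
  simpa [tvAt] using h

theorem SetEstimation.real_compl_le {Γ : Game A B X S Y d} (h : Γ.SetEstimation Chat C σ τ B' β)
    (r : ℕ) :
    (Γ.law σ τ).real {ω | C ⊆ Chat.set r (Γ.hist (2 ^ r) ω)}ᶜ ≤ 1 / (2 * 2 ^ r : ℝ) := by
  have hm : MeasurableSet {ω | C ⊆ Chat.set r (Γ.hist (2 ^ r) ω)} :=
    measurableSet_subset_multifunction
      (fun U hU => Γ.measurable_hist _ (Chat.measurable r U hU)) (fun _ => Chat.isClosed _ _) C
  rw [probReal_compl_eq_one_sub hm]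
  linarith [h.superset r]

theorem measurableSet_subset_current {t : ℕ} (ht : t ≠ 0) :
    MeasurableSet {H : Fin t → Outcome A B X S | C ⊆ Chat.current ht (Γ.seeAll H)} :=
  measurableSet_subset_multifunction
    (fun U hU => Γ.measurable_castLE_seeAll (Nat.pow_log_le_self 2 ht)
      (Chat.measurable (Nat.log 2 t) U hU)) (fun _ => Chat.isClosed _ _) C

/-- Histories whose estimate contains C contribute the conditional drift, bounded by the
Cauchy–Schwarz inequality; on the others the inner product is at most B'(B' + 2M), with probability
at most 1/(2T_r). The event G of the past is arbitrary because the maximal inequality stops the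
process. -/
theorem IsPhaseStrategy.setIntegral_inner_le {Γ : Game A B X S Y d}
    (hQhat : ∀ t, IsMarkovKernel (Qhat t)) (hσ : Γ.IsPhaseStrategy Qhat Chat σ)
    (hB : Γ.Blackwell C) (hE : Γ.SetEstimation Chat C σ τ B' β) {t : ℕ} (ht : t ≠ 0)
    {G : Set (Fin t → Outcome A B X S)} (hG : MeasurableSet G) :
    ∫ ω in fullHist t ⁻¹' G, inner ℝ (Γ.curDir Chat ht (fullHist t ω))
        ((Γ.see (ω t)).1 - Γ.curProj Chat ht (fullHist t ω)) ∂Γ.law σ τ ≤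
      4 * Γ.supNorm * (√(∫ ω, Γ.estDist Chat (Nat.log 2 t) t ω ^ 2 ∂Γ.law σ τ)
          * Γ.tvErr Qhat σ τ t)
        + (B' ^ 2 + 2 * B' * Γ.supNorm) / (2 * 2 ^ Nat.log 2 t) := by
  have hB0 := hE.bound_nonneg
  have hM0 := Γ.supNorm_nonneg
  have hH := measurable_fullHist (A := A) (B := B) (X := X) (S := S) t
  have hsee : Measurable fun ω : ℕ → Outcome A B X S => (Γ.see (ω t)).1 :=
    (measurable_fst.comp Γ.measurable_see).comp (measurable_pi_apply t)
  set I : (ℕ → Outcome A B X S) → ℝ := fun ω => inner ℝ (Γ.curDir Chat ht (fullHist t ω))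
        ((Γ.see (ω t)).1 - Γ.curProj Chat ht (fullHist t ω)) with hI
  have hImeas : Measurable I := ((Γ.measurable_curDir ht).comp hH).inner
    (hsee.sub ((Γ.measurable_curProj ht).comp hH))
  have hIbd : ∀ᵐ ω ∂Γ.law σ τ, ‖I ω‖ ≤ B' ^ 2 + 2 * B' * Γ.supNorm := by
    filter_upwards [hE.bounds ht] with ω hω
    calc ‖I ω‖ ≤ _ := norm_inner_le_norm _ _
      _ ≤ B' * (B' + 2 * Γ.supNorm) := by
        gcongr
        · exact hω.1
        · exact hω.2.2
      _ = _ := by ring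
  have hIint : Integrable I (Γ.law σ τ) := Integrable.of_bound hImeas.aestronglyMeasurable _ hIbd
  set Gd := {H : Fin t → Outcome A B X S | C ⊆ Chat.current ht (Γ.seeAll H)} with hGd
  have hGdm : MeasurableSet Gd := Γ.measurableSet_subset_current ht
  rw [← integral_inter_add_sdiff (hH hGdm) hIint.integrableOn]
  have hgood : ∫ ω in fullHist t ⁻¹' G ∩ fullHist t ⁻¹' Gd, I ω ∂Γ.law σ τ ≤
      4 * Γ.supNorm * (√(∫ ω, Γ.estDist Chat (Nat.log 2 t) t ω ^ 2 ∂Γ.law σ τ)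
          * Γ.tvErr Qhat σ τ t) := by
    -- Setting the direction to zero off the good histories in G keeps it a function of the history,
    -- so the next payoff may be replaced with its conditional mean.
    set u : (Fin t → Outcome A B X S) → Vec d := (G ∩ Gd).indicator (Γ.curDir Chat ht) with hu
    have hum : Measurable u := (Γ.measurable_curDir ht).indicator (hG.inter hGdm)
    have hubd : ∀ᵐ ω ∂Γ.law σ τ, ‖u (fullHist t ω)‖ ≤ B' := by
      filter_upwards [hE.bounds ht] with ω hω
      exact (norm_indicator_le_norm_self _ _).trans hω.1
    have hint : ∀ {f : (ℕ → Outcome A B X S) → Vec d}, Measurable f → ∀ c : ℝ,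
        (∀ᵐ ω ∂Γ.law σ τ, ‖f ω‖ ≤ c) →
        Integrable (fun ω => inner ℝ (u (fullHist t ω)) (f ω)) (Γ.law σ τ) := by
      intro f hf c hc
      refine Integrable.of_bound ((hum.comp hH).inner hf).aestronglyMeasurable (B' * c) ?_
      filter_upwards [hubd, hc] with ω h1 h2
      exact (norm_inner_le_norm _ _).trans (by gcongr)
    have hproj : Integrable (fun ω => inner ℝ (u (fullHist t ω))
        (Γ.curProj Chat ht (fullHist t ω))) (Γ.law σ τ) := hint ((Γ.measurable_curProj ht).comp hH) (Γ.supNorm + B')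
      (by filter_upwards [hE.bounds ht] with ω hω using hω.2.1)
    have hpay := hint hsee Γ.supNorm (ae_of_all _ fun ω => Γ.norm_payoff_le _ _ _ _)
    have hmean : Integrable (fun ω => inner ℝ (u (fullHist t ω))
        (Γ.condMean σ τ t (fullHist t ω))) (Γ.law σ τ) := hint ((Γ.measurable_condMean (σ := σ) (τ := τ) t).comp hH) Γ.supNorm
      (ae_of_all _ fun ω => Γ.norm_condMean_le t _)
    calc ∫ ω in fullHist t ⁻¹' G ∩ fullHist t ⁻¹' Gd, I ω ∂Γ.law σ τ
        = ∫ ω, inner ℝ (u (fullHist t ω)) (Γ.see (ω t)).1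
            - inner ℝ (u (fullHist t ω)) (Γ.curProj Chat ht (fullHist t ω)) ∂Γ.law σ τ := by
          rw [← Set.preimage_inter, ← integral_indicator (hH (hG.inter hGdm))]
          refine integral_congr_ae (ae_of_all _ fun ω => ?_)
          by_cases hω : fullHist t ω ∈ G ∩ Gd
          · rw [Set.indicator_of_mem (show ω ∈ fullHist t ⁻¹' (G ∩ Gd) from hω)]
            simp only [hu, hI, Set.indicator_of_mem hω, inner_sub_right]
          · rw [Set.indicator_of_notMem (show ω ∉ fullHist t ⁻¹' (G ∩ Gd) from hω)]
            simp only [hu, Set.indicator_of_notMem hω, inner_zero_left, sub_zero]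
      _ = ∫ ω, inner ℝ (u (fullHist t ω)) (Γ.condMean σ τ t (fullHist t ω))
            - inner ℝ (u (fullHist t ω)) (Γ.curProj Chat ht (fullHist t ω)) ∂Γ.law σ τ := by
          rw [integral_sub hpay hproj, Γ.integral_inner_payoff_law σ τ t hum hubd]
          exact (integral_sub hmean hproj).symm
      _ ≤ ∫ ω, 4 * Γ.supNorm * (Γ.estDist Chat (Nat.log 2 t) t ω * Γ.tvAt Qhat t ω)
            ∂Γ.law σ τ := by
          refine integral_mono (hmean.sub hproj)
            (((hE.memLp_estDist _ ht).integrable_mul (Γ.memLp_tvAt hQhat t)).const_mul _)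
            fun ω => ?_
          have h0 : 0 ≤ 4 * Γ.supNorm * (Γ.estDist Chat (Nat.log 2 t) t ω * Γ.tvAt Qhat t ω) := by
            have := Γ.estDist_nonneg Chat (Nat.log 2 t) t ω
            have := Γ.tvAt_nonneg (Qhat := Qhat) t ω
            positivity
          by_cases hω : fullHist t ω ∈ G ∩ Gd
          · have h1 := hσ.inner_condMean_le (τ := τ) hQhat hB ht (fullHist t ω) hω.2
            have h2 := Γ.norm_curDir (Chat := Chat) ht ω
            simp only [hu, Set.indicator_of_mem hω]
            rw [← inner_sub_right, ← h2, ← mul_assoc]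
            exact h1
          · simpa only [hu, Set.indicator_of_notMem hω, inner_zero_left, sub_zero] using h0
      _ ≤ _ := by
          rw [integral_const_mul]
          gcongr
          exact integral_mul_le_sqrt_mul_sqrt (hE.memLp_estDist _ ht) (Γ.memLp_tvAt hQhat t)
            (ae_of_all _ fun ω => Γ.estDist_nonneg _ _ _ _) (ae_of_all _ fun ω => Γ.tvAt_nonneg _ _)
  have hbad : ∫ ω in fullHist t ⁻¹' G \ fullHist t ⁻¹' Gd, I ω ∂Γ.law σ τ ≤
      (B' ^ 2 + 2 * B' * Γ.supNorm) / (2 * 2 ^ Nat.log 2 t) := by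
    have h1 := norm_setIntegral_le_of_norm_le_const_ae (μ := Γ.law σ τ)
      (s := fullHist t ⁻¹' G \ fullHist t ⁻¹' Gd) (measure_lt_top _ _)
      (ae_restrict_of_ae hIbd)
    have h2 : (Γ.law σ τ).real (fullHist t ⁻¹' G \ fullHist t ⁻¹' Gd) ≤
        1 / (2 * 2 ^ Nat.log 2 t) :=
      (measureReal_mono fun ω hω => hω.2).trans (hE.real_compl_le (Nat.log 2 t))
    calc _ ≤ _ := (le_abs_self _).trans h1
      _ ≤ (B' ^ 2 + 2 * B' * Γ.supNorm) * (1 / (2 * 2 ^ Nat.log 2 t)) := by gcongr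
      _ = _ := by ring
  exact add_le_add hgood hbad

/-- One round of a phase-wise projected strategy. -/
theorem IsPhaseStrategy.setIntegral_estDist_succ_le {Γ : Game A B X S Y d}
    (hQhat : ∀ t, IsMarkovKernel (Qhat t)) (hσ : Γ.IsPhaseStrategy Qhat Chat σ)
    (hB : Γ.Blackwell C) (hE : Γ.SetEstimation Chat C σ τ B' β) (hR : Γ.StepBound Chat σ τ R)
    {t : ℕ} (ht : t ≠ 0) {G : Set (Fin t → Outcome A B X S)} (hG : MeasurableSet G) :
    ∫ ω in fullHist t ⁻¹' G, Γ.estDist Chat (Nat.log 2 t) (t + 1) ω ^ 2 ∂Γ.law σ τ ≤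
      ((t : ℝ) / (t + 1)) ^ 2 *
          ∫ ω in fullHist t ⁻¹' G, Γ.estDist Chat (Nat.log 2 t) t ω ^ 2 ∂Γ.law σ τ
        + rateConst Γ.supNorm B' R / ((t : ℝ) + 1) ^ 2
        + 8 * Γ.supNorm * t / ((t : ℝ) + 1) ^ 2 *
          (√(∫ ω, Γ.estDist Chat (Nat.log 2 t) t ω ^ 2 ∂Γ.law σ τ) * Γ.tvErr Qhat σ τ t) := by
  have hB0 := hE.bound_nonneg
  have hM0 := Γ.supNorm_nonneg
  have hdrift := hσ.setIntegral_inner_le hQhat hB hE ht hG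
  set r := Nat.log 2 t with hr
  set E := fullHist t ⁻¹' G with hEdef
  set I : (ℕ → Outcome A B X S) → ℝ := fun ω => inner ℝ (Γ.curDir Chat ht (fullHist t ω))
        ((Γ.see (ω t)).1 - Γ.curProj Chat ht (fullHist t ω)) with hI
  have hIint : Integrable I (Γ.law σ τ) := by
    have hH := measurable_fullHist (A := A) (B := B) (X := X) (S := S) t
    have hsee : Measurable fun ω : ℕ → Outcome A B X S => (Γ.see (ω t)).1 :=
      (measurable_fst.comp Γ.measurable_see).comp (measurable_pi_apply t)
    refine Integrable.of_bound (((Γ.measurable_curDir ht).comp hH).inner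
      (hsee.sub ((Γ.measurable_curProj ht).comp hH))).aestronglyMeasurable
      (B' * (B' + 2 * Γ.supNorm)) ?_
    filter_upwards [hE.bounds ht] with ω hω
    refine (norm_inner_le_norm _ _).trans ?_
    gcongr
    · exact hω.1
    · exact hω.2.2
  -- The old projection ĉ_t still belongs to the estimate r, and m̄_{t+1} - ĉ_t is the convex
  -- combination of m̄_t - ĉ_t and m_{t+1} - ĉ_t with weights t/(t+1) and 1/(t+1).
  have hpath : ∀ᵐ ω ∂Γ.law σ τ, Γ.estDist Chat r (t + 1) ω ^ 2 ≤
      ((t : ℝ) / (t + 1)) ^ 2 * Γ.estDist Chat r t ω ^ 2 + R ^ 2 / ((t : ℝ) + 1) ^ 2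
        + 2 * t / ((t : ℝ) + 1) ^ 2 * I ω := by
    filter_upwards [hR] with ω hω
    have h1 : ‖(Γ.see (ω t)).1 - Γ.curProj Chat ht (fullHist t ω)‖ ≤ R :=
      hω r _ ⟨_, _, _, _, rfl⟩ _ (Γ.avg_hist_mem_convexHull ht ω)
    have h2 : Γ.estDist Chat r (t + 1) ω ≤
        ‖((t : ℝ) / (t + 1)) • Γ.curDir Chat ht (fullHist t ω)
          + (1 / ((t : ℝ) + 1)) • ((Γ.see (ω t)).1 - Γ.curProj Chat ht (fullHist t ω))‖ := by
      have h3 : ((t : ℝ) / (t + 1)) • Γ.curDir Chat ht (fullHist t ω)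
          + (1 / ((t : ℝ) + 1)) • ((Γ.see (ω t)).1 - Γ.curProj Chat ht (fullHist t ω)) =
          avg (Γ.hist (t + 1) ω) - Γ.curProj Chat ht (fullHist t ω) := by
        have h4 : (t : ℝ) / (t + 1) = 1 - 1 / ((t : ℝ) + 1) := by field_simp; ring
        rw [avg_hist_succ, curDir, ← hist_eq_seeAll, h4]
        module
      rw [h3, ← dist_eq_norm]
      exact infDist_le_dist_of_mem (proj_mem (Chat.nonempty _ _) (Chat.isClosed _ _) _)
    calc Γ.estDist Chat r (t + 1) ω ^ 2 ≤ _ :=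
          pow_le_pow_left₀ (Γ.estDist_nonneg _ _ _ _) h2 2
      _ = ((t : ℝ) / (t + 1)) ^ 2 * Γ.estDist Chat r t ω ^ 2
          + (‖(Γ.see (ω t)).1 - Γ.curProj Chat ht (fullHist t ω)‖) ^ 2 / ((t : ℝ) + 1) ^ 2
          + 2 * t / ((t : ℝ) + 1) ^ 2 * I ω := by
          rw [norm_add_sq_real, norm_smul, norm_smul, inner_smul_left, inner_smul_right,
            norm_curDir, Real.norm_of_nonneg (by positivity), Real.norm_of_nonneg (by positivity)]
          simp only [hI, conj_trivial, ← hr]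
          field_simp
          ring
      _ ≤ _ := by gcongr
  have hsq : ∀ s, s ≠ 0 → IntegrableOn (fun ω => Γ.estDist Chat r s ω ^ 2) E (Γ.law σ τ) :=
    fun s hs => (hE.memLp_estDist r hs).integrable_sq.integrableOn
  have h1 : ∫ ω in E, Γ.estDist Chat r (t + 1) ω ^ 2 ∂Γ.law σ τ ≤
      ((t : ℝ) / (t + 1)) ^ 2 * (∫ ω in E, Γ.estDist Chat r t ω ^ 2 ∂Γ.law σ τ)
        + (Γ.law σ τ).real E * (R ^ 2 / ((t : ℝ) + 1) ^ 2)
        + 2 * t / ((t : ℝ) + 1) ^ 2 * ∫ ω in E, I ω ∂Γ.law σ τ := by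
    have h2 := integral_mono_ae (μ := (Γ.law σ τ).restrict E) (hsq (t + 1) (Nat.succ_ne_zero t))
      ((((hsq t ht).const_mul (((t : ℝ) / (t + 1)) ^ 2)).add
        (integrable_const (R ^ 2 / ((t : ℝ) + 1) ^ 2))).add
        (hIint.integrableOn.const_mul (2 * t / ((t : ℝ) + 1) ^ 2))) (ae_restrict_of_ae hpath)
    refine h2.trans (le_of_eq ?_)
    simp only [Pi.add_apply]
    rw [integral_add (f := fun ω => ((t : ℝ) / (t + 1)) ^ 2 * Γ.estDist Chat r t ω ^ 2
        + R ^ 2 / ((t : ℝ) + 1) ^ 2) (((hsq t ht).const_mul _).add (integrable_const _))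
        (hIint.integrableOn.const_mul _),
      integral_add ((hsq t ht).const_mul _) (integrable_const _), integral_const_mul,
      integral_const_mul, setIntegral_const, smul_eq_mul]
  have hP : (Γ.law σ τ).real E ≤ 1 := measureReal_le_one
  -- Within phase r, the probability 1/(2T_r) of a bad estimate is at most 1/(t+1). Its contribution
  -- is thus of order 1/(t+1)² and joins R² to form the constant K.
  have hlog : (t : ℝ) + 1 ≤ 2 * 2 ^ r := by
    have : t < 2 ^ (r + 1) := Nat.lt_pow_succ_log_self one_lt_two t
    rw [pow_succ'] at this
    exact_mod_cast this
  set δ := √(∫ ω, Γ.estDist Chat r t ω ^ 2 ∂Γ.law σ τ) * Γ.tvErr Qhat σ τ t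
  have ht1 : (0 : ℝ) < (t : ℝ) + 1 := by positivity
  calc _ ≤ _ := h1
    _ ≤ ((t : ℝ) / (t + 1)) ^ 2 * (∫ ω in E, Γ.estDist Chat r t ω ^ 2 ∂Γ.law σ τ)
        + 1 * (R ^ 2 / ((t : ℝ) + 1) ^ 2)
        + 2 * t / ((t : ℝ) + 1) ^ 2 * (4 * Γ.supNorm * δ
          + (B' ^ 2 + 2 * B' * Γ.supNorm) / ((t : ℝ) + 1)) := by
        gcongr
        refine hdrift.trans ?_
        gcongr
    _ = ((t : ℝ) / (t + 1)) ^ 2 * (∫ ω in E, Γ.estDist Chat r t ω ^ 2 ∂Γ.law σ τ)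
        + (R ^ 2 / ((t : ℝ) + 1) ^ 2
          + (t / ((t : ℝ) + 1)) * ((2 * B' ^ 2 + 4 * B' * Γ.supNorm) / ((t : ℝ) + 1) ^ 2))
        + 8 * Γ.supNorm * t / ((t : ℝ) + 1) ^ 2 * δ := by field_simp; ring
    _ ≤ ((t : ℝ) / (t + 1)) ^ 2 * (∫ ω in E, Γ.estDist Chat r t ω ^ 2 ∂Γ.law σ τ)
        + (R ^ 2 / ((t : ℝ) + 1) ^ 2
          + 1 * ((2 * B' ^ 2 + 4 * B' * Γ.supNorm) / ((t : ℝ) + 1) ^ 2))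
        + 8 * Γ.supNorm * t / ((t : ℝ) + 1) ^ 2 * δ := by
        gcongr
        rw [div_le_one ht1]
        linarith
    _ = _ := by rw [rateConst]; ring

end Game

end FairApproach

namespace FairApproach

/-! ### A maximal inequality for almost supermartingales. -/

section Maximal

variable {Ω : Type*} {m : MeasurableSpace Ω} {μ : Measure Ω} [IsProbabilityMeasure μ]

/-- A maximal inequality for almost supermartingales, over a finite horizon. -/
theorem mul_real_exists_le_add {ℱ : ℕ → MeasurableSpace Ω} (hmono : Monotone ℱ)
    (hle : ∀ t, ℱ t ≤ m) {T : ℕ} {D : ℕ → Ω → ℝ} (hmeas : ∀ t, T ≤ t → Measurable[ℱ t] (D t))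
    (h0 : ∀ t ω, 0 ≤ D t ω) (hint : ∀ t, T ≤ t → Integrable (D t) μ) {x : ℕ → ℝ}
    (hstep : ∀ t, T ≤ t → ∀ E, MeasurableSet[ℱ t] E →
      ∫ ω in E, D (t + 1) ω ∂μ ≤ ∫ ω in E, D t ω ∂μ + x t) (l : ℝ) (n : ℕ) :
    l * μ.real {ω | ∃ i ≤ n, l ≤ D (T + i) ω} ≤
      ∫ ω, D T ω ∂μ + ∑ i ∈ Finset.range n, x (T + i) := by
  let hit : ℕ → Set Ω := fun n => {ω | ∃ i ≤ n, l ≤ D (T + i) ω}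
  have hhit : ∀ n, MeasurableSet[ℱ (T + n)] (hit n) := by
    intro n
    have : hit n = ⋃ i ∈ Set.Iic n, {ω | l ≤ D (T + i) ω} := by
      ext ω; simp [hit]
    rw [this]
    refine MeasurableSet.biUnion (Set.to_countable _) fun i hi => ?_
    have h1 : MeasurableSet[ℱ (T + i)] {ω | l ≤ D (T + i) ω} :=
      hmeas (T + i) (Nat.le_add_right _ _) measurableSet_Ici
    exact hmono (Nat.add_le_add_left hi T) _ h1
  have hhit' : ∀ n, MeasurableSet (hit n) := fun n => hle _ _ (hhit n)
  have hmarkov : ∀ (n : ℕ) (E : Set Ω), MeasurableSet E →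
      l * μ.real (E ∩ {ω | l ≤ D (T + n) ω}) + ∫ ω in E \ {ω | l ≤ D (T + n) ω}, D (T + n) ω ∂μ ≤
        ∫ ω in E, D (T + n) ω ∂μ := by
    intro n E hE
    have hS : MeasurableSet {ω | l ≤ D (T + n) ω} :=
      measurableSet_le measurable_const ((hmeas _ (Nat.le_add_right _ _)).mono (hle _) le_rfl)
    have hi := hint (T + n) (Nat.le_add_right _ _)
    rw [← integral_inter_add_sdiff (s := E) hS hi.integrableOn]
    refine add_le_add ?_ le_rfl
    have h1 := setIntegral_mono_on (μ := μ) (f := fun _ => l) (integrable_const _).integrableOn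
      hi.integrableOn (hE.inter hS) fun ω hω => hω.2
    rw [setIntegral_const, smul_eq_mul] at h1
    linarith
  -- The induction must also carry the integral over the paths that have not reached the level l. It
  -- is on this event of the past that `hstep` applies, before Markov's inequality removes the newly
  -- hit paths.
  have key : ∀ n, l * μ.real (hit n) + ∫ ω in (hit n)ᶜ, D (T + n) ω ∂μ ≤
      ∫ ω, D T ω ∂μ + ∑ i ∈ Finset.range n, x (T + i) := by
    intro n
    induction n with
    | zero =>
      have h1 := hmarkov 0 Set.univ MeasurableSet.univ
      have h2 : hit 0 = {ω | l ≤ D (T + 0) ω} := by ext ω; simp [hit]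
      rw [Set.univ_inter, ← Set.compl_eq_univ_sdiff, setIntegral_univ, ← h2] at h1
      simpa using h1
    | succ n ih =>
      have h1 := hmarkov (n + 1) (hit n)ᶜ (hhit' n).compl
      have h2 := hstep (T + n) (Nat.le_add_right _ _) (hit n)ᶜ (hhit n).compl
      have h3 : hit (n + 1) = hit n ∪ ((hit n)ᶜ ∩ {ω | l ≤ D (T + (n + 1)) ω}) := by
        ext ω
        simp only [hit, Set.mem_ofPred_eq, Set.mem_union, Set.mem_inter_iff, Set.mem_compl_iff]
        constructor
        · rintro ⟨i, hi, hl⟩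
          by_cases hex : ∃ i ≤ n, l ≤ D (T + i) ω
          · exact Or.inl hex
          · rcases Nat.le_succ_iff.1 hi with hi | rfl
            · exact absurd ⟨i, hi, hl⟩ hex
            · exact Or.inr ⟨hex, hl⟩
        · rintro (⟨i, hi, hl⟩ | ⟨-, hl⟩)
          · exact ⟨i, hi.trans n.le_succ, hl⟩
          · exact ⟨n + 1, le_rfl, hl⟩
      have h4 : (hit (n + 1))ᶜ = (hit n)ᶜ \ {ω | l ≤ D (T + (n + 1)) ω} := by
        rw [h3]
        ext ω
        simp only [Set.mem_compl_iff, Set.mem_union, Set.mem_inter_iff, Set.mem_sdiff]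
        tauto
      have hS : MeasurableSet {ω | l ≤ D (T + (n + 1)) ω} :=
        measurableSet_le measurable_const ((hmeas _ (Nat.le_add_right _ _)).mono (hle _) le_rfl)
      rw [h4, h3, measureReal_union (Set.disjoint_left.2 fun ω h h' => h'.1 h)
        ((hhit' n).compl.inter hS), Finset.sum_range_succ, mul_add]
      rw [show T + (n + 1) = T + n + 1 by ring] at h1 ⊢
      linarith
  refine le_trans ?_ (key n)
  have : 0 ≤ ∫ ω in (hit n)ᶜ, D (T + n) ω ∂μ := integral_nonneg fun ω => h0 _ ω
  linarith

/-- A maximal inequality for almost supermartingales. -/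
theorem mul_real_exists_ge_le {ℱ : ℕ → MeasurableSpace Ω} (hmono : Monotone ℱ)
    (hle : ∀ t, ℱ t ≤ m) {T : ℕ} {D : ℕ → Ω → ℝ} (hmeas : ∀ t, T ≤ t → Measurable[ℱ t] (D t))
    (h0 : ∀ t ω, 0 ≤ D t ω) (hint : ∀ t, T ≤ t → Integrable (D t) μ) {x : ℕ → ℝ}
    (hstep : ∀ t, T ≤ t → ∀ E, MeasurableSet[ℱ t] E →
      ∫ ω in E, D (t + 1) ω ∂μ ≤ ∫ ω in E, D t ω ∂μ + x t) (l : ℝ) {b : ℝ}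
    (hb : ∀ n, ∑ i ∈ Finset.range n, x (T + i) ≤ b) :
    l * μ.real {ω | ∃ t, T ≤ t ∧ l ≤ D t ω} ≤ ∫ ω, D T ω ∂μ + b := by
  have hunion : {ω | ∃ t, T ≤ t ∧ l ≤ D t ω} = ⋃ n : ℕ, {ω | ∃ i ≤ n, l ≤ D (T + i) ω} := by
    ext ω
    simp only [Set.mem_ofPred_eq, Set.mem_iUnion]
    constructor
    · rintro ⟨t, ht, hl⟩
      exact ⟨t - T, t - T, le_rfl, by rwa [Nat.add_sub_cancel' ht]⟩
    · rintro ⟨n, i, -, hl⟩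
      exact ⟨T + i, Nat.le_add_right _ _, hl⟩
  have htend : Tendsto (fun n : ℕ => μ.real {ω | ∃ i ≤ n, l ≤ D (T + i) ω}) atTop
      (𝓝 (μ.real {ω | ∃ t, T ≤ t ∧ l ≤ D t ω})) := by
    rw [hunion]
    refine (ENNReal.tendsto_toReal (measure_ne_top _ _)).comp (tendsto_measure_iUnion_atTop ?_)
    exact fun n n' hn ω ⟨i, hi, hl⟩ => ⟨i, hi.trans hn, hl⟩
  refine le_of_tendsto (htend.const_mul l) (Eventually.of_forall fun n => ?_)
  refine (mul_real_exists_le_add hmono hle hmeas h0 hint hstep l n).trans ?_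
  gcongr
  exact hb n

end Maximal

/-! ### Changes of phase. -/

namespace Game

universe v

variable {A B X : Type*} {S : Type v} {Y : Type*} {d : ℕ}
  [MeasurableSpace A] [MeasurableSpace B] [MeasurableSpace X] [MeasurableSpace S]
  [MeasurableSpace Y]

variable (Γ : Game A B X S Y d) {σ : PlayerStrategy A X S d} {τ : NatureStrategy A B X S Y}
  (Chat : SetEstimator X S d) (C : Set (Vec d)) {B' R : ℝ} {β : ℕ → ℝ}

/-- The one-sided distance of the estimate number `r` to the target set along a play. -/
def excL (r : ℕ) (ω : ℕ → Outcome A B X S) : ℝ≥0∞ := excess (Chat.set r (Γ.hist (2 ^ r) ω)) C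

/-- The one-sided distance of the target set to the estimate number `r` along a play. -/
def excR (r : ℕ) (ω : ℕ → Outcome A B X S) : ℝ≥0∞ := excess C (Chat.set r (Γ.hist (2 ^ r) ω))

theorem measurable_excL (r : ℕ) : Measurable (Γ.excL Chat C r) :=
  measurable_excess_left (fun U hU => Γ.measurable_hist _ (Chat.measurable r U hU)) C

theorem measurable_excR (r : ℕ) : Measurable (Γ.excR Chat C r) :=
  measurable_excess_right (fun U hU => Γ.measurable_hist _ (Chat.measurable r U hU)) C

variable {Chat C}

theorem SetEstimation.excL_spec {Γ : Game A B X S Y d} (h : Γ.SetEstimation Chat C σ τ B' β)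
    (r : ℕ) :
    (∀ᵐ ω ∂Γ.law σ τ, Γ.excL Chat C r ω ≠ ∞) ∧
      MemLp (fun ω => (Γ.excL Chat C r ω).toReal) 2 (Γ.law σ τ) ∧
      √(∫ ω, (Γ.excL Chat C r ω).toReal ^ 2 ∂Γ.law σ τ) ≤ β r :=
  toReal_of_lintegral_sq_le (Γ.measurable_excL Chat C r) (h.beta_nonneg r) (h.excess_left r)

theorem SetEstimation.excR_spec {Γ : Game A B X S Y d} (h : Γ.SetEstimation Chat C σ τ B' β)
    (r : ℕ) :
    (∀ᵐ ω ∂Γ.law σ τ, Γ.excR Chat C r ω ≠ ∞) ∧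
      MemLp (fun ω => (Γ.excR Chat C r ω).toReal) 2 (Γ.law σ τ) ∧
      √(∫ ω, (Γ.excR Chat C r ω).toReal ^ 2 ∂Γ.law σ τ) ≤ β r :=
  toReal_of_lintegral_sq_le (Γ.measurable_excR Chat C r) (h.beta_nonneg r) (h.excess_right r)

theorem SetEstimation.dist_le {Γ : Game A B X S Y d} (h : Γ.SetEstimation Chat C σ τ B' β) :
    ∀ᵐ ω ∂Γ.law σ τ, ∀ r t,
      Γ.dist C t ω ≤ Γ.estDist Chat r t ω + (Γ.excL Chat C r ω).toReal := by
  filter_upwards [ae_all_iff.2 fun r => (h.excL_spec r).1] with ω hω r t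
  exact infDist_le_add_excess (Chat.nonempty _ _) (hω r) _

/-- Two successive estimates are compared through C: the distance to the first controls the distance
to C, which controls the distance to the second. -/
theorem SetEstimation.estDist_succ_le {Γ : Game A B X S Y d} (hC : C.Nonempty)
    (h : Γ.SetEstimation Chat C σ τ B' β) (r t : ℕ) :
    ∀ᵐ ω ∂Γ.law σ τ, Γ.estDist Chat (r + 1) t ω ≤ Γ.estDist Chat r t ω +
      ((Γ.excL Chat C r ω).toReal + (Γ.excR Chat C (r + 1) ω).toReal) := by
  filter_upwards [(h.excL_spec r).1, (h.excR_spec (r + 1)).1] with ω h1 h2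
  have h3 := infDist_le_add_excess (Chat.nonempty r (Γ.hist (2 ^ r) ω)) h1 (avg (Γ.hist t ω))
  have h4 := infDist_le_add_excess hC h2 (avg (Γ.hist t ω))
  unfold estDist excL excR
  linarith

/-- The jump of the `L²` norm of the distance when the estimate is updated. -/
theorem SetEstimation.sqrt_integral_estDist_succ_le {Γ : Game A B X S Y d} (hC : C.Nonempty)
    (h : Γ.SetEstimation Chat C σ τ B' β) (r : ℕ) {t : ℕ} (ht : t ≠ 0) :
    √(∫ ω, Γ.estDist Chat (r + 1) t ω ^ 2 ∂Γ.law σ τ) ≤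
      √(∫ ω, Γ.estDist Chat r t ω ^ 2 ∂Γ.law σ τ) + 2 * β r := by
  have hL := h.excL_spec r
  have hR := h.excR_spec (r + 1)
  have h1 := sqrt_integral_sq_le_add (h.memLp_estDist r ht) (hL.2.1.add hR.2.1)
    (ae_of_all _ fun ω => Γ.estDist_nonneg Chat (r + 1) t ω)
    (ae_of_all _ fun ω => Γ.estDist_nonneg Chat r t ω)
    (ae_of_all _ fun ω => add_nonneg ENNReal.toReal_nonneg ENNReal.toReal_nonneg)
    (h.estDist_succ_le hC r t)
  have h2 := sqrt_integral_sq_le_add (μ := Γ.law σ τ)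
    (f := fun ω => (Γ.excL Chat C r ω).toReal + (Γ.excR Chat C (r + 1) ω).toReal) hL.2.1 hR.2.1
    (ae_of_all _ fun ω => add_nonneg ENNReal.toReal_nonneg ENNReal.toReal_nonneg)
    (ae_of_all _ fun ω => ENNReal.toReal_nonneg)
    (ae_of_all _ fun ω => ENNReal.toReal_nonneg) (ae_of_all _ fun ω => le_rfl)
  -- The jump is bounded by β_r + β_{r+1}, and monotonicity turns this into 2β_r.
  have h3 := h.antitone r.le_succ
  simp only [Pi.add_apply] at h1
  have h4 := hL.2.2
  have h5 := hR.2.2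
  simp only [Nat.succ_eq_add_one] at h3
  linarith

/-- The jump of the squared distance when the estimate is updated. -/
theorem SetEstimation.setIntegral_estDist_succ_le {Γ : Game A B X S Y d} (hC : C.Nonempty)
    (h : Γ.SetEstimation Chat C σ τ B' β) (r : ℕ) {t : ℕ} (ht : t ≠ 0)
    (E : Set (ℕ → Outcome A B X S)) :
    ∫ ω in E, Γ.estDist Chat (r + 1) t ω ^ 2 ∂Γ.law σ τ ≤
      ∫ ω in E, Γ.estDist Chat r t ω ^ 2 ∂Γ.law σ τ + 4 * B' * β r := by
  have hB0 := h.bound_nonneg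
  have hL := h.excL_spec r
  have hR := h.excR_spec (r + 1)
  set e : (ℕ → Outcome A B X S) → ℝ := fun ω =>
    (Γ.excL Chat C r ω).toReal + (Γ.excR Chat C (r + 1) ω).toReal with he
  have he0 : ∀ ω, 0 ≤ e ω := fun ω => add_nonneg ENNReal.toReal_nonneg ENNReal.toReal_nonneg
  have hLi := hL.2.1.integrable one_le_two
  have hRi := hR.2.1.integrable one_le_two
  have hei : Integrable e (Γ.law σ τ) := hLi.add hRi
  have hpath : ∀ᵐ ω ∂Γ.law σ τ, Γ.estDist Chat (r + 1) t ω ^ 2 ≤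
      Γ.estDist Chat r t ω ^ 2 + 2 * B' * e ω := by
    filter_upwards [h.estDist_succ_le hC r t, h.estDist_le] with ω h1 h2
    have h3 := h2 r t ht
    have h4 := h2 (r + 1) t ht
    have h5 := Γ.estDist_nonneg Chat r t ω
    have h6 := Γ.estDist_nonneg Chat (r + 1) t ω
    have h7 : Γ.estDist Chat (r + 1) t ω - Γ.estDist Chat r t ω ≤ e ω := by
      simp only [he]; linarith
    rcases le_total (Γ.estDist Chat (r + 1) t ω) (Γ.estDist Chat r t ω) with hle | hle
    · have := mul_nonneg hB0 (he0 ω)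
      nlinarith
    -- Difference of two squares: the distances differ by at most e and their sum is at most 2B'.
    · have h8 : (Γ.estDist Chat (r + 1) t ω - Γ.estDist Chat r t ω) *
          (Γ.estDist Chat (r + 1) t ω + Γ.estDist Chat r t ω) ≤ e ω * (2 * B') :=
        mul_le_mul h7 (by linarith) (by linarith) (he0 ω)
      linarith
  have hsq : ∀ r, IntegrableOn (fun ω => Γ.estDist Chat r t ω ^ 2) E (Γ.law σ τ) :=
    fun r => (h.memLp_estDist r ht).integrable_sq.integrableOn
  have h1 := integral_mono_ae (μ := (Γ.law σ τ).restrict E) (hsq (r + 1))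
    ((hsq r).add (hei.integrableOn.const_mul (2 * B'))) (ae_restrict_of_ae hpath)
  have h2 : ∫ ω in E, e ω ∂Γ.law σ τ ≤ ∫ ω, e ω ∂Γ.law σ τ :=
    setIntegral_le_integral hei (ae_of_all _ he0)
  have h3 : ∫ ω, e ω ∂Γ.law σ τ ≤ 2 * β r := by
    rw [he, integral_add hLi hRi]
    have h4 := integral_le_sqrt_integral_sq hL.2.1 (ae_of_all _ fun ω => ENNReal.toReal_nonneg)
    have h5 := integral_le_sqrt_integral_sq hR.2.1 (ae_of_all _ fun ω => ENNReal.toReal_nonneg)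
    have h6 := h.antitone r.le_succ
    have h7 := hL.2.2
    have h8 := hR.2.2
    simp only [Nat.succ_eq_add_one] at h6
    linarith
  simp only [Pi.add_apply] at h1
  rw [integral_add (hsq r) (hei.integrableOn.const_mul _), integral_const_mul] at h1
  refine h1.trans ?_
  have h4 : 2 * B' * ∫ ω in E, e ω ∂Γ.law σ τ ≤ 2 * B' * (2 * β r) := by
    gcongr
    exact h2.trans h3
  linarith

end Game

end FairApproach

/-! ### The L² rate and the almost-supermartingale property. -/

namespace FairApproach

/-- The estimate in force changes only when t + 1 reaches the next power of two; the transitions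
from t to t + 1 are treated according to these two cases. -/
theorem log_two_succ_cases {t : ℕ} (ht : t ≠ 0) :
    Nat.log 2 (t + 1) = Nat.log 2 t ∨
      (Nat.log 2 (t + 1) = Nat.log 2 t + 1 ∧ t + 1 = 2 ^ (Nat.log 2 t + 1)) := by
  have h1 : t < 2 ^ (Nat.log 2 t + 1) := Nat.lt_pow_succ_log_self one_lt_two t
  have h2 : 2 ^ Nat.log 2 t ≤ t := Nat.pow_log_le_self 2 ht
  rcases Nat.lt_or_ge (t + 1) (2 ^ (Nat.log 2 t + 1)) with h | h
  · exact Or.inl (Nat.log_eq_of_pow_le_of_lt_pow (h2.trans t.le_succ) h)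
  · have h3 : t + 1 = 2 ^ (Nat.log 2 t + 1) := le_antisymm h1 h
    refine Or.inr ⟨?_, h3⟩
    conv_lhs => rw [h3]
    exact Nat.log_pow one_lt_two _

/-- One step of the recursion that governs the `L²` rate. -/
theorem le_sqrt_add_of_sq_le {W V a b K s : ℝ} (hK : 0 ≤ K) (hs : 0 ≤ s) (hV : V ≤ √s + a)
    (hV0 : 0 ≤ V) (hab : 0 ≤ a + b) (hb : 0 ≤ b) (hW : W ^ 2 ≤ V ^ 2 + K + 2 * b * V) :
    W ≤ √(s + K) + (a + b) := by
  refine abs_le_of_sq_le_sq' ?_ (by positivity) |>.2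
  have h1 : √s ≤ √(s + K) := Real.sqrt_le_sqrt (by linarith)
  -- Complete the square; then (√s + a + b)² + K ≤ (√(s + K) + a + b)² since √s ≤ √(s + K).
  have h2 : W ^ 2 ≤ (V + b) ^ 2 + K := by nlinarith [sq_nonneg b]
  have h3 : (V + b) ^ 2 ≤ (√s + (a + b)) ^ 2 := by
    apply pow_le_pow_left₀ (by linarith); linarith
  have h4 : √s ^ 2 = s := Real.sq_sqrt hs
  have h5 : √(s + K) ^ 2 = s + K := Real.sq_sqrt (by linarith)
  nlinarith [mul_le_mul_of_nonneg_left h1 hab]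

theorem rateConst_nonneg {M B R : ℝ} (hM : 0 ≤ M) (hB : 0 ≤ B) : 0 ≤ rateConst M B R := by
  unfold rateConst; positivity

/-- The recursion yields the constant √K; this passes to the larger constant that appears in the
stated rates. -/
theorem sqrt_le_sqrt_two_mul_div (K : ℝ) : √K ≤ √(2 * K) / (√2 - 1) := by
  have h1 : (1 : ℝ) < √2 := Real.lt_sqrt_of_sq_lt (by norm_num)
  have h2 : √2 ^ 2 = (2 : ℝ) := Real.sq_sqrt (by norm_num)
  rw [le_div_iff₀ (by linarith), Real.sqrt_mul (by norm_num)]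
  nlinarith [Real.sqrt_nonneg K]

namespace Game

universe v

variable {A B X : Type*} {S : Type v} {Y : Type*} {d : ℕ}
  [MeasurableSpace A] [MeasurableSpace B] [MeasurableSpace X] [MeasurableSpace S]
  [MeasurableSpace Y]

variable (Γ : Game A B X S Y d) {σ : PlayerStrategy A X S d} {τ : NatureStrategy A B X S Y}
  {Chat : SetEstimator X S d} {C : Set (Vec d)} {B' R : ℝ} {β : ℕ → ℝ}
  {Qhat : ∀ t : ℕ, Kernel (Fin t → Seen X S d) (X × S)}

variable (Chat) in
/-- The distance of the average payoff to the current estimate of the target set. -/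
def curDist (t : ℕ) : (ℕ → Outcome A B X S) → ℝ := Γ.estDist Chat (Nat.log 2 t) t

variable (σ τ Chat) in
/-- The `L²` norm of the distance to the current estimate of the target set. -/
def curNorm (t : ℕ) : ℝ := √(∫ ω, Γ.curDist Chat t ω ^ 2 ∂Γ.law σ τ)

variable [Fintype A] [MeasurableSingletonClass A] [Fintype B] [MeasurableSingletonClass B]
  [Nonempty A] [Nonempty B] [StandardBorelSpace X] [Fintype S] [MeasurableSingletonClass S]

/-- After multiplication by t, one round reads W² ≤ V² + K + 2bV with b = 4Mδ_t, so K accumulates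
under the square root and the errors b outside it. Phase changes also add to the part outside. -/
theorem IsPhaseStrategy.mul_curNorm_le {Γ : Game A B X S Y d}
    (hQhat : ∀ t, IsMarkovKernel (Qhat t)) (hσ : Γ.IsPhaseStrategy Qhat Chat σ)
    (hC : C.Nonempty) (hB : Γ.Blackwell C) (hE : Γ.SetEstimation Chat C σ τ B' β)
    (hR : Γ.StepBound Chat σ τ R) {t : ℕ} (ht : 1 ≤ t) :
    t * Γ.curNorm σ τ Chat t ≤ √(t * rateConst Γ.supNorm B' R)
      + (4 * Γ.supNorm * ∑ s ∈ Finset.Ico 1 t, Γ.tvErr Qhat σ τ s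
        + 4 * ∑ r ∈ Finset.range (Nat.log 2 t), 2 ^ r * β r) := by
  have hB0 := hE.bound_nonneg
  have hM0 := Γ.supNorm_nonneg
  set K := rateConst Γ.supNorm B' R with hKdef
  have hK0 : 0 ≤ K := rateConst_nonneg hM0 hB0
  induction t, ht using Nat.le_induction with
  | base =>
    have h1 : Γ.curNorm σ τ Chat 1 ≤ √K := by
      refine Real.sqrt_le_sqrt ?_
      have h2 : ∫ ω, Γ.curDist Chat 1 ω ^ 2 ∂Γ.law σ τ ≤ ∫ _, B' ^ 2 ∂Γ.law σ τ := by
        refine integral_mono_ae (hE.memLp_estDist _ one_ne_zero).integrable_sq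
          (integrable_const _) ?_
        filter_upwards [hE.estDist_le] with ω hω
        exact pow_le_pow_left₀ (Γ.estDist_nonneg _ _ _ _) (hω _ 1 one_ne_zero) 2
      rw [integral_const, probReal_univ, one_smul] at h2
      have : B' ^ 2 ≤ K := by
        rw [hKdef, rateConst]
        nlinarith [sq_nonneg R, sq_nonneg B', mul_nonneg hB0 hM0]
      linarith
    simpa using h1
  | succ t ht ih =>
    have ht0 : t ≠ 0 := Nat.one_le_iff_ne_zero.1 ht
    have htpos : (0 : ℝ) < t := by positivity
    set W := √(∫ ω, Γ.estDist Chat (Nat.log 2 t) (t + 1) ω ^ 2 ∂Γ.law σ τ) with hW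
    set δ := Γ.tvErr Qhat σ τ t with hδ
    have hδ0 : 0 ≤ δ := Γ.tvErr_nonneg t
    have hV0 : 0 ≤ Γ.curNorm σ τ Chat t := Real.sqrt_nonneg _
    set a := 4 * Γ.supNorm * ∑ s ∈ Finset.Ico 1 t, Γ.tvErr Qhat σ τ s
        + 4 * ∑ r ∈ Finset.range (Nat.log 2 t), 2 ^ r * β r with ha
    have ha0 : 0 ≤ a := by
      have h1 : 0 ≤ ∑ s ∈ Finset.Ico 1 t, Γ.tvErr Qhat σ τ s :=
        Finset.sum_nonneg fun s _ => Γ.tvErr_nonneg s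
      have h2 : 0 ≤ ∑ r ∈ Finset.range (Nat.log 2 t), 2 ^ r * β r :=
        Finset.sum_nonneg fun r _ => mul_nonneg (by positivity) (hE.beta_nonneg r)
      exact add_nonneg (mul_nonneg (by linarith) h1) (mul_nonneg (by norm_num) h2)
    have hb0 : 0 ≤ 4 * Γ.supNorm * δ := mul_nonneg (by linarith) hδ0
    have hstep := hσ.setIntegral_estDist_succ_le hQhat hB hE hR ht0 MeasurableSet.univ
    rw [Set.preimage_univ, setIntegral_univ, setIntegral_univ] at hstep
    have hWsq : W ^ 2 = ∫ ω, Γ.estDist Chat (Nat.log 2 t) (t + 1) ω ^ 2 ∂Γ.law σ τ :=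
      Real.sq_sqrt (integral_nonneg fun _ => sq_nonneg _)
    have hVsq : Γ.curNorm σ τ Chat t ^ 2 =
        ∫ ω, Γ.estDist Chat (Nat.log 2 t) t ω ^ 2 ∂Γ.law σ τ :=
      Real.sq_sqrt (integral_nonneg fun _ => sq_nonneg _)
    have h1 : ((t + 1) * W) ^ 2 ≤ (t * Γ.curNorm σ τ Chat t) ^ 2 + K
        + 2 * (4 * Γ.supNorm * δ) * (t * Γ.curNorm σ τ Chat t) := by
      rw [mul_pow, hWsq]
      have h2 : ((t : ℝ) + 1) ^ 2 * (((t : ℝ) / (t + 1)) ^ 2 * Γ.curNorm σ τ Chat t ^ 2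
          + K / ((t : ℝ) + 1) ^ 2
          + 8 * Γ.supNorm * t / ((t : ℝ) + 1) ^ 2 * (Γ.curNorm σ τ Chat t * δ)) =
          (t * Γ.curNorm σ τ Chat t) ^ 2 + K
        + 2 * (4 * Γ.supNorm * δ) * (t * Γ.curNorm σ τ Chat t) := by
        field_simp
        ring
      rw [← h2, hVsq]
      gcongr
      exact hstep
    have h2 : (t + 1) * W ≤ √(t * K + K) + (a + 4 * Γ.supNorm * δ) :=
      le_sqrt_add_of_sq_le hK0 (mul_nonneg htpos.le hK0) ih (mul_nonneg htpos.le hV0)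
        (add_nonneg ha0 hb0) hb0 h1
    -- The difference of sums vanishes inside a phase and equals 2^r β_r at a change. There the jump
    -- 2β_r is weighted by t + 1 = 2·2^r, whence the factor 4.
    have h3 : ((t : ℝ) + 1) * Γ.curNorm σ τ Chat (t + 1) ≤ (t + 1) * W
        + 4 * (∑ r ∈ Finset.range (Nat.log 2 (t + 1)), 2 ^ r * β r
          - ∑ r ∈ Finset.range (Nat.log 2 t), 2 ^ r * β r) := by
      rcases log_two_succ_cases ht0 with hlog | ⟨hlog, hpow⟩
      · simp only [curNorm, curDist, hlog, sub_self, mul_zero, add_zero]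
        exact le_rfl
      · have h4 := hE.sqrt_integral_estDist_succ_le hC (Nat.log 2 t) (Nat.succ_ne_zero t)
        have h5 : (t : ℝ) + 1 = 2 * 2 ^ Nat.log 2 t := by
          rw [← pow_succ']; exact_mod_cast hpow
        simp only [curNorm, curDist, hlog, Finset.sum_range_succ, add_sub_cancel_left]
        calc ((t : ℝ) + 1) * _ ≤ ((t : ℝ) + 1) * (W + 2 * β (Nat.log 2 t)) := by gcongr
          _ = (t + 1) * W + 2 * ((t : ℝ) + 1) * β (Nat.log 2 t) := by ring
          _ = _ := by rw [h5]; ring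
    push_cast
    rw [Finset.sum_Ico_succ_top ht]
    rw [show (t : ℝ) * K + K = (t + 1) * K by ring] at h2
    calc _ ≤ _ := h3
      _ ≤ _ := by linarith

theorem IsPhaseStrategy.curNorm_le {Γ : Game A B X S Y d}
    (hQhat : ∀ t, IsMarkovKernel (Qhat t)) (hσ : Γ.IsPhaseStrategy Qhat Chat σ)
    (hC : C.Nonempty) (hB : Γ.Blackwell C) (hE : Γ.SetEstimation Chat C σ τ B' β)
    (hR : Γ.StepBound Chat σ τ R) {t : ℕ} (ht : 1 ≤ t) :
    Γ.curNorm σ τ Chat t ≤ √(rateConst Γ.supNorm B' R) / √t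
      + (4 * Γ.supNorm / t * ∑ s ∈ Finset.Ico 1 t, Γ.tvErr Qhat σ τ s
        + 4 / t * ∑ r ∈ Finset.range (Nat.log 2 t), 2 ^ r * β r) := by
  have h := hσ.mul_curNorm_le hQhat hC hB hE hR ht
  have htpos : (0 : ℝ) < t := by positivity
  rw [← le_div_iff₀' htpos] at h
  refine h.trans (le_of_eq ?_)
  rw [Real.sqrt_mul htpos.le]
  have h1 : √(t : ℝ) ≠ 0 := (Real.sqrt_pos.2 htpos).ne'
  have h2 : √(t : ℝ) * √(t : ℝ) = t := Real.mul_self_sqrt htpos.le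
  have h3 : √(t : ℝ) * √(rateConst Γ.supNorm B' R) / t = √(rateConst Γ.supNorm B' R) / √t := by
    rw [div_eq_div_iff htpos.ne' h1]
    linear_combination √(rateConst Γ.supNorm B' R) * h2
  rw [add_div, h3]
  ring

/-- The `L²` rate. -/
theorem IsPhaseStrategy.sqrt_integral_dist_sq_le {Γ : Game A B X S Y d}
    (hQhat : ∀ t, IsMarkovKernel (Qhat t)) (hσ : Γ.IsPhaseStrategy Qhat Chat σ)
    (hC : C.Nonempty) (hB : Γ.Blackwell C) (hE : Γ.SetEstimation Chat C σ τ B' β)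
    (hR : Γ.StepBound Chat σ τ R) {r t : ℕ} (h1 : 2 ^ r ≤ t) (h2 : t < 2 ^ (r + 1)) :
    √(∫ ω, Γ.dist C t ω ^ 2 ∂Γ.law σ τ) ≤
      l2Rate Γ.supNorm B' R β (Γ.tvErr Qhat σ τ) r t := by
  have ht : 1 ≤ t := Nat.one_le_two_pow.trans h1
  have ht0 : t ≠ 0 := Nat.one_le_iff_ne_zero.1 ht
  have htpos : (0 : ℝ) < t := by positivity
  have hlog : Nat.log 2 t = r := Nat.log_eq_of_pow_le_of_lt_pow h1 h2
  have h3 := hσ.curNorm_le hQhat hC hB hE hR ht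
  rw [hlog] at h3
  have hL := hE.excL_spec r
  have h4 : √(∫ ω, Γ.dist C t ω ^ 2 ∂Γ.law σ τ) ≤ Γ.curNorm σ τ Chat t + β r := by
    have h5 := sqrt_integral_sq_le_add (hE.memLp_estDist r ht0) hL.2.1
      (f := Γ.dist C t) (ae_of_all _ fun ω => infDist_nonneg)
      (ae_of_all _ fun ω => Γ.estDist_nonneg Chat r t ω)
      (ae_of_all _ fun ω => ENNReal.toReal_nonneg)
      (by filter_upwards [hE.dist_le] with ω hω using hω r t)
    rw [curNorm, curDist, hlog]
    exact h5.trans (by gcongr; exact hL.2.2)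
  -- The distance from the estimate r to C becomes the last term of the sum, since t ≤ 4·2^r within
  -- phase r.
  have h5 : β r ≤ 4 / t * (2 ^ r * β r) := by
    have h6 : (t : ℝ) ≤ 4 * 2 ^ r := by
      have : (t : ℝ) < 2 ^ (r + 1) := by exact_mod_cast h2
      rw [pow_succ'] at this
      have h7 : (0 : ℝ) < 2 ^ r := by positivity
      linarith
    have h7 : 1 ≤ 4 * 2 ^ r / (t : ℝ) := by rwa [one_le_div htpos]
    calc β r = 1 * β r := (one_mul _).symm
      _ ≤ 4 * 2 ^ r / (t : ℝ) * β r := by gcongr; exact hE.beta_nonneg r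
      _ = _ := by ring
  have h6 : √(rateConst Γ.supNorm B' R) / √t ≤
      √(2 * rateConst Γ.supNorm B' R) / ((√2 - 1) * √t) := by
    rw [← div_div]
    gcongr
    exact sqrt_le_sqrt_two_mul_div _
  rw [l2Rate, Finset.sum_range_succ, mul_add]
  linarith

/-- The current distance is almost a supermartingale. -/
theorem IsPhaseStrategy.setIntegral_curDist_succ_le {Γ : Game A B X S Y d}
    (hQhat : ∀ t, IsMarkovKernel (Qhat t)) (hσ : Γ.IsPhaseStrategy Qhat Chat σ)
    (hC : C.Nonempty) (hB : Γ.Blackwell C) (hE : Γ.SetEstimation Chat C σ τ B' β)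
    (hR : Γ.StepBound Chat σ τ R) {t : ℕ} (ht : t ≠ 0) {G : Set (Fin t → Outcome A B X S)}
    (hG : MeasurableSet G) :
    ∫ ω in fullHist t ⁻¹' G, Γ.curDist Chat (t + 1) ω ^ 2 ∂Γ.law σ τ ≤
      ∫ ω in fullHist t ⁻¹' G, Γ.curDist Chat t ω ^ 2 ∂Γ.law σ τ +
        (rateConst Γ.supNorm B' R / ((t : ℝ) + 1) ^ 2
          + 8 * Γ.supNorm / t * (Γ.curNorm σ τ Chat t * Γ.tvErr Qhat σ τ t)
          + 4 * B' * (∑ k ∈ Finset.range (Nat.log 2 (t + 1)), β k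
            - ∑ k ∈ Finset.range (Nat.log 2 t), β k)) := by
  have hM0 := Γ.supNorm_nonneg
  have htpos : (0 : ℝ) < t := by positivity
  have h1 := hσ.setIntegral_estDist_succ_le hQhat hB hE hR ht hG
  have h2 : ((t : ℝ) / (t + 1)) ^ 2 *
      (∫ ω in fullHist t ⁻¹' G, Γ.estDist Chat (Nat.log 2 t) t ω ^ 2 ∂Γ.law σ τ) ≤
      1 * ∫ ω in fullHist t ⁻¹' G, Γ.curDist Chat t ω ^ 2 ∂Γ.law σ τ := by
    refine mul_le_mul_of_nonneg_right ?_ (integral_nonneg fun _ => sq_nonneg _)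
    refine pow_le_one₀ (by positivity) ?_
    rw [div_le_one (by positivity)]
    linarith
  have h3 : 8 * Γ.supNorm * t / ((t : ℝ) + 1) ^ 2 *
      (Γ.curNorm σ τ Chat t * Γ.tvErr Qhat σ τ t) ≤
      8 * Γ.supNorm / t * (Γ.curNorm σ τ Chat t * Γ.tvErr Qhat σ τ t) := by
    refine mul_le_mul_of_nonneg_right ?_
      (mul_nonneg (Real.sqrt_nonneg _) (Γ.tvErr_nonneg t))
    rw [mul_div_assoc, div_eq_mul_inv (8 * Γ.supNorm)]
    gcongr
    rw [div_le_iff₀ (by positivity), inv_mul_eq_div, le_div_iff₀ htpos]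
    nlinarith
  -- Writing the jump as a difference of partial sums of β treats both cases at once and lets the
  -- jumps telescope later.
  have h4 : ∫ ω in fullHist t ⁻¹' G, Γ.curDist Chat (t + 1) ω ^ 2 ∂Γ.law σ τ ≤
      ∫ ω in fullHist t ⁻¹' G, Γ.estDist Chat (Nat.log 2 t) (t + 1) ω ^ 2 ∂Γ.law σ τ
        + 4 * B' * (∑ k ∈ Finset.range (Nat.log 2 (t + 1)), β k
            - ∑ k ∈ Finset.range (Nat.log 2 t), β k) := by
    rcases log_two_succ_cases ht with hlog | ⟨hlog, -⟩
    · simp only [curDist, hlog, sub_self, mul_zero, add_zero]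
      exact le_rfl
    · have h5 := hE.setIntegral_estDist_succ_le hC (Nat.log 2 t) (Nat.succ_ne_zero t)
        (fullHist t ⁻¹' G)
      simp only [curDist, hlog, Finset.sum_range_succ, add_sub_cancel_left]
      exact h5
  change _ ≤ _ + _ + 8 * Γ.supNorm * t / ((t : ℝ) + 1) ^ 2 *
      (Γ.curNorm σ τ Chat t * Γ.tvErr Qhat σ τ t) at h1
  linarith

end Game

end FairApproach

namespace FairApproach

/-! ### Weighted averages, tails of series and the limit of `xi`. -/

section Sequences

theorem tendsto_iSup_tail {u : ℕ → ℝ} (h0 : ∀ t, 0 ≤ u t) (hu : Tendsto u atTop (𝓝 0)) :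
    Tendsto (fun T => ⨆ t : {t : ℕ // T ≤ t}, u t) atTop (𝓝 0) := by
  refine tendsto_order.2 ⟨fun a ha => Eventually.of_forall fun T =>
    ha.trans_le (Real.iSup_nonneg fun t => h0 t), fun a ha => ?_⟩
  obtain ⟨N, hN⟩ := eventually_atTop.1 (hu.eventually_le_const (half_pos ha))
  filter_upwards [eventually_ge_atTop N] with T hT
  have : Nonempty {t : ℕ // T ≤ t} := ⟨⟨T, le_rfl⟩⟩
  exact (ciSup_le fun t : {t : ℕ // T ≤ t} => hN t (hT.trans t.2)).trans_lt (half_lt_self ha)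

/-- Weighted averages of a sequence tend to zero, if the weighted terms are summable. -/
theorem tendsto_weighted_average {w f : ℕ → ℝ} (hw0 : ∀ n, 0 ≤ w n) (hw : Monotone w) (hwtop : Tendsto w atTop atTop) (hf : Summable f) (hf0 : ∀ n, 0 ≤ f n) :
    Tendsto (fun n => 1 / w n * ∑ k ∈ Finset.Ico 0 n, w k * f k) atTop (𝓝 0) := by
  have h1 : ∀ n, 1 / w n * ∑ k ∈ Finset.Ico 0 n, w k * f k =
      ∑' k, (if k ∈ Finset.Ico 0 n then w k / w n * f k else 0) := by
    intro n
    rw [tsum_eq_sum (s := Finset.Ico 0 n) fun k hk => if_neg hk, Finset.mul_sum]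
    refine Finset.sum_congr rfl fun k hk => ?_
    rw [if_pos hk]
    ring
  simp_rw [h1]
  -- The ratios w k / w n are at most 1 and tend to 0 for each fixed k, so f dominates the series.
  have h2 := tendsto_tsum_of_dominated_convergence (𝓕 := atTop) (β := ℕ)
    (f := fun n k => if k ∈ Finset.Ico 0 n then w k / w n * f k else 0)
    (g := fun _ => (0 : ℝ)) (bound := f) hf ?_ ?_
  · simpa using h2
  · intro k
    have h3 : Tendsto (fun n => w k / w n * f k) atTop (𝓝 0) := by
      simpa using (hwtop.const_div_atTop (w k)).mul_const (f k)
    refine squeeze_zero (fun n => ?_) (fun n => ?_) h3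
    · split_ifs
      · have := hw0 k; have := hw0 n; have := hf0 k; positivity
      · exact le_rfl
    · split_ifs
      · exact le_rfl
      · have := hw0 k; have := hw0 n; have := hf0 k; positivity
  · refine Eventually.of_forall fun n k => ?_
    split_ifs with hk
    · have h4 : w k / w n ≤ 1 :=
        div_le_one_of_le₀ (hw (Finset.mem_Ico.1 hk).2.le) (hw0 n)
      have h5 : 0 ≤ w k / w n := div_nonneg (hw0 k) (hw0 n)
      rw [Real.norm_of_nonneg (mul_nonneg h5 (hf0 k))]
      exact mul_le_of_le_one_left (hf0 k) h4
    · simpa using hf0 k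

/-- Telescoping bound on t^(-3/2), based on 1/a - 1/b = 1/(ab(a + b)) for a² = t - 1 and b² = t. It
produces the term in 1/√(T_r - 1) of `xi`. -/
theorem inv_mul_sqrt_le {t : ℝ} (ht : 1 < t) :
    1 / (t * √t) ≤ 2 * (1 / √(t - 1) - 1 / √t) := by
  have h1 : 0 < √(t - 1) := Real.sqrt_pos.2 (by linarith)
  have h2 : 0 < √t := Real.sqrt_pos.2 (by linarith)
  have h3 : √(t - 1) ^ 2 = t - 1 := Real.sq_sqrt (by linarith)
  have h4 : √t ^ 2 = t := Real.sq_sqrt (by linarith)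
  have h5 : √(t - 1) ≤ √t := Real.sqrt_le_sqrt (by linarith)
  set a := √(t - 1)
  set b := √t
  have h6 : 1 / a - 1 / b = 1 / (a * b * (a + b)) := by
    field_simp
    nlinarith
  rw [h6, ← h4, mul_one_div, div_le_div_iff₀ (by positivity) (by positivity)]
  nlinarith [mul_nonneg h2.le (sub_nonneg.2 h5), mul_nonneg (mul_nonneg h2.le h1.le)
    (sub_nonneg.2 h5), mul_nonneg (mul_nonneg h2.le h2.le) (sub_nonneg.2 h5)]

theorem sum_range_sub_sum_range_le_tsum {β : ℕ → ℝ} (hβ : Summable β) (h0 : ∀ r, 0 ≤ β r)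
    {r L : ℕ} (h : r ≤ L) :
    ∑ k ∈ Finset.range L, β k - ∑ k ∈ Finset.range r, β k ≤ ∑' k, β (r + k) := by
  obtain ⟨n, rfl⟩ := Nat.exists_eq_add_of_le h
  rw [Finset.sum_range_add, add_sub_cancel_left]
  exact Summable.sum_le_tsum _ (fun k _ => h0 _) (hβ.comp_injective (add_right_injective r))

variable {δ β : ℕ → ℝ}

/-- Boundedness is essential here, because the real supremum of an unbounded family is 0 by
convention; it comes from δ ≤ 1, and from the sum of β in `le_betaStar`. -/
theorem le_deltaStar (h1 : ∀ t, δ t ≤ 1) {T t : ℕ} (h : T ≤ t) :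
    1 / (t : ℝ) * ∑ s ∈ Finset.Ico 1 t, δ s ≤ deltaStar δ T := by
  refine le_ciSup (f := fun t : {t : ℕ // T ≤ t} =>
    1 / ((t : ℕ) : ℝ) * ∑ s ∈ Finset.Ico 1 (t : ℕ), δ s) ⟨1, ?_⟩ ⟨t, h⟩
  rintro _ ⟨⟨t, ht⟩, rfl⟩
  have h2 : ∑ s ∈ Finset.Ico 1 t, δ s ≤ t := by
    calc ∑ s ∈ Finset.Ico 1 t, δ s ≤ ∑ _s ∈ Finset.Ico 1 t, (1 : ℝ) :=
          Finset.sum_le_sum fun s _ => h1 s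
      _ ≤ t := by simp
  dsimp only
  rw [one_div_mul_eq_div]
  exact div_le_one_of_le₀ h2 (Nat.cast_nonneg _)

theorem le_betaStar (hβ : Summable β) (h0 : ∀ r, 0 ≤ β r) {r k : ℕ} (h : r ≤ k) :
    1 / (2 : ℝ) ^ k * ∑ j ∈ Finset.range k, 2 ^ j * β j ≤ betaStar β r := by
  refine le_ciSup (f := fun k : {k : ℕ // r ≤ k} =>
    1 / (2 : ℝ) ^ (k : ℕ) * ∑ j ∈ Finset.range (k : ℕ), 2 ^ j * β j) ⟨∑' j, β j, ?_⟩ ⟨k, h⟩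
  rintro _ ⟨⟨k, hk⟩, rfl⟩
  dsimp only
  refine le_trans ?_ (Summable.sum_le_tsum (Finset.range k) (fun j _ => h0 j) hβ)
  rw [Finset.mul_sum]
  refine Finset.sum_le_sum fun j hj => ?_
  rw [← mul_assoc, one_div_mul_eq_div]
  refine mul_le_of_le_one_left (h0 j) (div_le_one_of_le₀ ?_ (by positivity))
  exact pow_le_pow_right₀ one_le_two (Finset.mem_range.1 hj).le

/-- The weighted-average lemma with weights t and the summable terms δ_t / t; `tendsto_betaStar`
uses the weights 2^k instead. -/
theorem tendsto_deltaStar (h0 : ∀ t, 0 ≤ δ t) (hsum : Summable fun t : ℕ => 1 / (t : ℝ) * δ t) :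
    Tendsto (deltaStar δ) atTop (𝓝 0) := by
  refine tendsto_iSup_tail (u := fun t => 1 / (t : ℝ) * ∑ s ∈ Finset.Ico 1 t, δ s)
    (fun t => mul_nonneg (by positivity) (Finset.sum_nonneg fun s _ => h0 s)) ?_
  have h := tendsto_weighted_average (w := fun n : ℕ => (n : ℝ))
    (fun n => Nat.cast_nonneg n) Nat.mono_cast tendsto_natCast_atTop_atTop hsum
    (fun n => mul_nonneg (by positivity) (h0 n))
  refine squeeze_zero (fun t => mul_nonneg (by positivity) (Finset.sum_nonneg fun s _ => h0 s))
    (fun t => ?_) h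
  refine mul_le_mul_of_nonneg_left ?_ (by positivity)
  calc ∑ s ∈ Finset.Ico 1 t, δ s = ∑ s ∈ Finset.Ico 1 t, (s : ℝ) * (1 / (s : ℝ) * δ s) := by
        refine Finset.sum_congr rfl fun s hs => ?_
        have : (s : ℝ) ≠ 0 := Nat.cast_ne_zero.2 (Nat.one_le_iff_ne_zero.1 (Finset.mem_Ico.1 hs).1)
        field_simp
    _ ≤ _ := Finset.sum_le_sum_of_subset_of_nonneg
        (Finset.Ico_subset_Ico_left zero_le_one)
        fun s _ _ => mul_nonneg (by positivity) (mul_nonneg (by positivity) (h0 s))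

theorem tendsto_betaStar (hβ : Summable β) (h0 : ∀ r, 0 ≤ β r) :
    Tendsto (betaStar β) atTop (𝓝 0) := by
  refine tendsto_iSup_tail (u := fun k => 1 / (2 : ℝ) ^ k * ∑ j ∈ Finset.range k, 2 ^ j * β j)
    (fun k => mul_nonneg (by positivity) (Finset.sum_nonneg fun s _ =>
      mul_nonneg (by positivity) (h0 s))) ?_
  have h := tendsto_weighted_average (w := fun n : ℕ => (2 : ℝ) ^ n)
    (fun n => by positivity) (fun m n h => pow_le_pow_right₀ one_le_two h)
    (tendsto_pow_atTop_atTop_of_one_lt one_lt_two) hβ h0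
  simpa [Nat.Ico_zero_eq_range] using h

theorem tendsto_xi (M B R : ℝ) (hβ : Summable β) (hβ0 : ∀ r, 0 ≤ β r) (hδ0 : ∀ t, 0 ≤ δ t)
    (hδ : Summable fun t : ℕ => 1 / (t : ℝ) * δ t) :
    Tendsto (xi M B R β δ) atTop (𝓝 0) := by
  have hpow : Tendsto (fun r : ℕ => (2 : ℝ) ^ r) atTop atTop :=
    tendsto_pow_atTop_atTop_of_one_lt one_lt_two
  have hpowN : Tendsto (fun r : ℕ => 2 ^ r) atTop atTop :=
    tendsto_pow_atTop_atTop_of_one_lt one_lt_two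
  have h1 : Tendsto (fun r : ℕ => (1 + 2 / (√2 - 1) ^ 2) * (rateConst M B R / 2 ^ r)) atTop
      (𝓝 0) := by
    simpa using (hpow.const_div_atTop (rateConst M B R)).const_mul (1 + 2 / (√2 - 1) ^ 2)
  have h2 : Tendsto (fun r : ℕ => 16 * M * (√(2 * rateConst M B R) /
      ((√2 - 1) * √(2 ^ r - 1)))) atTop (𝓝 0) := by
    have h3 : Tendsto (fun r : ℕ => √((2 : ℝ) ^ r - 1)) atTop atTop :=
      Real.tendsto_sqrt_atTop.comp (tendsto_atTop_add_const_right _ (-1) hpow)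
    have h4 := (h3.const_div_atTop (√(2 * rateConst M B R) / (√2 - 1))).const_mul (16 * M)
    simpa [div_div] using h4
  have h3 : Tendsto (fun r : ℕ => 4 * B * ∑' k, β (r + k)) atTop (𝓝 0) := by
    have := (tendsto_sum_nat_add β).const_mul (4 * B)
    simpa [add_comm] using this
  have h4 := (tendsto_deltaStar hδ0 hδ).comp hpowN
  have h5 := tendsto_betaStar hβ hβ0
  have h6 : Tendsto (fun r : ℕ => ∑' k : ℕ, 1 / ((2 ^ r + k : ℕ) : ℝ) * δ (2 ^ r + k)) atTop
      (𝓝 0) := by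
    have := (tendsto_sum_nat_add fun t : ℕ => 1 / (t : ℝ) * δ t).comp hpowN
    refine this.congr fun r => ?_
    simp only [Function.comp_apply]
    exact tsum_congr fun k => by rw [add_comm k]
  have h7 : Tendsto (fun r => M * deltaStar δ (2 ^ r) + betaStar β r) atTop (𝓝 0) := by
    simpa using (h4.const_mul M).add h5
  have h8 := (h7.const_mul 32).mul (h7.add (h6.const_mul M))
  have h9 := ((h1.add h2).add h3).add h8
  rw [show (0 : ℝ) + 0 + 0 + 32 * 0 * (0 + M * 0) = 0 by ring] at h9
  exact h9

end Sequences

end FairApproach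

/-! ### The almost sure rate. -/

namespace FairApproach

/-- The sum of the drifts of the almost supermartingale. -/
theorem sum_increments_le {K M B c : ℝ} {β δ N : ℕ → ℝ} {r : ℕ} (hr : 1 ≤ r)
    (hK : 0 ≤ K) (hM : 0 ≤ M) (hB : 0 ≤ B) (hc : 0 ≤ c) (hδ0 : ∀ t, 0 ≤ δ t)
    (hδ1 : ∀ t, δ t ≤ 1) (hδ : Summable fun t : ℕ => 1 / (t : ℝ) * δ t) (hβ : Summable β)
    (hβ0 : ∀ k, 0 ≤ β k) (hN : ∀ t, 2 ^ r ≤ t → N t ≤ √K / √t + 4 * c) (n : ℕ) :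
    ∑ i ∈ Finset.range n, (K / (((2 ^ r + i : ℕ) : ℝ) + 1) ^ 2
        + 8 * M / ((2 ^ r + i : ℕ) : ℝ) * (N (2 ^ r + i) * δ (2 ^ r + i))
        + 4 * B * (∑ k ∈ Finset.range (Nat.log 2 (2 ^ r + i + 1)), β k
          - ∑ k ∈ Finset.range (Nat.log 2 (2 ^ r + i)), β k)) ≤
      K / 2 ^ r + 16 * M * (√K / √(2 ^ r - 1)) + 4 * B * ∑' k, β (r + k)
        + 32 * c * (M * ∑' k : ℕ, 1 / ((2 ^ r + k : ℕ) : ℝ) * δ (2 ^ r + k)) := by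
  have h2r : 2 ≤ 2 ^ r := by
    calc 2 = 2 ^ 1 := rfl
      _ ≤ 2 ^ r := Nat.pow_le_pow_right two_pos hr
  set T := 2 ^ r with hT
  -- A potential whose decrements dominate the increments, except for the part proportional to c,
  -- which is summed against δ_t / t.
  let f : ℕ → ℝ := fun i => K / ((T + i : ℕ) : ℝ) + 16 * M * (√K / √(((T + i : ℕ) : ℝ) - 1))
    - 4 * B * ∑ k ∈ Finset.range (Nat.log 2 (T + i)), β k
  have hterm : ∀ i, K / (((T + i : ℕ) : ℝ) + 1) ^ 2
        + 8 * M / ((T + i : ℕ) : ℝ) * (N (T + i) * δ (T + i))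
        + 4 * B * (∑ k ∈ Finset.range (Nat.log 2 (T + i + 1)), β k
          - ∑ k ∈ Finset.range (Nat.log 2 (T + i)), β k) ≤
      (f i - f (i + 1)) + 32 * c * (M * (1 / ((T + i : ℕ) : ℝ) * δ (T + i))) := by
    intro i
    have ht : 2 ≤ T + i := by omega
    have hcast : ((T + (i + 1) : ℕ) : ℝ) = ((T + i : ℕ) : ℝ) + 1 := by push_cast; ring
    simp only [f, hcast, add_sub_cancel_right]
    rw [← add_assoc T i 1]
    have hN' := hN (T + i) (Nat.le_add_right _ _)
    generalize T + i = t at *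
    have ht' : (2 : ℝ) ≤ t := by exact_mod_cast ht
    have h1 : K / ((t : ℝ) + 1) ^ 2 ≤ K / t - K / ((t : ℝ) + 1) := by
      rw [div_sub_div _ _ (by positivity) (by positivity), div_le_div_iff₀ (by positivity)
        (by positivity)]
      have : K * (t * (t + 1)) ≤ K * ((t : ℝ) + 1) ^ 2 := by gcongr; nlinarith
      nlinarith
    -- The bound on N is split: δ ≤ 1 suffices for the part in √K/√t, which becomes summable,
    -- whereas δ is kept with the part in c.
    have h2 : 8 * M / t * (N t * δ t) ≤ 8 * M * √K * (1 / (t * √t))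
        + 32 * c * (M * (1 / (t : ℝ) * δ t)) := by
      have hs : 0 < √(t : ℝ) := Real.sqrt_pos.2 (by linarith)
      have h3 : N t * δ t ≤ √K / √t + 4 * c * δ t := by
        calc N t * δ t ≤ (√K / √t + 4 * c) * δ t := by gcongr; exact hδ0 t
          _ = √K / √t * δ t + 4 * c * δ t := by ring
          _ ≤ √K / √t * 1 + 4 * c * δ t := by gcongr; exact hδ1 t
          _ = _ := by ring
      calc 8 * M / t * (N t * δ t) ≤ 8 * M / t * (√K / √t + 4 * c * δ t) := by gcongr
        _ = _ := by field_simp; ring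
    have h4 := mul_le_mul_of_nonneg_left (inv_mul_sqrt_le (t := t) (by linarith))
      (show 0 ≤ 8 * M * √K by positivity)
    have h5 : 8 * M * √K * (2 * (1 / √((t : ℝ) - 1) - 1 / √t)) =
        16 * M * (√K / √((t : ℝ) - 1)) - 16 * M * (√K / √t) := by ring
    linarith
  refine (Finset.sum_le_sum fun i _ => hterm i).trans ?_
  rw [Finset.sum_add_distrib, Finset.sum_range_sub', ← Finset.mul_sum, ← Finset.mul_sum]
  have h1 : f 0 - f n ≤ K / 2 ^ r + 16 * M * (√K / √(2 ^ r - 1)) + 4 * B * ∑' k, β (r + k) := by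
    have h2 : r ≤ Nat.log 2 (T + n) := Nat.le_log_of_pow_le one_lt_two (Nat.le_add_right _ _)
    have h3 := mul_le_mul_of_nonneg_left (sum_range_sub_sum_range_le_tsum hβ hβ0 h2)
      (show 0 ≤ 4 * B by positivity)
    have h4 : 0 ≤ K / ((T + n : ℕ) : ℝ) + 16 * M * (√K / √(((T + n : ℕ) : ℝ) - 1)) := by
      positivity
    have h5 : Nat.log 2 T = r := Nat.log_pow one_lt_two r
    have h6 : (T : ℝ) = 2 ^ r := by rw [hT]; push_cast; rfl
    simp only [f, add_zero, h5, h6]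
    linarith
  have h2 : ∑ i ∈ Finset.range n, 1 / ((T + i : ℕ) : ℝ) * δ (T + i) ≤
      ∑' k : ℕ, 1 / ((T + k : ℕ) : ℝ) * δ (T + k) :=
    Summable.sum_le_tsum _ (fun k _ => mul_nonneg (by positivity) (hδ0 _))
      (hδ.comp_injective (add_right_injective T))
  exact add_le_add h1 (by gcongr)

/-- Comparison of the bound on the maximal deviation with `xi`. -/
theorem add_le_xi {M B R c N sd sb : ℝ} {β δ : ℕ → ℝ} {r : ℕ}
    (hM : 0 ≤ M) (hB : 0 ≤ B) (hN0 : 0 ≤ N)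
    (hc : c = M * deltaStar δ (2 ^ r) + betaStar β r)
    (hN : N ≤ √(rateConst M B R) / √(2 ^ r) + 4 * c)
    (hsb : sb = ∑' k, β (r + k))
    (hsd : sd = ∑' k : ℕ, 1 / ((2 ^ r + k : ℕ) : ℝ) * δ (2 ^ r + k)) :
    N ^ 2 + (rateConst M B R / 2 ^ r + 16 * M * (√(rateConst M B R) / √(2 ^ r - 1))
      + 4 * B * sb + 32 * c * (M * sd)) ≤ xi M B R β δ r := by
  rw [xi, ← hc, ← hsb, ← hsd]
  have hK := rateConst_nonneg (R := R) hM hB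
  set K := rateConst M B R
  -- By (x + y)² ≤ 2x² + 2y² with y = 4c. The 2K/T_r joins the K/T_r of the increments, and 3 ≤ 1 +
  -- 2/(√2 - 1)².
  have h1 : N ^ 2 ≤ 2 * (K / 2 ^ r) + 32 * c ^ 2 := by
    have h2 : (√K / √(2 ^ r)) ^ 2 = K / 2 ^ r := by
      rw [div_pow, Real.sq_sqrt hK, Real.sq_sqrt (by positivity)]
    have h3 := pow_le_pow_left₀ hN0 hN 2
    nlinarith [sq_nonneg (√K / √(2 ^ r) - 4 * c)]
  have h4 : √K / √(2 ^ r - 1) ≤ √(2 * K) / ((√2 - 1) * √(2 ^ r - 1)) := by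
    rw [← div_div]
    gcongr
    exact sqrt_le_sqrt_two_mul_div _
  have h5 : 1 ≤ 1 / (√2 - 1) ^ 2 := by
    have h6 : (1 : ℝ) < √2 := Real.lt_sqrt_of_sq_lt (by norm_num)
    have h7 : √2 ^ 2 = (2 : ℝ) := Real.sq_sqrt (by norm_num)
    rw [one_le_div (by nlinarith)]
    nlinarith
  have h8 : 0 ≤ K / 2 ^ r := by positivity
  have h9 : 3 * (K / 2 ^ r) ≤ (1 + 2 / (√2 - 1) ^ 2) * (K / 2 ^ r) := by
    gcongr
    have : 2 / (√2 - 1) ^ 2 = 2 * (1 / (√2 - 1) ^ 2) := by ring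
    linarith
  have h10 := mul_le_mul_of_nonneg_left h4 (show 0 ≤ 16 * M by positivity)
  have h11 : 32 * c * (c + M * sd) = 32 * c ^ 2 + 32 * c * (M * sd) := by ring
  linarith

namespace Game

universe v

variable {A B X : Type*} {S : Type v} {Y : Type*} {d : ℕ}
  [MeasurableSpace A] [MeasurableSpace B] [MeasurableSpace X] [MeasurableSpace S]
  [MeasurableSpace Y]

variable (Γ : Game A B X S Y d) {σ : PlayerStrategy A X S d} {τ : NatureStrategy A B X S Y}
  {Chat : SetEstimator X S d} {C : Set (Vec d)} {B' R : ℝ} {β : ℕ → ℝ}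
  {Qhat : ∀ t : ℕ, Kernel (Fin t → Seen X S d) (X × S)}

theorem monotone_comap_fullHist :
    Monotone fun t => MeasurableSpace.comap
      (fullHist t : (ℕ → Outcome A B X S) → Fin t → Outcome A B X S) inferInstance := by
  intro s t hst
  have : (fullHist s : (ℕ → Outcome A B X S) → Fin s → Outcome A B X S) =
      (fun H i => H (Fin.castLE hst i)) ∘ fullHist t := rfl
  dsimp only
  rw [this, ← MeasurableSpace.comap_comp]
  exact MeasurableSpace.comap_mono (Measurable.comap_le
    (measurable_pi_lambda _ fun _ => measurable_pi_apply _))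

theorem dist_le_const (hC : C.Nonempty) :
    ∃ c : ℝ, ∀ t, t ≠ 0 → ∀ ω : ℕ → Outcome A B X S, Γ.dist C t ω ≤ c := by
  obtain ⟨v, hv⟩ := hC
  refine ⟨Γ.supNorm + ‖v‖, fun t ht ω => ?_⟩
  refine (infDist_le_dist_of_mem hv).trans ?_
  rw [dist_eq_norm]
  exact (norm_sub_le _ _).trans
    (by gcongr; exact Γ.norm_le_of_mem_convexHull (Γ.avg_hist_mem_convexHull ht ω))

/-- The estimates of the target set are eventually close to it. -/
theorem SetEstimation.sq_mul_real_exists_le {Γ : Game A B X S Y d}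
    (hE : Γ.SetEstimation Chat C σ τ B' β) (r : ℕ) {ε : ℝ} (hε : 0 < ε) :
    (Γ.law σ τ).real {ω | ∃ k, ε ≤ (Γ.excL Chat C (r + k) ω).toReal} ≤
      1 / ε ^ 2 * ∑' k, β (r + k) ^ 2 := by
  have hsq : Summable fun k => β (r + k) ^ 2 := by
    refine Summable.of_nonneg_of_le (fun _ => sq_nonneg _) (fun k => ?_)
      ((hE.summable.comp_injective (add_right_injective r)).mul_left (β 0))
    rw [sq]
    exact mul_le_mul_of_nonneg_right (hE.antitone (Nat.zero_le _)) (hE.beta_nonneg _)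
  -- Chebyshev's inequality for each estimate; a union bound over the phases follows.
  have hmk : ∀ k, Γ.law σ τ {ω | ε ≤ (Γ.excL Chat C (r + k) ω).toReal} ≤
      ENNReal.ofReal (1 / ε ^ 2 * β (r + k) ^ 2) := by
    intro k
    have hε' : ENNReal.ofReal (ε ^ 2) ≠ 0 := (ENNReal.ofReal_pos.2 (pow_pos hε 2)).ne'
    have h1 := mul_meas_ge_le_lintegral (μ := Γ.law σ τ)
      ((Γ.measurable_excL Chat C (r + k)).pow_const 2) (ENNReal.ofReal (ε ^ 2))
    have h2 : {ω | ε ≤ (Γ.excL Chat C (r + k) ω).toReal} ⊆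
        {ω | ENNReal.ofReal (ε ^ 2) ≤ Γ.excL Chat C (r + k) ω ^ 2} := by
      intro ω hω
      have h3 : ENNReal.ofReal ε ≤ Γ.excL Chat C (r + k) ω :=
        ENNReal.ofReal_le_of_le_toReal hω
      rw [Set.mem_ofPred_eq, ENNReal.ofReal_pow hε.le]
      gcongr
    have h4 : ENNReal.ofReal (ε ^ 2) * Γ.law σ τ {ω | ε ≤ (Γ.excL Chat C (r + k) ω).toReal} ≤
        ENNReal.ofReal (β (r + k) ^ 2) :=
      (mul_le_mul_right (measure_mono h2) _).trans (h1.trans (hE.excess_left (r + k)))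
    rw [one_div_mul_eq_div, ENNReal.ofReal_div_of_pos (by positivity),
      ENNReal.le_div_iff_mul_le (Or.inl hε') (Or.inl ENNReal.ofReal_ne_top), mul_comm]
    exact h4
  have hset : {ω | ∃ k, ε ≤ (Γ.excL Chat C (r + k) ω).toReal} =
      ⋃ k, {ω | ε ≤ (Γ.excL Chat C (r + k) ω).toReal} := by
    ext ω; simp
  rw [hset, ← tsum_mul_left]
  refine ENNReal.toReal_le_of_le_ofReal (tsum_nonneg fun k => by positivity) ?_
  rw [ENNReal.ofReal_tsum_of_nonneg (fun k => by positivity) (hsq.mul_left _)]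
  exact (measure_iUnion_le _).trans (ENNReal.tsum_le_tsum hmk)

variable [Fintype A] [MeasurableSingletonClass A] [Fintype B] [MeasurableSingletonClass B]
  [Nonempty A] [Nonempty B] [StandardBorelSpace X] [Fintype S] [MeasurableSingletonClass S]

/-- The error terms are made uniform over t ≥ 2^r, as the summation of the increments requires. -/
theorem IsPhaseStrategy.curNorm_le_of_two_pow_le {Γ : Game A B X S Y d}
    (hQhat : ∀ t, IsMarkovKernel (Qhat t)) (hσ : Γ.IsPhaseStrategy Qhat Chat σ)
    (hC : C.Nonempty) (hB : Γ.Blackwell C) (hE : Γ.SetEstimation Chat C σ τ B' β)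
    (hR : Γ.StepBound Chat σ τ R) {r t : ℕ} (ht : 2 ^ r ≤ t) :
    Γ.curNorm σ τ Chat t ≤ √(rateConst Γ.supNorm B' R) / √t
      + 4 * (Γ.supNorm * deltaStar (Γ.tvErr Qhat σ τ) (2 ^ r) + betaStar β r) := by
  have ht1 : 1 ≤ t := Nat.one_le_two_pow.trans ht
  have htpos : (0 : ℝ) < t := by positivity
  refine (hσ.curNorm_le hQhat hC hB hE hR ht1).trans ?_
  have h1 := le_deltaStar (fun s => Γ.tvErr_le_one (σ := σ) (τ := τ) hQhat s) ht
  have h2 := le_betaStar hE.summable hE.beta_nonneg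
    (Nat.le_log_of_pow_le one_lt_two ht)
  have h3 : 4 * Γ.supNorm / t * ∑ s ∈ Finset.Ico 1 t, Γ.tvErr Qhat σ τ s ≤
      4 * (Γ.supNorm * deltaStar (Γ.tvErr Qhat σ τ) (2 ^ r)) := by
    have := mul_le_mul_of_nonneg_left h1
      (show 0 ≤ 4 * Γ.supNorm by have := Γ.supNorm_nonneg; positivity)
    calc _ = _ := by ring
      _ ≤ _ := this
      _ = _ := by ring
  have h4 : 4 / t * ∑ k ∈ Finset.range (Nat.log 2 t), 2 ^ k * β k ≤ 4 * betaStar β r := by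
    have h5 : (2 : ℝ) ^ Nat.log 2 t ≤ t := by
      exact_mod_cast Nat.pow_log_le_self 2 (Nat.one_le_iff_ne_zero.1 ht1)
    calc 4 / t * ∑ k ∈ Finset.range (Nat.log 2 t), 2 ^ k * β k
        = 4 * (1 / t * ∑ k ∈ Finset.range (Nat.log 2 t), 2 ^ k * β k) := by ring
      _ ≤ 4 * (1 / 2 ^ Nat.log 2 t * ∑ k ∈ Finset.range (Nat.log 2 t), 2 ^ k * β k) := by
        gcongr
        exact Finset.sum_nonneg fun k _ => mul_nonneg (by positivity) (hE.beta_nonneg k)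
      _ ≤ _ := by gcongr
  linarith

/-- The maximal inequality for the distances to the current estimates. -/
theorem IsPhaseStrategy.mul_real_exists_curDist_le {Γ : Game A B X S Y d}
    (hQhat : ∀ t, IsMarkovKernel (Qhat t)) (hσ : Γ.IsPhaseStrategy Qhat Chat σ)
    (hC : C.Nonempty) (hB : Γ.Blackwell C) (hF : Γ.FastEstimation Qhat σ τ)
    (hE : Γ.SetEstimation Chat C σ τ B' β)
    (hR : Γ.StepBound Chat σ τ R) {r : ℕ} (hr : 1 ≤ r) (l : ℝ) :
    l * (Γ.law σ τ).real {ω | ∃ t, 2 ^ r ≤ t ∧ l ≤ Γ.curDist Chat t ω ^ 2} ≤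
      xi Γ.supNorm B' R β (Γ.tvErr Qhat σ τ) r := by
  have hM := Γ.supNorm_nonneg
  have hB0 := hE.bound_nonneg
  have hc0 : 0 ≤ Γ.supNorm * deltaStar (Γ.tvErr Qhat σ τ) (2 ^ r) + betaStar β r := by
    refine add_nonneg (mul_nonneg hM (Real.iSup_nonneg fun t => ?_)) (Real.iSup_nonneg fun k => ?_)
    · exact mul_nonneg (by positivity) (Finset.sum_nonneg fun s _ => Γ.tvErr_nonneg s)
    · exact mul_nonneg (by positivity)
        (Finset.sum_nonneg fun s _ => mul_nonneg (by positivity) (hE.beta_nonneg s))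
  have hne : ∀ t, 2 ^ r ≤ t → t ≠ 0 := fun t ht =>
    Nat.one_le_iff_ne_zero.1 (Nat.one_le_two_pow.trans ht)
  have hsum := sum_increments_le hr (rateConst_nonneg (R := R) hM hB0) hM hB0 hc0
    (fun t => Γ.tvErr_nonneg t) (fun s => Γ.tvErr_le_one (σ := σ) (τ := τ) hQhat s) hF
    hE.summable hE.beta_nonneg
    (fun t ht => hσ.curNorm_le_of_two_pow_le hQhat hC hB hE hR ht)
  have h1 := mul_real_exists_ge_le (μ := Γ.law σ τ) (T := 2 ^ r)
    (D := fun t ω => Γ.curDist Chat t ω ^ 2)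
    (x := fun t => rateConst Γ.supNorm B' R / ((t : ℝ) + 1) ^ 2
      + 8 * Γ.supNorm / t * (Γ.curNorm σ τ Chat t * Γ.tvErr Qhat σ τ t)
      + 4 * B' * (∑ k ∈ Finset.range (Nat.log 2 (t + 1)), β k
        - ∑ k ∈ Finset.range (Nat.log 2 t), β k))
    (monotone_comap_fullHist (A := A) (B := B) (X := X) (S := S))
    (fun t => (measurable_fullHist t).comap_le) (fun t ht => ?_) (fun _ _ => sq_nonneg _)
    (fun t ht => (hE.memLp_estDist _ (hne t ht)).integrable_sq)
    (fun t ht E hE' => ?_) l hsum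
  · refine h1.trans ?_
    have h2 : ∫ ω, Γ.curDist Chat (2 ^ r) ω ^ 2 ∂Γ.law σ τ = Γ.curNorm σ τ Chat (2 ^ r) ^ 2 :=
      (Real.sq_sqrt (integral_nonneg fun _ => sq_nonneg _)).symm
    rw [h2]
    have h3 := hσ.curNorm_le_of_two_pow_le hQhat hC hB hE hR (le_refl (2 ^ r))
    push_cast at h3
    exact add_le_xi hM hB0 (Real.sqrt_nonneg _) rfl h3 rfl rfl
  · have h2 : (fun ω => Γ.curDist Chat t ω ^ 2) =
        (fun H => ‖Γ.curDir Chat (hne t ht) H‖ ^ 2) ∘ fullHist t := by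
      funext ω
      simp only [Function.comp_apply, norm_curDir]
      rfl
    rw [h2]
    exact ((Γ.measurable_curDir (hne t ht)).norm.pow_const 2).comp (comap_measurable _)
  · obtain ⟨G, hG, rfl⟩ := hE'
    exact hσ.setIntegral_curDist_succ_le hQhat hC hB hE hR (hne t ht) hG

/-- The almost sure rate. -/
theorem IsPhaseStrategy.real_iSup_dist_ge_le {Γ : Game A B X S Y d}
    (hQhat : ∀ t, IsMarkovKernel (Qhat t)) (hσ : Γ.IsPhaseStrategy Qhat Chat σ)
    (hC : C.Nonempty) (hB : Γ.Blackwell C) (hF : Γ.FastEstimation Qhat σ τ)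
    (hE : Γ.SetEstimation Chat C σ τ B' β)
    (hR : Γ.StepBound Chat σ τ R) {r : ℕ} (hr : 1 ≤ r) {ε : ℝ} (hε : 0 < ε) :
    (Γ.law σ τ).real {ω | 2 * ε ≤ ⨆ t : {t : ℕ // 2 ^ r ≤ t}, Γ.dist C t ω} ≤
      xi Γ.supNorm B' R β (Γ.tvErr Qhat σ τ) r / ε ^ 2 + 1 / ε ^ 2 * ∑' k, β (r + k) ^ 2 := by
  set P := (Γ.law σ τ).real {ω | 2 * ε ≤ ⨆ t : {t : ℕ // 2 ^ r ≤ t}, Γ.dist C t ω}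
  set Ξ := xi Γ.supNorm B' R β (Γ.tvErr Qhat σ τ) r
  set sb := ∑' k, β (r + k) ^ 2
  -- The supremum may reach 2ε without any d_t doing so; a strictly smaller level 2e is exceeded at
  -- some t. Continuity in e then gives the bound at ε.
  have key : ∀ e, 0 < e → e < ε → P ≤ Ξ / e ^ 2 + 1 / e ^ 2 * sb := by
    intro e he heε
    have h1 : (Γ.law σ τ).real {ω | ∃ t, 2 ^ r ≤ t ∧ e ^ 2 ≤ Γ.curDist Chat t ω ^ 2} ≤
        Ξ / e ^ 2 := by
      rw [le_div_iff₀' (by positivity)]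
      exact hσ.mul_real_exists_curDist_le hQhat hC hB hF hE hR hr (e ^ 2)
    have h2 := hE.sq_mul_real_exists_le r he
    refine le_trans ?_ (add_le_add h1 h2)
    refine le_trans ?_ (measureReal_union_le _ _)
    refine ENNReal.toReal_mono (measure_ne_top _ _) (measure_mono_ae ?_)
    filter_upwards [hE.dist_le] with ω hω hmem
    have hne : Nonempty {t : ℕ // 2 ^ r ≤ t} := ⟨⟨2 ^ r, le_rfl⟩⟩
    have h3 : 2 * e < ⨆ t : {t : ℕ // 2 ^ r ≤ t}, Γ.dist C t ω :=
      lt_of_lt_of_le (by linarith) hmem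
    obtain ⟨⟨t, ht⟩, h4⟩ := exists_lt_of_lt_ciSup h3
    have h5 := hω (Nat.log 2 t) t
    -- As d_t > 2e is at most the distance to the current estimate plus the excess of that estimate
    -- over C, one of the two is at least e.
    rcases le_or_gt e (Γ.curDist Chat t ω) with h6 | h6
    · exact Or.inl ⟨t, ht, pow_le_pow_left₀ he.le h6 2⟩
    · refine Or.inr ⟨Nat.log 2 t - r, ?_⟩
      rw [Nat.add_sub_cancel' (Nat.le_log_of_pow_le one_lt_two ht)]
      simp only at h4
      unfold curDist at h6
      linarith
  have hcont : ContinuousAt (fun e : ℝ => Ξ / e ^ 2 + 1 / e ^ 2 * sb) ε := by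
    have : ε ^ 2 ≠ 0 := by positivity
    fun_prop (disch := assumption)
  have htend : Tendsto (fun e : ℝ => Ξ / e ^ 2 + 1 / e ^ 2 * sb) (𝓝[<] ε)
      (𝓝 (Ξ / ε ^ 2 + 1 / ε ^ 2 * sb)) := hcont.tendsto.mono_left nhdsWithin_le_nhds
  refine ge_of_tendsto htend ?_
  filter_upwards [Ioo_mem_nhdsLT hε] with e he using key e he.1 he.2

end Game

end FairApproach

/-! ### Sufficiency of Blackwell's condition. -/

namespace FairApproach

/-- The estimator that always returns the same set. -/
def SetEstimator.const (X S : Type*) [MeasurableSpace X] [MeasurableSpace S] {d : ℕ}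
    {C : Set (Vec d)} (h1 : C.Nonempty) (h2 : IsClosed C) (h3 : Convex ℝ C) :
    SetEstimator X S d where
  set _ _ := C
  nonempty _ _ := h1
  isClosed _ _ := h2
  convex _ _ := h3
  measurable _ _ _ := MeasurableSet.const _

namespace Game

universe v

variable {A B X : Type*} {S : Type v} {Y : Type*} {d : ℕ}
  [MeasurableSpace A] [MeasurableSpace B] [MeasurableSpace X] [MeasurableSpace S]
  [MeasurableSpace Y]

variable (Γ : Game A B X S Y d) {σ : PlayerStrategy A X S d} {τ : NatureStrategy A B X S Y}
  {Chat : SetEstimator X S d} {C : Set (Vec d)} {B' R : ℝ} {β : ℕ → ℝ}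
  {Qhat : ∀ t : ℕ, Kernel (Fin t → Seen X S d) (X × S)}

/-- The event that all tail suprema are at least 2ε has probability at most b ε r for every r ≥ 1,
hence zero; countably many ε = 1/(n+1) suffice. -/
theorem ae_tendsto_dist (hC : C.Nonempty) {b : ℝ → ℕ → ℝ}
    (hb : ∀ ε, 0 < ε → Tendsto (b ε) atTop (𝓝 0))
    (h : ∀ ε r, 0 < ε → 1 ≤ r →
      (Γ.law σ τ).real {ω | 2 * ε ≤ ⨆ t : {t : ℕ // 2 ^ r ≤ t}, Γ.dist C t ω} ≤ b ε r) :
    ∀ᵐ ω ∂Γ.law σ τ, Tendsto (fun t => Γ.dist C t ω) atTop (𝓝 0) := by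
  have h1 : ∀ n : ℕ, ∀ᵐ ω ∂Γ.law σ τ, ∃ r,
      (⨆ t : {t : ℕ // 2 ^ r ≤ t}, Γ.dist C t ω) < 2 * (1 / ((n : ℝ) + 1)) := by
    intro n
    have hε : 0 < 1 / ((n : ℝ) + 1) := by positivity
    rw [ae_iff]
    set E := {ω | ¬∃ r, (⨆ t : {t : ℕ // 2 ^ r ≤ t}, Γ.dist C t ω) < 2 * (1 / ((n : ℝ) + 1))}
    have h2 : ∀ r, 1 ≤ r → (Γ.law σ τ).real E ≤ b (1 / ((n : ℝ) + 1)) r := by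
      intro r hr
      refine le_trans (measureReal_mono fun ω hω => ?_) (h _ r hε hr)
      exact not_lt.1 fun h3 => hω ⟨r, h3⟩
    have h3 : (Γ.law σ τ).real E ≤ 0 := by
      refine ge_of_tendsto (hb _ hε) ?_
      filter_upwards [eventually_ge_atTop 1] with r hr using h2 r hr
    exact (measureReal_eq_zero_iff (measure_ne_top _ _)).1 (h3.antisymm measureReal_nonneg)
  obtain ⟨c, hc⟩ := Γ.dist_le_const (C := C) hC
  filter_upwards [ae_all_iff.2 h1] with ω hω
  refine tendsto_order.2 ⟨fun a ha => Eventually.of_forall fun t =>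
    ha.trans_le infDist_nonneg, fun a ha => ?_⟩
  obtain ⟨n, hn⟩ := exists_nat_one_div_lt (half_pos ha)
  obtain ⟨r, hr⟩ := hω n
  filter_upwards [eventually_ge_atTop (2 ^ r)] with t ht
  have h2 : Γ.dist C t ω ≤ ⨆ t : {t : ℕ // 2 ^ r ≤ t}, Γ.dist C t ω := by
    refine le_ciSup (f := fun t : {t : ℕ // 2 ^ r ≤ t} => Γ.dist C t ω) ⟨c, ?_⟩ ⟨t, ht⟩
    rintro _ ⟨⟨s, hs⟩, rfl⟩
    exact hc s (Nat.one_le_iff_ne_zero.1 (Nat.one_le_two_pow.trans hs)) ω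
  linarith

variable [Fintype A] [MeasurableSingletonClass A] [Fintype B] [MeasurableSingletonClass B]
  [Nonempty A] [Nonempty B] [StandardBorelSpace X] [Fintype S] [MeasurableSingletonClass S]

theorem IsPhaseStrategy.approaches {Γ : Game A B X S Y d}
    (hQhat : ∀ t, IsMarkovKernel (Qhat t)) (hσ : Γ.IsPhaseStrategy Qhat Chat σ)
    (hC : C.Nonempty) (hB : Γ.Blackwell C)
    (h : ∀ τ : NatureStrategy A B X S Y, Γ.FastEstimation Qhat σ τ ∧
      ∃ (B' : ℝ) (β : ℕ → ℝ), Γ.SetEstimation Chat C σ τ B' β) :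
    Γ.Approaches σ C := by
  intro τ
  obtain ⟨hF, B', β, hE⟩ := h τ
  refine Γ.ae_tendsto_dist hC (fun ε hε => ?_) fun ε r hε hr =>
    hσ.real_iSup_dist_ge_le hQhat hC hB hF hE hE.stepBound hr hε
  have h1 := tendsto_xi Γ.supNorm B' (B' + 2 * Γ.supNorm) hE.summable hE.beta_nonneg
    (fun t => Γ.tvErr_nonneg (Qhat := Qhat) (σ := σ) (τ := τ) t) hF
  have h2 : Tendsto (fun r => ∑' k, β (r + k) ^ 2) atTop (𝓝 0) := by
    have := tendsto_sum_nat_add fun k => β k ^ 2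
    simpa [add_comm] using this
  have h3 := (h1.div_const (ε ^ 2)).add (h2.const_mul (1 / ε ^ 2))
  rwa [zero_div, mul_zero, add_zero] at h3

/-- The Player may use the exact estimates Q and C, for which both assumptions hold with zero
errors. -/
theorem Blackwell.approachable {Γ : Game A B X S Y d} (h : Γ.Blackwell C) (hC : C.Nonempty)
    (hclosed : IsClosed C) (hconvex : Convex ℝ C) : Γ.Approachable C := by
  have hctx := Γ.isProbabilityMeasure_ctx
  let Qhat : ∀ t : ℕ, Kernel (Fin t → Seen X S d) (X × S) := fun t => Kernel.const _ Γ.ctx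
  have hQhat : ∀ t, IsMarkovKernel (Qhat t) := fun t => inferInstance
  obtain ⟨σ, hσ⟩ := Γ.exists_isPhaseStrategy Qhat hQhat (SetEstimator.const X S hC hclosed hconvex)
  refine ⟨σ, hσ.approaches hQhat hC h fun τ => ⟨?_, ?_⟩⟩
  · have : ∀ t, Γ.tvErr Qhat σ τ t = 0 := by
      intro t
      simp [tvErr, Qhat, tvDist_self]
    simp only [FastEstimation, this, mul_zero]
    exact summable_zero
  · obtain ⟨v, hv⟩ := hC
    have hexc : excess C C = 0 := (excess_eq_zero_iff hclosed).2 subset_rfl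
    refine ⟨Γ.supNorm + ‖v‖, fun _ => 0, antitone_const, summable_zero, ae_of_all _ ?_, ?_, ?_, ?_⟩
    · intro ω r w hw
      change ‖w - proj C w‖ ≤ _
      rw [norm_sub_proj ⟨v, hv⟩ hclosed]
      refine (infDist_le_dist_of_mem hv).trans ?_
      rw [dist_eq_norm]
      exact (norm_sub_le _ _).trans (by gcongr; exact Γ.norm_le_of_mem_payoffs hw)
    · intro r
      simp only [SetEstimator.const, subset_refl, Set.ofPred_true, probReal_univ]
      have : (0 : ℝ) ≤ 1 / (2 * 2 ^ r) := by positivity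
      linarith
    · intro r
      simp [SetEstimator.const, hexc]
    · intro r
      simp [SetEstimator.const, hexc]

end Game

end FairApproach

namespace FairApproach

/-! ### Closedness of sets of integrals of selections. -/

section Selections

/-- The image of a bounded closed convex set of a Hilbert space by a continuous linear map is
closed. -/
theorem isClosed_image_of_isBounded_convex {H E : Type*} [NormedAddCommGroup H]
    [InnerProductSpace ℝ H] [CompleteSpace H] [NormedAddCommGroup E] [NormedSpace ℝ E]
    (L : H →L[ℝ] E) {K : Set H} (hcl : IsClosed K) (hc : Convex ℝ K) (hb : Bornology.IsBounded K) :
    IsClosed (L '' K) := by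
  refine isClosed_of_closure_subset fun v hv => ?_
  -- Nested closed convex sets of approximate preimages. Their least-norm points converge, which
  -- replaces weak compactness of K.
  let F : ℕ → Set H := fun n => K ∩ {f | ‖L f - v‖ ≤ 1 / ((n : ℝ) + 1)}
  have hFne : ∀ n, (F n).Nonempty := by
    intro n
    obtain ⟨_, ⟨f, hf, rfl⟩, hlt⟩ := Metric.mem_closure_iff.1 hv (1 / ((n : ℝ) + 1)) (by positivity)
    exact ⟨f, hf, by rw [Set.mem_ofPred_eq, ← dist_eq_norm, dist_comm]; exact hlt.le⟩
  have hFcl : ∀ n, IsClosed (F n) := fun n =>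
    hcl.inter (isClosed_le (L.continuous.sub continuous_const).norm continuous_const)
  have hFc : ∀ n, Convex ℝ (F n) := by
    intro n
    refine hc.inter ?_
    have : {f | ‖L f - v‖ ≤ 1 / ((n : ℝ) + 1)} =
        L.toLinearMap ⁻¹' closedBall v (1 / ((n : ℝ) + 1)) := by
      ext f; simp [dist_eq_norm]
    rw [this]
    exact (convex_closedBall _ _).linear_preimage _
  have hFanti : ∀ {m n}, m ≤ n → F n ⊆ F m := by
    intro m n h f hf
    refine ⟨hf.1, ?_⟩
    have h1 : ‖L f - v‖ ≤ 1 / ((n : ℝ) + 1) := hf.2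
    exact h1.trans (Nat.one_div_le_one_div h)
  have hmin : ∀ n, ∃ f ∈ F n, ∀ w ∈ F n, inner ℝ (0 - f) (w - f) ≤ 0 := by
    intro n
    obtain ⟨f, hf, hf'⟩ :=
      exists_norm_eq_iInf_of_complete_convex (hFne n) (hFcl n).isComplete (hFc n) 0
    exact ⟨f, hf, (norm_eq_iInf_iff_real_inner_le_zero (hFc n) hf).1 hf'⟩
  choose f hf hfmin using hmin
  -- Obtuse angle at the projection f m of 0. As the norms increase and are bounded, the sequence is
  -- Cauchy.
  have hdist : ∀ {m n}, m ≤ n → ‖f n - f m‖ ^ 2 ≤ ‖f n‖ ^ 2 - ‖f m‖ ^ 2 := by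
    intro m n h
    have h1 := hfmin m (f n) (hFanti h (hf n))
    rw [zero_sub, inner_neg_left] at h1
    have h2 : ‖f n‖ ^ 2 = ‖f n - f m‖ ^ 2 + 2 * inner ℝ (f n - f m) (f m) + ‖f m‖ ^ 2 := by
      rw [← norm_add_sq_real, sub_add_cancel]
    rw [real_inner_comm] at h1
    linarith
  have hmono : Monotone fun n => ‖f n‖ ^ 2 := fun m n h => by
    have := hdist h
    dsimp only
    linarith [sq_nonneg ‖f n - f m‖]
  obtain ⟨c, hcK⟩ := hb.exists_norm_le
  have hbdd : BddAbove (Set.range fun n => ‖f n‖ ^ 2) := by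
    refine ⟨c ^ 2, ?_⟩
    rintro _ ⟨n, rfl⟩
    exact pow_le_pow_left₀ (norm_nonneg _) (hcK _ (hf n).1) 2
  have hcau := (tendsto_atTop_ciSup hmono hbdd).cauchySeq
  have hcauchy : CauchySeq f := by
    rw [Metric.cauchySeq_iff'] at hcau ⊢
    intro ε hε
    obtain ⟨N, hN⟩ := hcau (ε ^ 2) (by positivity)
    refine ⟨N, fun n hn => ?_⟩
    have h1 := hN n hn
    rw [Real.dist_eq] at h1
    rw [dist_eq_norm]
    exact lt_of_pow_lt_pow_left₀ 2 hε.le ((hdist hn).trans_lt ((le_abs_self _).trans_lt h1))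
  obtain ⟨g, hg⟩ := cauchySeq_tendsto_of_complete hcauchy
  have hgF : ∀ n, g ∈ F n := fun n => (hFcl n).mem_of_tendsto hg
    (eventually_atTop.2 ⟨n, fun m hm => hFanti hm (hf m)⟩)
  refine ⟨g, (hgF 0).1, ?_⟩
  rw [← sub_eq_zero, ← norm_le_zero_iff]
  exact ge_of_tendsto tendsto_one_div_add_atTop_nhds_zero_nat
    (Eventually.of_forall fun n => (hgF n).2)

variable {X Z E F G : Type*} [MeasurableSpace X] [MeasurableSpace Z]
  [NormedAddCommGroup E] [InnerProductSpace ℝ E] [FiniteDimensional ℝ E]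
  [MeasurableSpace E] [BorelSpace E]
  [NormedAddCommGroup F] [NormedSpace ℝ F]
  [NormedAddCommGroup G] [NormedSpace ℝ G] [CompleteSpace G]

theorem isClosed_ae_mem {ν : Measure X} {D : Set E} (hD : IsClosed D) :
    IsClosed {f : Lp E 2 ν | ∀ᵐ x ∂ν, f x ∈ D} := by
  refine IsSeqClosed.isClosed fun f g hf hg => ?_
  obtain ⟨ns, -, hns⟩ := (tendstoInMeasure_of_tendsto_Lp hg).exists_seq_tendsto_ae
  filter_upwards [hns, ae_all_iff.2 hf] with x h1 h2
  exact hD.mem_of_tendsto h1 (Eventually.of_forall fun n => h2 (ns n))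

theorem convex_ae_mem {ν : Measure X} {D : Set E} (hD : Convex ℝ D) :
    Convex ℝ {f : Lp E 2 ν | ∀ᵐ x ∂ν, f x ∈ D} := by
  intro f hf g hg a b ha hb hab
  filter_upwards [hf, hg, Lp.coeFn_add (a • f) (b • g), Lp.coeFn_smul a f, Lp.coeFn_smul b g]
    with x h1 h2 h3 h4 h5
  rw [h3, Pi.add_apply, h4, h5]
  exact hD h1 h2 ha hb hab

theorem isBounded_ae_mem {ν : Measure X} [IsProbabilityMeasure ν] {D : Set E}
    (hD : Bornology.IsBounded D) :
    Bornology.IsBounded {f : Lp E 2 ν | ∀ᵐ x ∂ν, f x ∈ D} := by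
  obtain ⟨c, hc0, hc⟩ := hD.exists_pos_norm_le
  rw [isBounded_iff_forall_norm_le]
  refine ⟨ν.real Set.univ ^ (2 : ℝ≥0∞).toReal⁻¹ * c, fun f hf => ?_⟩
  refine Lp.norm_le_of_ae_bound hc0.le ?_
  filter_upwards [hf] with x hx using hc _ hx

/-- The set of integrals `∫ B(f(π z), g(z)) dμ(z)`, where `f` ranges over the measurable functions
with values in a bounded closed convex set, is convex and closed. -/
theorem isClosed_convex_integral_selections {μ : Measure Z} [IsProbabilityMeasure μ] {π : Z → X}
    (hπ : Measurable π) {D : Set E} (hne : D.Nonempty) (hcl : IsClosed D) (hc : Convex ℝ D)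
    (hb : Bornology.IsBounded D) (T : E →L[ℝ] F →L[ℝ] G) {g : Z → F} (hg : MemLp g 2 μ) :
    IsClosed {v | ∃ f : X → E, Measurable f ∧ (∀ x, f x ∈ D) ∧ ∫ z, T (f (π z)) (g z) ∂μ = v} ∧
    Convex ℝ {v | ∃ f : X → E, Measurable f ∧ (∀ x, f x ∈ D) ∧ ∫ z, T (f (π z)) (g z) ∂μ = v} := by
  have hν : IsProbabilityMeasure (μ.map π) := Measure.isProbabilityMeasure_map hπ.aemeasurable
  have hmp : MeasurePreserving π μ (μ.map π) := ⟨hπ, rfl⟩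
  -- The integral is continuous and linear in the class of f in L² of the law of π, where the
  -- selections with values in D form a bounded closed convex set.
  let L : Lp E 2 (μ.map π) →L[ℝ] G := ((T.lpPairing μ 2 2).flip hg.toLp).comp
    (Lp.compMeasurePreservingₗᵢ ℝ π hmp).toContinuousLinearMap
  have hL : ∀ (f : Lp E 2 (μ.map π)) (f' : X → E), f =ᵐ[μ.map π] f' →
      L f = ∫ z, T (f' (π z)) (g z) ∂μ := by
    intro f f' hf
    change T.lpPairing μ 2 2 (Lp.compMeasurePreserving π hmp f) hg.toLp = _
    rw [ContinuousLinearMap.lpPairing_eq_integral]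
    refine integral_congr_ae ?_
    filter_upwards [Lp.coeFn_compMeasurePreserving f hmp, hg.coeFn_toLp,
      ae_of_ae_map hπ.aemeasurable hf] with z h1 h2 h3
    rw [h1, h2, Function.comp_apply, h3]
  have himage : {v | ∃ f : X → E, Measurable f ∧ (∀ x, f x ∈ D) ∧
      ∫ z, T (f (π z)) (g z) ∂μ = v} = L '' {f | ∀ᵐ x ∂μ.map π, f x ∈ D} := by
    ext v
    constructor
    · rintro ⟨f, hf, hfD, rfl⟩
      obtain ⟨c, hcD⟩ := hb.exists_norm_le
      have hmem : MemLp f 2 (μ.map π) := MemLp.of_bound hf.aestronglyMeasurable c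
        (ae_of_all _ fun x => hcD _ (hfD x))
      refine ⟨hmem.toLp, ?_, hL _ _ hmem.coeFn_toLp⟩
      filter_upwards [hmem.coeFn_toLp] with x hx
      rw [hx]
      exact hfD x
    · rintro ⟨f, hf, rfl⟩
      obtain ⟨e, he⟩ := hne
      have hfm : Measurable f := (Lp.stronglyMeasurable f).measurable
      classical
      -- A class in L² has values in D only almost everywhere; correcting a representative on a null
      -- set makes it a genuine selection.
      refine ⟨fun x => if f x ∈ D then f x else e,
        Measurable.ite (hfm hcl.measurableSet) hfm measurable_const, fun x => ?_, ?_⟩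
      · dsimp only
        split_ifs with h
        exacts [h, he]
      · refine (hL f (fun x => if f x ∈ D then f x else e) ?_).symm
        filter_upwards [hf] with x hx
        rw [if_pos hx]
  rw [himage]
  exact ⟨isClosed_image_of_isBounded_convex L (isClosed_ae_mem hcl) (convex_ae_mem hc)
    (isBounded_ae_mem hb), (convex_ae_mem hc).linear_image L.toLinearMap⟩

end Selections

end FairApproach

/-! ### Necessity of Blackwell's condition. -/

namespace FairApproach

namespace Game

universe v

variable {A B X : Type*} {S : Type v} {Y : Type*} {d : ℕ}
  [MeasurableSpace A] [MeasurableSpace B] [MeasurableSpace X] [MeasurableSpace S]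
  [MeasurableSpace Y]

variable (Γ : Game A B X S Y d) {σ : PlayerStrategy A X S d} {τ : NatureStrategy A B X S Y}
  {C : Set (Vec d)}
  [Fintype A] [MeasurableSingletonClass A] [Fintype B] [MeasurableSingletonClass B]

/-- The mean payoffs that the Player can reach against a family of mixed actions of Nature. -/
def responses (q : Kernel Y B) : Set (Vec d) :=
  {v | ∃ p : Kernel X A, IsMarkovKernel p ∧ Γ.meanPayoff Γ.ctx p q = v}

/-- A family of the Player is a measurable map from X to the simplex, and its mean payoff against q
is the integral of a bilinear pairing with a fixed bounded function g. The simplex lives in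
`EuclideanSpace` so that L² is a Hilbert space. -/
theorem isClosed_convex_responses [Nonempty A] (q : Kernel Y B) [IsMarkovKernel q] :
    IsClosed (Γ.responses q) ∧ Convex ℝ (Γ.responses q) := by
  have := Γ.isProbabilityMeasure_ctx
  let D : Set (EuclideanSpace ℝ A) := WithLp.ofLp ⁻¹' stdSimplex ℝ A
  have hcont : Continuous (WithLp.ofLp : EuclideanSpace ℝ A → A → ℝ) :=
    PiLp.continuous_ofLp 2 fun _ : A => ℝ
  have hne : D.Nonempty := by
    classical
    exact ⟨WithLp.toLp 2 (Pi.single (Classical.arbitrary A) 1), single_mem_stdSimplex ℝ _⟩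
  have hcl : IsClosed D := (isClosed_stdSimplex ℝ A).preimage hcont
  have hc : Convex ℝ D :=
    (convex_stdSimplex ℝ A).linear_preimage (WithLp.linearEquiv 2 ℝ (A → ℝ)).toLinearMap
  have hb : Bornology.IsBounded D := by
    have : D = WithLp.toLp 2 '' stdSimplex ℝ A := by
      ext e
      exact ⟨fun he => ⟨e.ofLp, he, rfl⟩, by rintro ⟨f, hf, rfl⟩; exact hf⟩
    rw [this]
    exact ((isCompact_stdSimplex ℝ A).image (PiLp.continuous_toLp 2 fun _ : A => ℝ)).isBounded
  let T : EuclideanSpace ℝ A →L[ℝ] (A → Vec d) →L[ℝ] Vec d :=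
    ∑ a, (ContinuousLinearMap.lsmul ℝ ℝ : ℝ →L[ℝ] Vec d →L[ℝ] Vec d).bilinearComp
      (EuclideanSpace.proj a) (ContinuousLinearMap.proj a)
  have hT : ∀ e g, T e g = ∑ a, e a • g a := by
    intro e g
    simp [T]
  let g : X × S → A → Vec d := fun z a =>
    ∑ b, (q (Γ.obs z)).real {b} • Γ.payoff a b z.1 z.2
  have hgm : Measurable g := measurable_pi_lambda _ fun a => Finset.measurable_sum _ fun b _ =>
    ((measurable_real_singleton q b).comp Γ.measurable_obs).smul (Γ.measurable_payoff_apply a b)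
  have hg : MemLp g 2 Γ.ctx := by
    refine MemLp.of_bound hgm.aestronglyMeasurable Γ.supNorm (ae_of_all _ fun z => ?_)
    refine (pi_norm_le_iff_of_nonneg Γ.supNorm_nonneg).2 fun a => ?_
    calc ‖g z a‖ ≤ ∑ b, (q (Γ.obs z)).real {b} * Γ.supNorm := by
          refine (norm_sum_le _ _).trans (Finset.sum_le_sum fun b _ => ?_)
          rw [norm_smul, Real.norm_of_nonneg measureReal_nonneg]
          gcongr
          exact Γ.norm_payoff_le _ _ _ _
      _ = Γ.supNorm := by
          rw [← Finset.sum_mul, (real_singleton_mem_stdSimplex (q (Γ.obs z))).2, one_mul]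
  have hmean : ∀ (p : Kernel X A) (f : X → EuclideanSpace ℝ A),
      (∀ x a, (p x).real {a} = f x a) →
      Γ.meanPayoff Γ.ctx p q = ∫ z, T (f z.1) (g z) ∂Γ.ctx := by
    intro p f hpf
    refine integral_congr_ae (ae_of_all _ fun z => ?_)
    simp only [mixedPayoff, hT, g, Finset.smul_sum, smul_smul, hpf]
  have hset : Γ.responses q = {v | ∃ f : X → EuclideanSpace ℝ A, Measurable f ∧
      (∀ x, f x ∈ D) ∧ ∫ z, T (f (Prod.fst z)) (g z) ∂Γ.ctx = v} := by
    ext v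
    constructor
    · rintro ⟨p, hp, rfl⟩
      refine ⟨fun x => WithLp.toLp 2 fun a => (p x).real {a}, ?_,
        fun x => real_singleton_mem_stdSimplex (p x), (hmean p
          (fun x => WithLp.toLp 2 fun a => (p x).real {a}) fun x a => rfl).symm⟩
      exact (WithLp.measurable_toLp 2 _).comp
        (measurable_pi_lambda _ fun a => measurable_real_singleton p a)
    · rintro ⟨f, hf, hfD, rfl⟩
      have hfm : Measurable fun x a => f x a :=
        (WithLp.measurable_ofLp 2 (A → ℝ)).comp hf
      exact ⟨weightKernel _ hfm, isMarkovKernel_weightKernel hfD, hmean _ _ fun x a =>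
        weightKernel_real_singleton _ hfm x a ((hfD x).1 a)⟩
  rw [hset]
  exact isClosed_convex_integral_selections measurable_fst hne hcl hc hb T hg

theorem isCompact_responses [Nonempty A] (q : Kernel Y B) [IsMarkovKernel q] :
    IsCompact (Γ.responses q) := by
  have := Γ.isProbabilityMeasure_ctx
  refine isCompact_of_isClosed_isBounded (Γ.isClosed_convex_responses q).1
    (isBounded_iff_forall_norm_le.2 ⟨Γ.supNorm, ?_⟩)
  rintro _ ⟨p, hp, rfl⟩
  exact Γ.norm_meanPayoff_le _ _ _

theorem integral_payoff_law (t : ℕ) :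
    ∫ ω, (Γ.see (ω t)).1 ∂Γ.law σ τ = ∫ ω, Γ.condMean σ τ t (fullHist t ω) ∂Γ.law σ τ := by
  refine ext_inner_left ℝ fun v => ?_
  have h := Γ.integral_inner_payoff_law (σ := σ) (τ := τ) t (u := fun _ => v) measurable_const
    (ae_of_all _ fun _ => le_rfl)
  rwa [integral_inner, integral_inner] at h
  · exact Integrable.of_bound ((Γ.measurable_condMean t).comp
      (measurable_fullHist t)).aestronglyMeasurable Γ.supNorm
      (ae_of_all _ fun ω => Γ.norm_condMean_le t _)
  · exact Integrable.of_bound (measurable_fst.comp (Γ.measurable_see.comp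
      (measurable_pi_apply t))).aestronglyMeasurable Γ.supNorm
      (ae_of_all _ fun ω => Γ.norm_payoff_le _ _ _ _)

/-- The strategy of Nature that always uses the same family of mixed actions. -/
def _root_.FairApproach.NatureStrategy.stationary (q : Kernel Y B) [IsMarkovKernel q] :
    NatureStrategy A B X S Y where
  mix _ := q.comap Prod.snd measurable_snd
  isMarkov _ := inferInstance

theorem integrable_avg {t : ℕ} (ht : t ≠ 0) :
    Integrable (fun ω => avg (Γ.hist t ω)) (Γ.law σ τ) :=
  Integrable.of_bound (measurable_avg.comp (Γ.measurable_hist t)).aestronglyMeasurable Γ.supNorm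
    (ae_of_all _ fun ω => Γ.norm_le_of_mem_convexHull (Γ.avg_hist_mem_convexHull ht ω))

/-- Against a stationary strategy of Nature, the expected average payoff is a response. -/
theorem integral_avg_mem_responses [Nonempty A] (q : Kernel Y B) [IsMarkovKernel q] {t : ℕ}
    (ht : t ≠ 0) :
    ∫ ω, avg (Γ.hist t ω) ∂Γ.law σ (NatureStrategy.stationary q) ∈ Γ.responses q := by
  have hctx := Γ.isProbabilityMeasure_ctx
  have ht' : (t : ℝ) ≠ 0 := Nat.cast_ne_zero.2 ht
  obtain ⟨hcl, hc⟩ := Γ.isClosed_convex_responses q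
  have hint : ∀ i, Integrable (fun ω : ℕ → Outcome A B X S => (Γ.see (ω i)).1)
      (Γ.law σ (NatureStrategy.stationary q)) := fun i =>
    Integrable.of_bound (measurable_fst.comp (Γ.measurable_see.comp
      (measurable_pi_apply i))).aestronglyMeasurable Γ.supNorm
      (ae_of_all _ fun ω => Γ.norm_payoff_le _ _ _ _)
  have h1 : ∫ ω, avg (Γ.hist t ω) ∂Γ.law σ (NatureStrategy.stationary q) =
      ∑ i : Fin t, (1 / (t : ℝ)) •
        ∫ ω, (Γ.see (ω i)).1 ∂Γ.law σ (NatureStrategy.stationary q) := by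
    simp only [avg]
    rw [integral_smul, ← Finset.smul_sum]
    congr 1
    exact integral_finsetSum _ fun i _ => hint i
  rw [h1]
  -- Against q, the conditional mean after each history is a response; averaging over histories and
  -- rounds stays in the closed convex set of responses.
  refine hc.sum_mem (fun _ _ => by positivity) (by simp [ht']) fun i _ => ?_
  rw [integral_payoff_law]
  refine hc.integral_mem hcl (ae_of_all _ fun ω => ?_) ?_
  · have := σ.isMarkov i
    exact ⟨(σ.mix i).sectR (Γ.seeAll (fullHist i ω)), inferInstance, rfl⟩
  · exact Integrable.of_bound ((Γ.measurable_condMean _).comp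
      (measurable_fullHist _)).aestronglyMeasurable Γ.supNorm
      (ae_of_all _ fun ω => Γ.norm_condMean_le _ _)

/-- Nature plays q forever. The expected averages are responses whose distance to C tends to 0, by
Jensen's inequality and dominated convergence; compactness of the responses provides one at distance
0. -/
theorem Approachable.blackwell [Nonempty A] {Γ : Game A B X S Y d} (h : Γ.Approachable C)
    (hC : C.Nonempty) (hclosed : IsClosed C) (hconvex : Convex ℝ C) : Γ.Blackwell C := by
  intro q hq
  obtain ⟨σ, hσ⟩ := h
  set μ := Γ.law σ (NatureStrategy.stationary q) with hμ
  have hae : ∀ᵐ ω ∂μ, Tendsto (fun t => Γ.dist C t ω) atTop (𝓝 0) := hσ _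
  obtain ⟨c, hc⟩ := Γ.dist_le_const (C := C) hC
  have hmeas : ∀ t, Measurable (Γ.dist C t) := fun t =>
    (continuous_infDist_pt C).measurable.comp (measurable_avg.comp (Γ.measurable_hist t))
  have hnn : ∀ t ω, 0 ≤ Γ.dist C t ω := fun _ _ => infDist_nonneg
  -- The index starts at t + 1 since the empty average is not an average of payoffs.
  have hlim : Tendsto (fun t => ∫ ω, Γ.dist C (t + 1) ω ∂μ) atTop (𝓝 0) := by
    have := tendsto_integral_of_dominated_convergence (μ := μ)
      (F := fun t ω => Γ.dist C (t + 1) ω) (f := fun _ => 0) (fun _ => c)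
      (fun t => (hmeas _).aestronglyMeasurable) (integrable_const c)
      (fun t => ae_of_all _ fun ω => ?_) ?_
    · simpa using this
    · rw [Real.norm_of_nonneg (hnn _ _)]
      exact hc _ (Nat.succ_ne_zero t) ω
    · filter_upwards [hae] with ω hω
      exact (tendsto_add_atTop_iff_nat 1).2 hω
  have hjensen : ∀ t, infDist (∫ ω, avg (Γ.hist (t + 1) ω) ∂μ) C ≤
      ∫ ω, Γ.dist C (t + 1) ω ∂μ := by
    intro t
    refine (convexOn_infDist_of_convex hC hconvex).map_integral_le
      (continuous_infDist_pt C).continuousOn isClosed_univ (ae_of_all _ fun _ => Set.mem_univ _)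
      (Γ.integrable_avg (Nat.succ_ne_zero t)) ?_
    refine Integrable.of_bound (hmeas (t + 1)).aestronglyMeasurable c (ae_of_all _ fun ω => ?_)
    change ‖Γ.dist C (t + 1) ω‖ ≤ c
    rw [Real.norm_of_nonneg (hnn _ _)]
    exact hc _ (Nat.succ_ne_zero t) ω
  have hmem : ∀ t, ∫ ω, avg (Γ.hist (t + 1) ω) ∂μ ∈ Γ.responses q := fun t =>
    Γ.integral_avg_mem_responses q (Nat.succ_ne_zero t)
  obtain ⟨v, ⟨p, hp, hpv⟩, hvmin⟩ := (Γ.isCompact_responses q).exists_isMinOn ⟨_, hmem 0⟩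
    (continuous_infDist_pt C).continuousOn
  refine ⟨p, hp, ?_⟩
  rw [hpv, hclosed.mem_iff_infDist_zero hC]
  refine le_antisymm (ge_of_tendsto hlim (Eventually.of_forall fun t => ?_)) infDist_nonneg
  exact (hvmin (hmem t)).trans (hjensen t)

end Game

end FairApproach

end

open FairApproach in
theorem theorem2 {A B X S Y : Type*} {d : ℕ}
    [Fintype A] [Nonempty A] [MeasurableSpace A] [MeasurableSingletonClass A]
    [Fintype B] [Nonempty B] [MeasurableSpace B] [MeasurableSingletonClass B]
    [MeasurableSpace X] [StandardBorelSpace X]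
    [Fintype S] [MeasurableSpace S] [MeasurableSingletonClass S]
    [MeasurableSpace Y]
    (Γ : Game A B X S Y d)
    (C : Set (Vec d)) (hC_nonempty : C.Nonempty) (hC_closed : IsClosed C)
    (hC_convex : Convex ℝ C)
    (Qhat : ∀ t : ℕ, Kernel (Fin t → Seen X S d) (X × S)) (hQhat : ∀ t, IsMarkovKernel (Qhat t))
    (Chat : SetEstimator X S d) :
    (Γ.Approachable C ↔ Γ.Blackwell C) ∧
    (Γ.Blackwell C →
      (∃ σ : PlayerStrategy A X S d, Γ.IsPhaseStrategy Qhat Chat σ) ∧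
      ∀ σ : PlayerStrategy A X S d, Γ.IsPhaseStrategy Qhat Chat σ →
        ((∀ τ : NatureStrategy A B X S Y, Γ.FastEstimation Qhat σ τ ∧
            ∃ (B' : ℝ) (β : ℕ → ℝ), Γ.SetEstimation Chat C σ τ B' β) →
          Γ.Approaches σ C) ∧
        ∀ (τ : NatureStrategy A B X S Y) (B' : ℝ) (β : ℕ → ℝ),
          Γ.FastEstimation Qhat σ τ → Γ.SetEstimation Chat C σ τ B' β →
          Γ.StepBound Chat σ τ (B' + 2 * Γ.supNorm) ∧
          ∀ R : ℝ, Γ.StepBound Chat σ τ R →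
            (∀ r t : ℕ, 1 ≤ r → 2 ^ r ≤ t → t < 2 ^ (r + 1) →
              √(∫ ω, Γ.dist C t ω ^ 2 ∂Γ.law σ τ) ≤
                l2Rate Γ.supNorm B' R β (Γ.tvErr Qhat σ τ) r t) ∧
            (∀ (r : ℕ) (ε : ℝ), 1 ≤ r → 0 < ε →
              (Γ.law σ τ).real {ω | 2 * ε ≤ ⨆ t : {t : ℕ // 2 ^ r ≤ t}, Γ.dist C t ω} ≤
                xi Γ.supNorm B' R β (Γ.tvErr Qhat σ τ) r / ε ^ 2
                  + 1 / ε ^ 2 * ∑' k, β (r + k) ^ 2) ∧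
            Tendsto (xi Γ.supNorm B' R β (Γ.tvErr Qhat σ τ)) atTop (𝓝 0)) := by
  refine ⟨⟨fun h => h.blackwell hC_nonempty hC_closed hC_convex,
    fun h => h.approachable hC_nonempty hC_closed hC_convex⟩, fun hB =>
    ⟨Γ.exists_isPhaseStrategy Qhat hQhat Chat, fun σ hσ =>
      ⟨fun h => hσ.approaches hQhat hC_nonempty hB h, fun τ B' β hF hE =>
        ⟨hE.stepBound, fun R hR => ⟨fun r t _ h1 h2 => ?_, fun r ε hr hε => ?_, ?_⟩⟩⟩⟩⟩
  · exact hσ.sqrt_integral_dist_sq_le hQhat hC_nonempty hB hE hR h1 h2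
  · exact hσ.real_iSup_dist_ge_le hQhat hC_nonempty hB hF hE hR hr hε
  · exact tendsto_xi Γ.supNorm B' R hE.summable hE.beta_nonneg (fun t => Γ.tvErr_nonneg t) hF
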